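/- Let $k$ be a field of characteristic different from $2$. All superalgebras are associative, unital, $\mathbb Z/2$-graded and commutative in the super sense; $\mathrm{(salg)}$ is their category, with parity-preserving unital $k$-algebra homomorphisms. A superscheme over $k$ is a topological space with a sheaf of superalgebras with local stalks that is locally isomorphic to $\underline{\mathrm{Spec}}\,A$, $A\in\mathrm{(salg)}$; morphisms are local on stalks. It is algebraic if it has a finite cover by open subsuperschemes $\underline{\mathrm{Spec}}\,A_i$ with $A_i$ a finitely generated superalgebra. An algebraic supergroup is an algebraic superscheme $G$ with a group structure on $G(A)=\mathrm{Hom}(\underline{\mathrm{Spec}}\,A,G)$, functorial in $A\in\mathrm{(salg)}$. For a superalgebra $A$ let $A(\epsilon)=A\oplus\epsilon A$ with $\epsilon$ even, $\epsilon^2=0$, let $p:A(\epsilon)\to A$, $\epsilon\mapsto 0$, and let $\mathrm{Lie}(G)(A)=\ker\big(G(p):G(A(\epsilon))\to G(A)\big)$. Let $1_G\in|G|$ be the image of the unit $e:\underline{\mathrm{Spec}}\,k\to G$; it is a rational point. Let $m=m_{G,1_G}$ be the maximal ideal of $\mathcal O_{G,1_G}$, and let $T=T_{1_G}G=\mathrm{Der}(\mathcal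 O_{G,1_G},k)$ be the tangent superspace, spanned by the even and the odd superderivations. **Theorem.** Let $G$ be an algebraic supergroup over $k$. 1. For every superalgebra $A$ there is an isomorphism of groups, natural in $A$, $$\mathrm{Lie}(G)(A)\;\cong\;\mathrm{Hom}_{\mathrm{smod}}(m/m^2,A)$$ onto the additive group of parity-preserving $k$-linear maps $m/m^2\to A$. It takes $z$ to the map $d$ with $z^*(s)=s(1_G)+\epsilon\, d\big([\,s-s(1_G)\,]\big)$ for every section $s$ of $\mathcal O_G$ on an open neighbourhood of $1_G$. 2. For every superalgebra $A$ the map $a\otimes D\mapsto\big([f]\mapsto D(f)\,a\big)$ is a linear isomorphism, natural in $A$, $$(A\otimes T)_0\;\cong\;\mathrm{Hom}_{\mathrm{smod}}(m/m^2,A).$$ 3. The functor $\mathrm{Lie}(G)$ is represented by the tangent superspace at the identity: there is a bijection, natural in $A$, $$\mathrm{Lie}(G)(A)\;\cong\;\mathrm{Hom}_{\mathrm{(salg)}}(\mathrm{Sym}(T^*),A),\qquad \mathrm{Sym}(T^*)=\mathrm{Sym}(T_0^*)\otimes\Lambda(T_1^*),$$ under which the homomorphism belonging to $z$ takes the linear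 function $D\mapsto D(f)$ on $T$, for $f\in m$, to $d([f])$, where $d$ belongs to $z$ as in 1. -/

import Mathlib

open CategoryTheory TopologicalSpace Opposite AlgebraicGeometry TensorProduct

universe u

noncomputable section

namespace Super

/-! ### Super vector spaces and superalgebras -/

section Grading

variable {k V : Type*} [Field k] [AddCommGroup V] [Module k V]

theorem zmod_two (i : ZMod 2) : i = 0 ∨ i = 1 := by revert i; decide

theorem isInternal_iff (𝒱 : ZMod 2 → Submodule k V) :
    DirectSum.IsInternal 𝒱 ↔
      (∀ v, ∃ a ∈ 𝒱 0, ∃ b ∈ 𝒱 1, a + b = v) ∧ ∀ v, v ∈ 𝒱 0 → v ∈ 𝒱 1 → v = 0 := by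
  rw [DirectSum.isInternal_submodule_iff_isCompl 𝒱 (i := 0) (j := 1) (by decide)
    (Set.ext fun i => by revert i; decide), isCompl_iff, codisjoint_iff, and_comm,
    Submodule.disjoint_def, Submodule.eq_top_iff']
  simp only [Submodule.mem_sup]

end Grading

/-- A commutative superalgebra over `k`: an associative unital `k`-algebra `A = A₀ ⊕ A₁`, graded
by `ℤ/2`, with `a b = (-1)^{p(a) p(b)} b a` for homogeneous `a`, `b`. -/
structure SAlg (k : Type u) [Field k] where
  carrier : Type u
  [ring : Ring carrier]
  [algebra : Algebra k carrier]
  grading : ZMod 2 → Submodule k carrier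
  [gradedMonoid : SetLike.GradedMonoid grading]
  isInternal : DirectSum.IsInternal grading
  superComm : ∀ (i j : ZMod 2) (a b : carrier), a ∈ grading i → b ∈ grading j →
    a * b = (-1) ^ (i.val * j.val) * (b * a)

namespace SAlg

variable {k : Type u} [Field k]

instance : CoeSort (SAlg k) (Type u) := ⟨SAlg.carrier⟩

attribute [instance] SAlg.ring SAlg.algebra SAlg.gradedMonoid

/-- A morphism of superalgebras: a parity-preserving homomorphism of unital `k`-algebras. -/
structure Hom (A B : SAlg k) extends A →ₐ[k] B where
  map_mem' : ∀ (i : ZMod 2) (a : A), a ∈ A.grading i → toFun a ∈ B.grading i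

instance (A B : SAlg k) : FunLike (Hom A B) A B where
  coe f := f.toFun
  coe_injective f g h := by
    obtain ⟨f, _⟩ := f
    obtain ⟨g, _⟩ := g
    obtain rfl : f = g := DFunLike.coe_injective h
    rfl

instance (A B : SAlg k) : AlgHomClass (Hom A B) k A B where
  map_mul f := f.map_mul'
  map_one f := f.map_one'
  map_add f := f.map_add'
  map_zero f := f.map_zero'
  commutes f := f.commutes'

instance : Category (SAlg k) where
  Hom := Hom
  id A := { AlgHom.id k A with map_mem' := fun _ _ h => h }
  comp f g := { g.toAlgHom.comp f.toAlgHom with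
    map_mem' := fun i a h => g.map_mem' i _ (f.map_mem' i a h) }

instance : ConcreteCategory (SAlg k) Hom where
  hom f := f
  ofHom f := f

theorem map_mem {A B : SAlg k} (f : A ⟶ B) {i : ZMod 2} {a : A} (h : a ∈ A.grading i) :
    f a ∈ B.grading i := f.map_mem' i a h

theorem hom_ext {A B : SAlg k} {f g : A ⟶ B} (h : ∀ a, f a = g a) : f = g :=
  DFunLike.ext (F := Hom A B) f g h

@[simp] theorem comp_apply' {A B C : SAlg k} (f : A ⟶ B) (g : B ⟶ C) (a : A) :
    (f ≫ g) a = g (f a) := rfl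

theorem exists_decomp {A : SAlg k} (a : A) :
    ∃ b ∈ A.grading 0, ∃ c ∈ A.grading 1, b + c = a :=
  ((isInternal_iff _).1 A.isInternal).1 a

theorem even_comm {A : SAlg k} {a : A} (ha : a ∈ A.grading 0) (b : A) : a * b = b * a := by
  obtain ⟨c, hc, d, hd, rfl⟩ := exists_decomp b
  have h1 := A.superComm 0 0 a c ha hc
  have h2 := A.superComm 0 1 a d ha hd
  simp only [ZMod.val_zero, zero_mul, pow_zero, one_mul] at h1 h2
  rw [mul_add, add_mul, h1, h2]

/-- The subalgebra of even elements. -/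
def evenSubalgebra (A : SAlg k) : Subalgebra k A where
  carrier := A.grading 0
  mul_mem' ha hb := by simpa using SetLike.mul_mem_graded (A := A.grading) ha hb
  add_mem' := (A.grading 0).add_mem
  algebraMap_mem' r := by
    rw [Algebra.algebraMap_eq_smul_one]
    exact (A.grading 0).smul_mem r SetLike.GradedOne.one_mem

/-- The commutative `k`-algebra `A₀` of even elements. -/
def Even (A : SAlg k) : Type u := A.evenSubalgebra

instance (A : SAlg k) : CommRing A.Even :=
  { (inferInstance : Ring A.evenSubalgebra) with
    mul_comm := fun a b => Subtype.ext (even_comm a.2 b.1) }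

instance (A : SAlg k) : Algebra k A.Even := inferInstanceAs (Algebra k A.evenSubalgebra)

/-- The inclusion of the even part. -/
def evenVal (A : SAlg k) : A.Even →+* A := A.evenSubalgebra.val.toRingHom

/-- `A` as an algebra over its (central) even part. -/
instance (A : SAlg k) : Algebra A.Even A :=
  A.evenVal.toAlgebra' fun c x => even_comm c.2 x

theorem even_smul_def {A : SAlg k} (c : A.Even) (a : A) : c • a = c.1 * a := rfl

/-- The map on even parts induced by a morphism of superalgebras. -/
def evenMap {A B : SAlg k} (f : A ⟶ B) : A.Even →+* B.Even where
  toFun a := ⟨f a.1, map_mem f a.2⟩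
  map_one' := Subtype.ext f.map_one'
  map_mul' a b := Subtype.ext (f.map_mul' a.1 b.1)
  map_zero' := Subtype.ext f.map_zero'
  map_add' a b := Subtype.ext (f.map_add' a.1 b.1)

/-- The ground field as a purely even superalgebra. -/
def base (k : Type u) [Field k] : SAlg k where
  carrier := k
  grading i := if i = 0 then ⊤ else ⊥
  gradedMonoid :=
    { one_mem := by simp
      mul_mem := by
        intro i j a b ha hb
        rcases zmod_two i with rfl | rfl <;> rcases zmod_two j with rfl | rfl <;> simp_all }
  isInternal := by
    rw [isInternal_iff]
    exact ⟨fun v => ⟨v, by simp, 0, by simp, by simp⟩, fun v _ h => by simpa using h⟩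
  superComm i j a b ha hb := by
    rcases zmod_two i with rfl | rfl <;> rcases zmod_two j with rfl | rfl <;>
      simp_all [mul_comm]

/-- The superalgebra of dual numbers `A(ε) = A ⊕ ε A`, with `ε` even and `ε² = 0`. -/
def dual (A : SAlg k) : SAlg k where
  carrier := DualNumber A
  grading i :=
    { carrier := {x | x.fst ∈ A.grading i ∧ x.snd ∈ A.grading i}
      add_mem' := fun ha hb => ⟨add_mem ha.1 hb.1, add_mem ha.2 hb.2⟩
      zero_mem' := ⟨zero_mem _, zero_mem _⟩
      smul_mem' := fun c _ h =>
        ⟨(A.grading i).smul_mem c h.1, (A.grading i).smul_mem c h.2⟩ }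
  gradedMonoid :=
    { one_mem := ⟨SetLike.GradedOne.one_mem, zero_mem _⟩
      mul_mem := by
        intro i j a b ha hb
        refine ⟨?_, ?_⟩
        · exact SetLike.mul_mem_graded ha.1 hb.1
        · change TrivSqZeroExt.snd (a * b) ∈ _
          rw [TrivSqZeroExt.snd_mul]
          exact add_mem (SetLike.mul_mem_graded ha.1 hb.2) (SetLike.mul_mem_graded ha.2 hb.1) }
  isInternal := by
    rw [isInternal_iff]
    refine ⟨fun v => ?_, fun v h0 h1 => ?_⟩
    · obtain ⟨a, ha, b, hb, h⟩ := exists_decomp v.fst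
      obtain ⟨c, hc, d, hd, h'⟩ := exists_decomp v.snd
      exact ⟨(a, c), ⟨ha, hc⟩, (b, d), ⟨hb, hd⟩, TrivSqZeroExt.ext h h'⟩
    · exact TrivSqZeroExt.ext (((isInternal_iff _).1 A.isInternal).2 _ h0.1 h1.1)
        (((isInternal_iff _).1 A.isInternal).2 _ h0.2 h1.2)
  superComm i j a b ha hb := by
    have e : ((-1 : DualNumber A) ^ (i.val * j.val)) =
        TrivSqZeroExt.inl ((-1 : A) ^ (i.val * j.val)) := by
      rw [← TrivSqZeroExt.inl_one A, ← TrivSqZeroExt.inl_neg]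
      exact TrivSqZeroExt.inl_pow (M := A) (-1 : A) _
    rw [e]
    refine TrivSqZeroExt.ext ?_ ?_
    · simpa using A.superComm i j _ _ ha.1 hb.1
    · have h1 := A.superComm i j _ _ ha.1 hb.2
      have h2 := A.superComm i j _ _ ha.2 hb.1
      simp only [TrivSqZeroExt.snd_mul, TrivSqZeroExt.fst_inl, TrivSqZeroExt.snd_inl,
        smul_eq_mul, MulOpposite.smul_eq_mul_unop, MulOpposite.unop_op, zero_mul, add_zero,
        mul_add] at *
      rw [h1, h2, add_comm]

/-- The element `a + ε b` of `A(ε)`. -/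
def dualMk {A : SAlg k} (a b : A) : A.dual := ((a, b) : A × A)

/-- The projection `p : A(ε) ⟶ A`, `ε ↦ 0`. -/
def dualProj (A : SAlg k) : A.dual ⟶ A :=
  { TrivSqZeroExt.fstHom k A A with map_mem' := fun _ _ h => h.1 }

/-- The morphism `A(ε) ⟶ B(ε)` induced by `φ : A ⟶ B`, `a + ε b ↦ φ a + ε φ b`. -/
def dualMap {A B : SAlg k} (φ : A ⟶ B) : A.dual ⟶ B.dual where
  toFun x := ((φ x.fst, φ x.snd) : B × B)
  map_one' := TrivSqZeroExt.ext φ.map_one' φ.map_zero'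
  map_mul' x y := TrivSqZeroExt.ext (φ.map_mul' x.fst y.fst) <|
    (φ.map_add' (x.fst * y.snd) (x.snd * y.fst)).trans <|
      congrArg₂ (· + ·) (φ.map_mul' x.fst y.snd) (φ.map_mul' x.snd y.fst)
  map_zero' := TrivSqZeroExt.ext φ.map_zero' φ.map_zero'
  map_add' _ _ := TrivSqZeroExt.ext (φ.map_add' _ _) (φ.map_add' _ _)
  commutes' r := TrivSqZeroExt.ext (φ.commutes' r) φ.map_zero'
  map_mem' _ _ h := ⟨map_mem φ h.1, map_mem φ h.2⟩

theorem dualMap_comp_dualProj {A B : SAlg k} (φ : A ⟶ B) :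
    dualMap φ ≫ dualProj B = dualProj A ≫ φ := rfl

end SAlg

/-! ### Stalks -/

section Stalk

variable {k : Type u} [Field k] {X : TopCat.{u}} (F : X.Presheaf (SAlg k)) (x : X)

/-- The open neighbourhoods of a point, ordered by reverse inclusion. -/
structure Nhd (x : X) where
  set : Opens X
  mem : x ∈ set

instance (x : X) : Preorder (Nhd x) where
  le U V := V.set ≤ U.set
  le_refl _ := le_rfl
  le_trans _ _ _ h h' := h'.trans h

instance (x : X) : IsDirectedOrder (Nhd x) where
  directed U V := ⟨⟨U.set ⊓ V.set, U.mem, V.mem⟩, inf_le_left (a := U.set), inf_le_right (a := U.set)⟩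

instance (x : X) : Nonempty (Nhd x) := ⟨⟨⊤, trivial⟩⟩

/-- Restriction of sections from an open neighbourhood of `x` to a smaller one. -/
def nhdRestrict (U V : Nhd x) (h : U ≤ V) : F.obj (op U.set) →ₐ[k] F.obj (op V.set) :=
  (F.map (homOfLE (show V.set ≤ U.set from h)).op).toAlgHom

instance : DirectedSystem (fun U : Nhd x => F.obj (op U.set)) (nhdRestrict F x · · ·) where
  map_self U s := DFunLike.congr_fun (F := SAlg.Hom _ _) (F.map_id (op U.set)) s
  map_map U V W hUV hVW s :=
    (DFunLike.congr_fun (F := SAlg.Hom _ _) (F.map_comp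
      (homOfLE (show V.set ≤ W.set from hUV)).op
      (homOfLE (show U.set ≤ V.set from hVW)).op) s).symm

/-- The direct limit of the algebras of sections over the open neighbourhoods of `x`. -/
abbrev StalkCarrier : Type u := DirectLimit (fun U : Nhd x => F.obj (op U.set)) (nhdRestrict F x)

/-- The germ at `x` of a section over an open set containing `x`. -/
def germ (U : Opens X) (hx : x ∈ U) : F.obj (op U) →ₐ[k] StalkCarrier F x where
  toFun s := Quotient.mk _ ⟨⟨U, hx⟩, s⟩
  map_one' := (DirectLimit.one_def (f := nhdRestrict F x) ⟨U, hx⟩).symm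
  map_mul' s t := (DirectLimit.mul_def (f := nhdRestrict F x) ⟨U, hx⟩ s t).symm
  map_zero' := (DirectLimit.zero_def (f := nhdRestrict F x) ⟨U, hx⟩).symm
  map_add' s t := (DirectLimit.add_def (f := nhdRestrict F x) ⟨U, hx⟩ s t).symm
  commutes' r := (DirectLimit.algebraMap_def (f := nhdRestrict F x) ⟨U, hx⟩ r).symm

theorem exists_germ_eq₂ (a b : StalkCarrier F x) :
    ∃ (U : Opens X) (hx : x ∈ U) (s t : F.obj (op U)),
      germ F x U hx s = a ∧ germ F x U hx t = b := by
  obtain ⟨U, s, t, rfl, rfl⟩ := DirectLimit.exists_eq_mk₂ _ a b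
  exact ⟨U.set, U.mem, s, t, rfl, rfl⟩

theorem exists_germ_eq (a : StalkCarrier F x) :
    ∃ (U : Opens X) (hx : x ∈ U) (s : F.obj (op U)), germ F x U hx s = a :=
  let ⟨U, hx, s, _, h, _⟩ := exists_germ_eq₂ F x a a
  ⟨U, hx, s, h⟩

theorem germ_res {U V : Opens X} (h : V ≤ U) (hx : x ∈ V) (s : F.obj (op U)) :
    germ F x V hx (F.map (homOfLE h).op s) = germ F x U (h hx) s := by
  have := DirectLimit.eq_of_le (f := nhdRestrict F x)
    (⟨⟨U, h hx⟩, s⟩ : Σ U : Nhd x, F.obj (op U.set)) ⟨V, hx⟩ h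
  exact this.symm

theorem germ_eq_iff {U V : Opens X} (hU : x ∈ U) (hV : x ∈ V) (s : F.obj (op U))
    (t : F.obj (op V)) :
    germ F x U hU s = germ F x V hV t ↔ ∃ (W : Opens X) (_ : x ∈ W) (hWU : W ≤ U) (hWV : W ≤ V),
      F.map (homOfLE hWU).op s = F.map (homOfLE hWV).op t := by
  constructor
  · intro h
    obtain ⟨W, hU', hV', h⟩ := Quotient.exact h
    exact ⟨W.set, W.mem, hU', hV', h⟩
  · rintro ⟨W, hW, hWU, hWV, h⟩
    rw [← germ_res F x hWU hW, ← germ_res F x hWV hW, h]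

/-- The stalk at `x` of a presheaf of superalgebras, with the grading by parity of germs. -/
def stalk : SAlg k where
  carrier := StalkCarrier F x
  grading i :=
    { carrier := {a | ∃ (U : Opens X) (hx : x ∈ U), ∃ s ∈ (F.obj (op U)).grading i,
        germ F x U hx s = a}
      add_mem' := by
        rintro _ _ ⟨U, hU, s, hs, rfl⟩ ⟨V, hV, t, ht, rfl⟩
        have hx : x ∈ U ⊓ V := ⟨hU, hV⟩
        refine ⟨U ⊓ V, hx, _, add_mem (SAlg.map_mem (F.map (homOfLE inf_le_left).op) hs)
          (SAlg.map_mem (F.map (homOfLE inf_le_right).op) ht), ?_⟩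
        rw [map_add, germ_res, germ_res]
      zero_mem' := ⟨⊤, trivial, 0, zero_mem _, map_zero _⟩
      smul_mem' := by
        rintro c _ ⟨U, hU, s, hs, rfl⟩
        exact ⟨U, hU, c • s, Submodule.smul_mem _ c hs, map_smul _ _ _⟩ }
  gradedMonoid :=
    { one_mem := ⟨⊤, trivial, 1, SetLike.GradedOne.one_mem, map_one _⟩
      mul_mem := by
        rintro i j _ _ ⟨U, hU, s, hs, rfl⟩ ⟨V, hV, t, ht, rfl⟩
        have hx : x ∈ U ⊓ V := ⟨hU, hV⟩
        refine ⟨U ⊓ V, hx, _, SetLike.mul_mem_graded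
          (SAlg.map_mem (F.map (homOfLE inf_le_left).op) hs)
          (SAlg.map_mem (F.map (homOfLE inf_le_right).op) ht), ?_⟩
        rw [map_mul, germ_res, germ_res] }
  isInternal := by
    rw [isInternal_iff]
    refine ⟨fun a => ?_, ?_⟩
    · obtain ⟨U, hU, s, rfl⟩ := exists_germ_eq F x a
      obtain ⟨b, hb, c, hc, rfl⟩ := SAlg.exists_decomp s
      exact ⟨_, ⟨U, hU, b, hb, rfl⟩, _, ⟨U, hU, c, hc, rfl⟩, (map_add _ _ _).symm⟩
    · rintro _ ⟨U, hU, s, hs, rfl⟩ ⟨V, hV, t, ht, h⟩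
      obtain ⟨W, hW, hWV, hWU, e⟩ := (germ_eq_iff F x hV hU t s).1 h
      rw [← germ_res F x hWU hW]
      have h0 := SAlg.map_mem (F.map (homOfLE hWU).op) hs
      have h1 := SAlg.map_mem (F.map (homOfLE hWV).op) ht
      rw [e] at h1
      rw [((isInternal_iff _).1 (F.obj (op W)).isInternal).2 _ h0 h1, map_zero]
  superComm := by
    rintro i j _ _ ⟨U, hU, s, hs, rfl⟩ ⟨V, hV, t, ht, rfl⟩
    have hx : x ∈ U ⊓ V := ⟨hU, hV⟩
    have h := (F.obj (op (U ⊓ V))).superComm i j _ _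
      (SAlg.map_mem (F.map (homOfLE inf_le_left).op) hs)
      (SAlg.map_mem (F.map (homOfLE inf_le_right).op) ht)
    have h' := congrArg (germ F x (U ⊓ V) hx) h
    simpa only [map_mul, map_pow, map_neg, map_one, germ_res] using h'

end Stalk

/-! ### Local rings -/

/-- The maximal ideal of a (not necessarily commutative) local ring: the set of nonunits. -/
def maximalIdeal (R : Type*) [Ring R] [IsLocalRing R] : Ideal R where
  carrier := nonunits R
  zero_mem' := not_isUnit_zero
  add_mem' := by
    rintro a b ha hb ⟨u, hu⟩
    have h : (↑u⁻¹ : R) * a + ↑u⁻¹ * b = 1 := by rw [← mul_add, ← hu, Units.inv_mul]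
    rcases IsLocalRing.isUnit_or_isUnit_of_add_one h with h | h
    · exact ha ((Units.isUnit_units_mul u⁻¹ a).1 h)
    · exact hb ((Units.isUnit_units_mul u⁻¹ b).1 h)
  smul_mem' := by
    rintro c a ha ⟨u, hu⟩
    refine ha ?_
    have h : (↑u⁻¹ * c) * a = 1 := by rw [mul_assoc, ← smul_eq_mul c a, ← hu, Units.inv_mul]
    set b := (↑u⁻¹ : R) * c
    have hid : (a * b) * (a * b) = a * b := by
      rw [mul_assoc, ← mul_assoc b a b, h, one_mul]
    rcases IsLocalRing.isUnit_or_isUnit_of_add_one (add_sub_cancel (a * b) 1) with h' | h'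
    · have : a * b = 1 := h'.mul_left_cancel (by rw [hid, mul_one])
      exact ⟨⟨a, b, this, h⟩, rfl⟩
    · have : a * b = 0 := h'.mul_left_cancel (by rw [sub_mul, one_mul, hid, sub_self, mul_zero])
      have h0 : (1 : R) = 0 := by
        calc (1 : R) = b * a * (b * a) := by rw [h, one_mul]
          _ = b * (a * b) * a := by simp only [mul_assoc]
          _ = 0 := by rw [this, mul_zero, zero_mul]
      exact absurd h0 one_ne_zero


/-! ### Super ringed spaces -/

/-- A topological space with a sheaf of commutative superalgebras over `k`. -/
structure SuperRingedSpace (k : Type u) [Field k] extends PresheafedSpace.{u} (SAlg k) where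
  isSheaf : TopCat.Presheaf.IsSheaf (toPresheafedSpace.presheaf ⋙ forget (SAlg k))

namespace SuperRingedSpace

variable {k : Type u} [Field k]

instance : CoeSort (SuperRingedSpace k) (Type u) := ⟨fun X => X.carrier⟩

/-- A morphism: a continuous map `|f|` and a parity-preserving morphism of sheaves of
superalgebras `f^*`, such that the maps `𝒪_{Y, |f|(x)} ⟶ 𝒪_{X, x}` on stalks are local:
a germ whose pullback is invertible is invertible. -/
@[ext]
structure Hom (X Y : SuperRingedSpace k) where
  hom : X.toPresheafedSpace ⟶ Y.toPresheafedSpace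
  isLocal : ∀ (x : X) (V : Opens Y) (hV : hom.base x ∈ V) (s : Y.presheaf.obj (op V)),
    IsUnit (germ X.presheaf x ((Opens.map hom.base).obj V) hV (hom.c.app (op V) s)) →
      IsUnit (germ Y.presheaf (hom.base x) V hV s)

instance : Category (SuperRingedSpace k) where
  Hom := Hom
  id _ := ⟨𝟙 _, fun _ _ _ _ h => h⟩
  comp f g := ⟨f.hom ≫ g.hom, fun x V hV s h =>
    g.isLocal (f.hom.base x) V hV s (f.isLocal x _ hV (g.hom.c.app (op V) s) h)⟩
  id_comp f := Hom.ext (Category.id_comp f.hom)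
  comp_id f := Hom.ext (Category.comp_id f.hom)
  assoc f g h := Hom.ext (Category.assoc f.hom g.hom h.hom)

end SuperRingedSpace

/-! ### The spectrum of a superalgebra -/

open AlgebraicGeometry.StructureSheaf

namespace SAlg

variable {k : Type u} [Field k]

/-- The localization `A_𝔭` of `A` at a prime ideal `𝔭` of `A₀`. -/
abbrev Loc (A : SAlg k) (p : PrimeSpectrum.Top A.Even) : Type u := Localizations (R := A.Even) A p

/-- The homogeneous elements `a / t` of `A_𝔭`, with `a ∈ A_i` and `t ∈ A₀ ∖ 𝔭`. -/
def LocHomog (A : SAlg k) (p : PrimeSpectrum.Top A.Even) (i : ZMod 2) (z : A.Loc p) : Prop :=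
  ∃ a ∈ A.grading i, ∃ t, z = LocalizedModule.mk a t

theorem even_smul_mem {A : SAlg k} {i : ZMod 2} (c : A.Even) {a : A} (ha : a ∈ A.grading i) :
    c • a ∈ A.grading i := by
  rw [even_smul_def]
  simpa using SetLike.mul_mem_graded (A := A.grading) c.2 ha

theorem locHomog_add {A : SAlg k} {p : PrimeSpectrum.Top A.Even} {i : ZMod 2} {y z : A.Loc p}
    (hy : A.LocHomog p i y) (hz : A.LocHomog p i z) : A.LocHomog p i (y + z) := by
  obtain ⟨a, ha, t, rfl⟩ := hy
  obtain ⟨b, hb, s, rfl⟩ := hz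
  exact ⟨_, add_mem (even_smul_mem s.1 ha) (even_smul_mem t.1 hb), _,
    LocalizedModule.mk_add_mk⟩

theorem locHomog_mul {A : SAlg k} {p : PrimeSpectrum.Top A.Even} {i j : ZMod 2} {y z : A.Loc p}
    (hy : A.LocHomog p i y) (hz : A.LocHomog p j z) : A.LocHomog p (i + j) (y * z) := by
  obtain ⟨a, ha, t, rfl⟩ := hy
  obtain ⟨b, hb, s, rfl⟩ := hz
  exact ⟨_, SetLike.mul_mem_graded ha hb, _, LocalizedModule.mk_mul_mk⟩

theorem locHomog_smul {A : SAlg k} {p : PrimeSpectrum.Top A.Even} {i : ZMod 2} (c : A.Even)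
    {z : A.Loc p} (hz : A.LocHomog p i z) : A.LocHomog p i (c • z) := by
  obtain ⟨a, ha, t, rfl⟩ := hz
  exact ⟨_, even_smul_mem c ha, t, LocalizedModule.smul'_mk _ _ _⟩

theorem locHomog_superComm {A : SAlg k} {p : PrimeSpectrum.Top A.Even} {i j : ZMod 2}
    {y z : A.Loc p} (hy : A.LocHomog p i y) (hz : A.LocHomog p j z) :
    y * z = (-1) ^ (i.val * j.val) * (z * y) := by
  obtain ⟨a, ha, t, rfl⟩ := hy
  obtain ⟨b, hb, s, rfl⟩ := hz
  rw [LocalizedModule.mk_mul_mk, LocalizedModule.mk_mul_mk, A.superComm i j a b ha hb, mul_comm t s]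
  rcases Nat.even_or_odd (i.val * j.val) with h | h
  · rw [h.neg_one_pow, h.neg_one_pow, one_mul, one_mul]
  · rw [h.neg_one_pow, h.neg_one_pow, neg_one_mul, neg_one_mul, LocalizedModule.mk_neg]

theorem locHomog_disjoint {A : SAlg k} {p : PrimeSpectrum.Top A.Even} {z : A.Loc p}
    (h0 : A.LocHomog p 0 z) (h1 : A.LocHomog p 1 z) : z = 0 := by
  obtain ⟨a, ha, t, rfl⟩ := h0
  obtain ⟨b, hb, s, h⟩ := h1
  obtain ⟨u, hu⟩ := LocalizedModule.mk_eq.1 h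
  have e0 : u • s • a ∈ A.grading 0 := even_smul_mem u.1 (even_smul_mem s.1 ha)
  have e1 : u • s • a ∈ A.grading 1 := by
    rw [hu]
    exact even_smul_mem u.1 (even_smul_mem t.1 hb)
  have e := ((isInternal_iff _).1 A.isInternal).2 _ e0 e1
  rw [← LocalizedModule.zero_mk t, LocalizedModule.mk_eq]
  refine ⟨u * s, ?_⟩
  rw [smul_comm, mul_smul, e, smul_zero, smul_zero]

instance (R : Type u) [CommRing R] (p : PrimeSpectrum.Top R) : p.asIdeal.IsPrime := p.2

theorem loc_mk_add {A : SAlg k} {p : PrimeSpectrum.Top A.Even} (a b : A)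
    (t : p.asIdeal.primeCompl) :
    (LocalizedModule.mk a t : A.Loc p) + LocalizedModule.mk b t = LocalizedModule.mk (a + b) t := by
  rw [LocalizedModule.mk_add_mk, ← smul_add, LocalizedModule.mk_cancel_common_left]

theorem loc_one_def {A : SAlg k} {p : PrimeSpectrum.Top A.Even} :
    (1 : A.Loc p) = LocalizedModule.mk 1 1 := OreLocalization.one_def

/-- Sections over `U` of the structure sheaf of `Spec A`: functions `𝔭 ↦ s(𝔭) ∈ A_𝔭` on `U` that
are locally fractions `a / f` with `a ∈ A` and `f ∈ A₀`. -/
def specSections (A : SAlg k) (U : Opens (PrimeSpectrum.Top A.Even)) :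
    Subalgebra A.Even (Π x : U, A.Loc x.1) where
  carrier := {s | (isLocallyFraction A.Even A).pred s}
  add_mem' := (sectionsSubmodule (R := A.Even) A U).add_mem'
  mul_mem' {a b} ha hb x := by
    obtain ⟨Va, ma, ia, ra, sa, wa⟩ := ha x
    obtain ⟨Vb, mb, ib, rb, sb, wb⟩ := hb x
    refine ⟨Va ⊓ Vb, ⟨ma, mb⟩, Opens.infLELeft _ _ ≫ ia, ra * rb, sa * sb, fun x ↦ ?_⟩
    obtain ⟨hsax, hsa⟩ := wa ⟨x.1, x.2.1⟩
    obtain ⟨hsbx, hsb⟩ := wb ⟨x.1, x.2.2⟩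
    exact ⟨fun h => (x.1.2.mem_or_mem h).elim hsax hsbx,
      congr($hsa * $hsb).trans (LocalizedModule.mk_mul_mk ..)⟩
  algebraMap_mem' r x :=
    ⟨U, x.2, 𝟙 _, algebraMap A.Even A r, 1, fun y ↦
      ⟨fun h => y.1.2.ne_top ((Ideal.eq_top_iff_one _).2 h), rfl⟩⟩

instance (A : SAlg k) (U : Opens (PrimeSpectrum.Top A.Even)) : Algebra k (A.specSections U) :=
  Algebra.compHom _ (algebraMap k A.Even)

theorem specSections_smul_def {A : SAlg k} {U : Opens (PrimeSpectrum.Top A.Even)} (c : k)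
    (s : A.specSections U) : c • s = algebraMap k A.Even c • s := rfl

/-- The superalgebra of sections over `U` of the structure sheaf of `Spec A`. -/
def specObj (A : SAlg k) (U : Opens (PrimeSpectrum.Top A.Even)) : SAlg k where
  carrier := A.specSections U
  grading i :=
    { carrier := {s | ∀ x : U, A.LocHomog x.1 i (s.1 x)}
      add_mem' := fun hs ht x => locHomog_add (hs x) (ht x)
      zero_mem' := fun x => ⟨0, zero_mem _, 1, (LocalizedModule.zero_mk 1).symm⟩
      smul_mem' := fun c s hs x => locHomog_smul (algebraMap k A.Even c) (hs x) }
  gradedMonoid :=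
    { one_mem := fun x => ⟨1, SetLike.GradedOne.one_mem, 1, loc_one_def⟩
      mul_mem := fun i j s t hs ht x => locHomog_mul (hs x) (ht x) }
  isInternal := by
    rw [isInternal_iff]
    refine ⟨fun s => ?_, fun s h0 h1 => Subtype.ext (funext fun x =>
      locHomog_disjoint (h0 x) (h1 x))⟩
    have key : ∀ x : U, ∃ y z, A.LocHomog x.1 0 y ∧ A.LocHomog x.1 1 z ∧ y + z = s.1 x := by
      intro x
      obtain ⟨V, hV, i, a, t, h⟩ := s.2 x
      obtain ⟨ht, e⟩ := h ⟨x.1, hV⟩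
      obtain ⟨b, hb, c, hc, rfl⟩ := exists_decomp a
      refine ⟨LocalizedModule.mk b ⟨t, ht⟩, LocalizedModule.mk c ⟨t, ht⟩, ⟨b, hb, _, rfl⟩,
        ⟨c, hc, _, rfl⟩, ?_⟩
      rw [loc_mk_add]
      exact e.symm
    choose y z hy hz hyz using key
    have uniq : ∀ (x : U) (y' z' : A.Loc x.1), A.LocHomog x.1 0 y' → A.LocHomog x.1 1 z' →
        y' + z' = s.1 x → y x = y' ∧ z x = z' := by
      intro x y' z' hy' hz' h
      have e : y x - y' = z' - z x := by
        rw [sub_eq_sub_iff_add_eq_add, hyz, add_comm z', h]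
      have hs : ∀ {i : ZMod 2} {w : A.Loc x.1}, A.LocHomog x.1 i w → A.LocHomog x.1 i (-w) := by
        rintro i _ ⟨a, ha, t, rfl⟩
        exact ⟨-a, neg_mem ha, t, LocalizedModule.mk_neg.symm⟩
      have h0 : A.LocHomog x.1 0 (y x - y') := by
        rw [sub_eq_add_neg]
        exact locHomog_add (hy x) (hs hy')
      have h1 : A.LocHomog x.1 1 (y x - y') := by
        rw [e, sub_eq_add_neg]
        exact locHomog_add hz' (hs (hz x))
      have h2 := locHomog_disjoint h0 h1
      exact ⟨sub_eq_zero.1 h2, (sub_eq_zero.1 (e ▸ h2)).symm⟩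
    have hfrac : ∀ x : U, ∃ (V : Opens (PrimeSpectrum.Top A.Even)) (_ : x.1 ∈ V) (i : V ⟶ U)
        (b c : A) (t : A.Even), ∀ w : V, ∃ ht : t ∉ w.1.asIdeal,
          y (i w) = LocalizedModule.mk b ⟨t, ht⟩ ∧ z (i w) = LocalizedModule.mk c ⟨t, ht⟩ := by
      intro x
      obtain ⟨V, hV, i, a, t, h⟩ := s.2 x
      obtain ⟨b, hb, c, hc, rfl⟩ := exists_decomp a
      refine ⟨V, hV, i, b, c, t, fun w => ?_⟩
      obtain ⟨ht, e⟩ := h w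
      refine ⟨ht, uniq (i w) _ _ ⟨b, hb, _, rfl⟩ ⟨c, hc, _, rfl⟩ ?_⟩
      refine Eq.trans ?_ e.symm
      exact loc_mk_add _ _ _
    refine ⟨⟨y, fun x => ?_⟩, hy, ⟨z, fun x => ?_⟩, hz, Subtype.ext (funext hyz)⟩
    · obtain ⟨V, hV, i, b, c, t, h⟩ := hfrac x
      exact ⟨V, hV, i, b, t, fun w => ⟨(h w).1, (h w).2.1⟩⟩
    · obtain ⟨V, hV, i, b, c, t, h⟩ := hfrac x
      exact ⟨V, hV, i, c, t, fun w => ⟨(h w).1, (h w).2.2⟩⟩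
  superComm i j s t hs ht :=
    Subtype.ext (funext fun x => locHomog_superComm (hs x) (ht x))

/-- Restriction of sections of the structure sheaf of `Spec A`. -/
def specRes (A : SAlg k) {U V : Opens (PrimeSpectrum.Top A.Even)} (i : V ⟶ U) :
    A.specObj U ⟶ A.specObj V where
  toFun s := ⟨fun x => s.1 (i x), (isLocallyFraction A.Even A).res i s.1 s.2⟩
  map_one' := rfl
  map_mul' _ _ := rfl
  map_zero' := rfl
  map_add' _ _ := rfl
  commutes' _ := rfl
  map_mem' _ _ h := fun x => h (i x)

/-- The affine superscheme `Spec A`: the prime spectrum of `A₀` with the sheaf associated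
with `A`. -/
def Spec (A : SAlg k) : SuperRingedSpace k where
  carrier := PrimeSpectrum.Top A.Even
  presheaf :=
    { obj := fun U => A.specObj U.unop
      map := fun i => A.specRes i.unop
      map_id := fun _ => rfl
      map_comp := fun _ _ => rfl }
  isSheaf := (structureSheafInType A.Even A).2

/-- An element of `A` as a section of the structure sheaf of `Spec A`. -/
def toSection (A : SAlg k) (U : Opens A.Spec) : A ⟶ A.Spec.presheaf.obj (op U) where
  toFun a := ⟨fun x => LocalizedModule.mk a 1, fun x => ⟨U, x.2, 𝟙 _, a, 1, fun y =>
    ⟨fun h => y.1.2.ne_top ((Ideal.eq_top_iff_one _).2 h), rfl⟩⟩⟩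
  map_one' := Subtype.ext (funext fun x => loc_one_def.symm)
  map_mul' a b := Subtype.ext (funext fun x => by
    refine Eq.trans ?_ (LocalizedModule.mk_mul_mk ..).symm
    rw [mul_one])
  map_zero' := Subtype.ext (funext fun x => LocalizedModule.zero_mk 1)
  map_add' a b := Subtype.ext (funext fun x => by
    refine Eq.trans ?_ (LocalizedModule.mk_add_mk).symm
    rw [one_smul, one_smul, mul_one])
  commutes' r := rfl
  map_mem' i a ha := fun x => ⟨a, ha, 1, rfl⟩

theorem map_even_smul {A B : SAlg k} (φ : A ⟶ B) (c : A.Even) (a : A) :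
    φ (c • a) = evenMap φ c • φ a := φ.map_mul' c.1 a

/-- The map `A_{φ⁻¹(𝔭)} ⟶ B_𝔭`, `a / t ↦ φ(a) / φ(t)`, induced by `φ : A ⟶ B`. -/
def locMap {A B : SAlg k} (φ : A ⟶ B) (p : PrimeSpectrum.Top B.Even)
    (z : A.Loc (PrimeSpectrum.comap (evenMap φ) p)) : B.Loc p :=
  LocalizedModule.liftOn z
    (fun w => LocalizedModule.mk (φ w.1) ⟨evenMap φ w.2.1, w.2.2⟩) (by
      rintro ⟨a, s⟩ ⟨b, t⟩ ⟨u, hu⟩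
      refine LocalizedModule.mk_eq.2 ⟨⟨evenMap φ u.1, u.2⟩, ?_⟩
      have h : φ (u.1 • t.1 • a) = φ (u.1 • s.1 • b) := congrArg φ hu
      rwa [map_even_smul, map_even_smul, map_even_smul, map_even_smul] at h)

theorem locMap_mk {A B : SAlg k} (φ : A ⟶ B) (p : PrimeSpectrum.Top B.Even) (a : A)
    (t : (PrimeSpectrum.comap (evenMap φ) p).asIdeal.primeCompl) :
    locMap φ p (LocalizedModule.mk a t) = LocalizedModule.mk (φ a) ⟨evenMap φ t.1, t.2⟩ := rfl

theorem locMap_add {A B : SAlg k} (φ : A ⟶ B) (p : PrimeSpectrum.Top B.Even)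
    (y z : A.Loc (PrimeSpectrum.comap (evenMap φ) p)) :
    locMap φ p (y + z) = locMap φ p y + locMap φ p z := by
  induction y using LocalizedModule.induction_on with | h a s =>
  induction z using LocalizedModule.induction_on with | h b t =>
  rw [LocalizedModule.mk_add_mk, locMap_mk, locMap_mk, locMap_mk, LocalizedModule.mk_add_mk]
  congr 1
  · refine (φ.map_add' _ _).trans ?_
    exact congrArg₂ (· + ·) (map_even_smul φ t.1 a) (map_even_smul φ s.1 b)
  · exact Subtype.ext (map_mul (evenMap φ) s.1 t.1)

theorem locMap_mul {A B : SAlg k} (φ : A ⟶ B) (p : PrimeSpectrum.Top B.Even)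
    (y z : A.Loc (PrimeSpectrum.comap (evenMap φ) p)) :
    locMap φ p (y * z) = locMap φ p y * locMap φ p z := by
  induction y using LocalizedModule.induction_on with | h a s =>
  induction z using LocalizedModule.induction_on with | h b t =>
  rw [LocalizedModule.mk_mul_mk, locMap_mk, locMap_mk, locMap_mk, LocalizedModule.mk_mul_mk]
  congr 1
  · exact φ.map_mul' _ _
  · exact Subtype.ext (map_mul (evenMap φ) s.1 t.1)

/-- The continuous map underlying `Spec φ`, taking `𝔭` to `φ⁻¹(𝔭)`. -/
def specBase {A B : SAlg k} (φ : A ⟶ B) :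
    PrimeSpectrum.Top B.Even ⟶ PrimeSpectrum.Top A.Even :=
  TopCat.ofHom ⟨PrimeSpectrum.comap (evenMap φ), PrimeSpectrum.continuous_comap _⟩

/-- Pullback of sections along `Spec φ`. -/
def specPullback {A B : SAlg k} (φ : A ⟶ B) (U : Opens (PrimeSpectrum.Top A.Even)) :
    A.specObj U ⟶ B.specObj ((Opens.map (specBase φ)).obj U) where
  toFun s := ⟨fun x => locMap φ x.1 (s.1 ⟨specBase φ x.1, x.2⟩), fun x => by
    obtain ⟨V, hV, i, a, t, h⟩ := s.2 ⟨specBase φ x.1, x.2⟩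
    refine ⟨(Opens.map (specBase φ)).obj V, hV, (Opens.map (specBase φ)).map i, φ a,
      evenMap φ t, fun w => ?_⟩
    obtain ⟨ht, e⟩ := h ⟨specBase φ w.1, w.2⟩
    exact ⟨ht, congrArg (locMap φ w.1) e⟩⟩
  map_one' := Subtype.ext (funext fun x => by
    refine (congrArg (locMap φ x.1) loc_one_def).trans (Eq.trans ?_ loc_one_def.symm)
    refine (locMap_mk φ x.1 1 1).trans ?_
    congr 1
    · exact φ.map_one'
    · exact Subtype.ext (map_one (evenMap φ)))
  map_mul' s t := Subtype.ext (funext fun x => locMap_mul φ x.1 _ _)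
  map_zero' := Subtype.ext (funext fun x => by
    refine (congrArg (locMap φ x.1) (LocalizedModule.zero_mk 1).symm).trans ?_
    refine (locMap_mk φ x.1 0 1).trans ?_
    rw [show φ 0 = 0 from φ.map_zero']
    exact LocalizedModule.zero_mk _)
  map_add' s t := Subtype.ext (funext fun x => locMap_add φ x.1 _ _)
  commutes' r := Subtype.ext (funext fun x => by
    refine (locMap_mk φ x.1 (algebraMap k A r) 1).trans ?_
    congr 1
    · exact φ.commutes' r
    · exact Subtype.ext (map_one (evenMap φ)))
  map_mem' i s hs := fun x => by
    obtain ⟨a, ha, t, e⟩ := hs ⟨specBase φ x.1, x.2⟩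
    exact ⟨φ a, map_mem φ ha, _, (congrArg (locMap φ x.1) e).trans (locMap_mk φ x.1 a t)⟩

/-- `Spec φ` as a morphism of spaces with a sheaf of superalgebras. -/
def specMapHom {A B : SAlg k} (φ : A ⟶ B) :
    B.Spec.toPresheafedSpace ⟶ A.Spec.toPresheafedSpace where
  base := specBase φ
  c :=
    { app := fun U => specPullback φ U.unop
      naturality := fun _ _ _ => rfl }

theorem odd_sq [NeZero (2 : k)] {A : SAlg k} {a : A} (ha : a ∈ A.grading 1) : a * a = 0 := by
  have h := A.superComm 1 1 a a ha ha
  rw [ZMod.val_one, one_mul, pow_one, neg_one_mul] at h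
  have h2 : (2 : k) • (a * a) = 0 := by
    rw [two_smul]
    nth_rewrite 1 [h]
    exact neg_add_cancel _
  exact (smul_eq_zero.1 h2).resolve_left (NeZero.ne _)

theorem odd_mul_odd_sq [NeZero (2 : k)] {A : SAlg k} {a b : A} (ha : a ∈ A.grading 1)
    (hb : b ∈ A.grading 1) : (a * b) * (a * b) = 0 := by
  have h := A.superComm 1 1 b a hb ha
  rw [ZMod.val_one, one_mul, pow_one, neg_one_mul] at h
  calc (a * b) * (a * b) = a * (b * a) * b := by simp only [mul_assoc]
    _ = 0 := by rw [h, mul_neg, ← mul_assoc, odd_sq ha, zero_mul, neg_zero, zero_mul]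

/-- The value in `A_𝔭` at a point `𝔭` of a section of the structure sheaf of `Spec A`. -/
def value {A : SAlg k} {U : Opens A.Spec} (s : A.Spec.presheaf.obj (op U)) (p : A.Spec)
    (hp : p ∈ U) : A.Loc p :=
  (show A.specSections U from s).1 ⟨p, hp⟩

theorem section_ext {A : SAlg k} {U : Opens A.Spec} {s t : A.Spec.presheaf.obj (op U)}
    (h : ∀ p hp, value s p hp = value t p hp) : s = t :=
  Subtype.ext (funext fun x => h x.1 x.2)

theorem value_mul {A : SAlg k} {U : Opens A.Spec} (s t : A.Spec.presheaf.obj (op U))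
    (p : A.Spec) (hp : p ∈ U) : value (s * t) p hp = value s p hp * value t p hp := rfl

theorem value_one {A : SAlg k} {U : Opens A.Spec} (p : A.Spec) (hp : p ∈ U) :
    value (1 : A.Spec.presheaf.obj (op U)) p hp = 1 := rfl

theorem value_res {A : SAlg k} {U V : Opens A.Spec} (h : V ≤ U) (s : A.Spec.presheaf.obj (op U))
    (p : A.Spec) (hp : p ∈ V) :
    value (A.Spec.presheaf.map (homOfLE h).op s) p hp = value s p (h hp) := rfl

/-- A section of the structure sheaf whose germ at `𝔭` is invertible has an invertible value. -/
theorem isUnit_value_of_isUnit_germ {A : SAlg k} {p : A.Spec} {U : Opens A.Spec} (hp : p ∈ U)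
    (s : A.Spec.presheaf.obj (op U)) (h : IsUnit (germ A.Spec.presheaf p U hp s)) :
    ∃ z : A.Loc p, value s p hp * z = 1 := by
  obtain ⟨b, hb⟩ := h.exists_right_inv
  obtain ⟨V, hV, t, rfl⟩ := exists_germ_eq A.Spec.presheaf p b
  have hUV : p ∈ U ⊓ V := ⟨hp, hV⟩
  have e : germ A.Spec.presheaf p (U ⊓ V) hUV
      (A.Spec.presheaf.map (homOfLE (inf_le_left : U ⊓ V ≤ U)).op s *
        A.Spec.presheaf.map (homOfLE (inf_le_right : U ⊓ V ≤ V)).op t) =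
      germ A.Spec.presheaf p (U ⊓ V) hUV 1 := by
    rw [map_mul, germ_res, germ_res, map_one]
    exact hb
  obtain ⟨W, hW, h1, h2, e⟩ := (germ_eq_iff _ _ _ _ _ _).1 e
  exact ⟨value t p hV, congrArg (fun r => value r p hW) e⟩

/-- A section with value `(b + c) / f` near `𝔭`, where `b ∈ A₀ ∖ 𝔭` and `c` is odd, has an
invertible germ at `𝔭`. -/
theorem isUnit_germ_of_fraction [NeZero (2 : k)] {A : SAlg k} {p : A.Spec} {U : Opens A.Spec}
    (hp : p ∈ U) (s : A.Spec.presheaf.obj (op U)) (V : Opens A.Spec) (hV : p ∈ V) (hVU : V ≤ U)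
    (b : A.Even) (hb : b ∉ PrimeSpectrum.asIdeal p) (c : A) (hc : c ∈ A.grading 1) (f : A.Even)
    (h : ∀ q (hq : q ∈ V), ∃ hf : f ∉ PrimeSpectrum.asIdeal q,
      value s q (hVU hq) = LocalizedModule.mk (b.1 + c) ⟨f, hf⟩) :
    IsUnit (germ A.Spec.presheaf p U hp s) := by
  let W : Opens A.Spec := V ⊓ PrimeSpectrum.basicOpen b
  have hWV : W ≤ V := inf_le_left
  have hW : p ∈ W := ⟨hV, hb⟩
  have hbW : ∀ q : W, b * b ∉ PrimeSpectrum.asIdeal q.1 := fun q hq =>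
    (q.1.2.mem_or_mem hq).elim q.2.2 q.2.2
  let r : A.Spec.presheaf.obj (op W) := (⟨fun q => LocalizedModule.mk (f • (b.1 - c))
    ⟨b * b, hbW q⟩, fun q => ⟨W, q.2, 𝟙 _, f • (b.1 - c), b * b, fun w => ⟨hbW w, rfl⟩⟩⟩ :
      A.specSections W)
  have hbc : (b.1 + c) * (b.1 - c) = b.1 * b.1 := by
    rw [mul_sub, add_mul, add_mul, odd_sq hc, add_zero, even_comm b.2 c, add_sub_cancel_right]
  have hcb : (b.1 - c) * (b.1 + c) = b.1 * b.1 := by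
    rw [mul_add, sub_mul, sub_mul, odd_sq hc, sub_zero, even_comm b.2 c, sub_add_cancel]
  have e1 : A.Spec.presheaf.map (homOfLE (hWV.trans hVU)).op s * r = 1 := by
    refine section_ext fun q hq => ?_
    obtain ⟨hf, e⟩ := h q (hWV hq)
    rw [value_mul, value_res, value_one, e]
    refine (LocalizedModule.mk_mul_mk ..).trans (Eq.trans ?_ loc_one_def.symm)
    refine LocalizedModule.mk_eq.2 ⟨1, ?_⟩
    congr 1
    rw [one_smul, mul_smul_comm, hbc]
    change f.1 * (b.1 * b.1) = f.1 * (b.1 * b.1) * 1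
    rw [mul_one]
  have e2 : r * A.Spec.presheaf.map (homOfLE (hWV.trans hVU)).op s = 1 := by
    refine section_ext fun q hq => ?_
    obtain ⟨hf, e⟩ := h q (hWV hq)
    rw [value_mul, value_res, value_one, e]
    refine (LocalizedModule.mk_mul_mk ..).trans (Eq.trans ?_ loc_one_def.symm)
    refine LocalizedModule.mk_eq.2 ⟨1, ?_⟩
    congr 1
    rw [one_smul, smul_mul_assoc, hcb]
    change f.1 * (b.1 * b.1) = b.1 * b.1 * f.1 * 1
    rw [mul_one, even_comm f.2]
  rw [← germ_res A.Spec.presheaf p (hWV.trans hVU) hW]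
  exact ⟨⟨_, germ A.Spec.presheaf p W hW r, by rw [← map_mul, e1, map_one],
    by rw [← map_mul, e2, map_one]⟩, rfl⟩

theorem notMem_of_mul_eq_one [NeZero (2 : k)] {A : SAlg k} {p : PrimeSpectrum.Top A.Even}
    (a : A.Even) (c : A) (hc : c ∈ A.grading 1) (f : p.asIdeal.primeCompl) (z : A.Loc p)
    (hz : (LocalizedModule.mk (a.1 + c) f : A.Loc p) * z = 1) : a ∉ p.asIdeal := by
  intro ha
  induction z using LocalizedModule.induction_on with | h b t =>
  rw [LocalizedModule.mk_mul_mk, loc_one_def, LocalizedModule.mk_eq] at hz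
  obtain ⟨u, hu⟩ := hz
  obtain ⟨b0, hb0, b1, hb1, rfl⟩ := exists_decomp b
  rw [one_smul] at hu
  replace hu : u.1.1 * ((a.1 + c) * (b0 + b1)) = u.1.1 * ((f.1 * t.1).1 * 1) := hu
  have h00 : a.1 * b0 ∈ A.grading 0 := by simpa using SetLike.mul_mem_graded (A := A.grading) a.2 hb0
  have h11 : c * b1 ∈ A.grading 0 := SetLike.mul_mem_graded (A := A.grading) hc hb1
  have h01 : a.1 * b1 ∈ A.grading 1 := by simpa using SetLike.mul_mem_graded (A := A.grading) a.2 hb1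
  have h10 : c * b0 ∈ A.grading 1 := by simpa using SetLike.mul_mem_graded (A := A.grading) hc hb0
  have e0 : u.1.1 * (a.1 * b0 + c * b1) - u.1.1 * (f.1 * t.1).1 ∈ A.grading 0 :=
    sub_mem (even_smul_mem u.1 (add_mem h00 h11)) (even_smul_mem u.1 (f.1 * t.1).2)
  have e1 : u.1.1 * (a.1 * b0 + c * b1) - u.1.1 * (f.1 * t.1).1 ∈ A.grading 1 := by
    have : u.1.1 * (a.1 * b0 + c * b1) - u.1.1 * (f.1 * t.1).1 =
        -(u.1.1 * (a.1 * b1 + c * b0)) := by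
      rw [mul_one] at hu
      rw [← hu]
      noncomm_ring
    rw [this]
    exact neg_mem (even_smul_mem u.1 (add_mem h01 h10))
  have e := ((isInternal_iff _).1 A.isInternal).2 _ e0 e1
  have e' : u.1 * (a * ⟨b0, hb0⟩ + ⟨c * b1, h11⟩) = u.1 * (f.1 * t.1) :=
    Subtype.ext (sub_eq_zero.1 e)
  have hn : (⟨c * b1, h11⟩ : A.Even) ∈ p.asIdeal := by
    have : (⟨c * b1, h11⟩ : A.Even) * ⟨c * b1, h11⟩ = 0 := Subtype.ext (odd_mul_odd_sq hc hb1)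
    exact or_self_iff.1 (p.2.mem_or_mem (this ▸ p.asIdeal.zero_mem))
  have hm : u.1 * (f.1 * t.1) ∈ p.asIdeal := by
    rw [← e']
    exact p.asIdeal.mul_mem_left _ (add_mem (p.asIdeal.mul_mem_right _ ha) hn)
  rcases p.2.mem_or_mem hm with h | h
  · exact u.2 h
  · exact (p.2.mem_or_mem h).elim f.2 t.2

theorem specMapHom_isLocal [NeZero (2 : k)] {A B : SAlg k} (φ : A ⟶ B) (p : B.Spec)
    (V : Opens A.Spec) (hV : (specMapHom φ).base p ∈ V) (s : A.Spec.presheaf.obj (op V))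
    (h : IsUnit (germ B.Spec.presheaf p ((Opens.map (specMapHom φ).base).obj V) hV
      ((specMapHom φ).c.app (op V) s))) :
    IsUnit (germ A.Spec.presheaf ((specMapHom φ).base p) V hV s) := by
  obtain ⟨z, hz⟩ := isUnit_value_of_isUnit_germ (U := (Opens.map (specMapHom φ).base).obj V) hV _ h
  obtain ⟨W, hW, i, a, f, hf⟩ := (show A.specSections V from s).2 ⟨specBase φ p, hV⟩
  obtain ⟨a0, ha0, a1, ha1, rfl⟩ := exists_decomp a
  refine isUnit_germ_of_fraction hV s W hW i.le ⟨a0, ha0⟩ ?_ a1 ha1 f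
    fun q hq => hf ⟨q, hq⟩
  obtain ⟨hfp, e⟩ := hf ⟨specBase φ p, hW⟩
  have e' : value ((specMapHom φ).c.app (op V) s) p hV =
      LocalizedModule.mk (φ a0 + φ a1) ⟨evenMap φ f, hfp⟩ :=
    (congrArg (locMap φ p) e).trans
      (congrArg (fun b => (LocalizedModule.mk b ⟨evenMap φ f, hfp⟩ : B.Loc p))
        (φ.map_add' a0 a1))
  exact notMem_of_mul_eq_one (evenMap φ ⟨a0, ha0⟩) (φ a1) (map_mem φ ha1) ⟨evenMap φ f, hfp⟩ z
    ((congrArg (· * z) e'.symm).trans hz)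

variable [NeZero (2 : k)]

/-- The morphism `Spec B ⟶ Spec A` induced by `φ : A ⟶ B`. -/
def specMap {A B : SAlg k} (φ : A ⟶ B) : B.Spec ⟶ A.Spec where
  hom := specMapHom φ
  isLocal := specMapHom_isLocal φ

theorem specMap_comp {A B C : SAlg k} (φ : A ⟶ B) (ψ : B ⟶ C) :
    specMap (φ ≫ ψ) = specMap ψ ≫ specMap φ := by
  have key : ∀ (p : PrimeSpectrum.Top C.Even) (z : A.Loc (specBase (φ ≫ ψ) p)),
      locMap (φ ≫ ψ) p z = locMap ψ p (locMap φ (specBase ψ p) z) := by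
    intro p z
    induction z using LocalizedModule.induction_on with | h a t => rfl
  refine SuperRingedSpace.Hom.ext ?_
  exact congrArg (fun c => (⟨specBase (φ ≫ ψ), c⟩ :
    PresheafedSpace.Hom C.Spec.toPresheafedSpace A.Spec.toPresheafedSpace))
    (NatTrans.ext (funext fun U => hom_ext fun s => Subtype.ext (funext fun x => key x.1 _)))

theorem specMap_id (A : SAlg k) : specMap (𝟙 A) = 𝟙 A.Spec := by
  have key : ∀ (p : PrimeSpectrum.Top A.Even) (z : A.Loc p), locMap (𝟙 A) p z = z := by
    intro p z
    induction z using LocalizedModule.induction_on with | h a t => rfl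
  refine SuperRingedSpace.Hom.ext ?_
  exact congrArg (fun c => (⟨𝟙 (PrimeSpectrum.Top A.Even), c⟩ :
    PresheafedSpace.Hom A.Spec.toPresheafedSpace A.Spec.toPresheafedSpace))
    (NatTrans.ext (funext fun U => hom_ext fun s => Subtype.ext (funext fun x => key x.1 _)))

end SAlg

/-! ### The symmetric superalgebra -/

section Sym

variable (k : Type u) [Field k] (V W : Type u) [AddCommGroup V] [Module k V] [AddCommGroup W]
  [Module k W]

/-- The parity grading of the exterior algebra. -/
abbrev extGrading (i : ZMod 2) : Submodule k (ExteriorAlgebra k W) :=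
  CliffordAlgebra.evenOdd (0 : QuadraticForm k W) i

variable {k W}

theorem ext_even_comm {a : ExteriorAlgebra k W} (ha : a ∈ extGrading k W 0)
    (b : ExteriorAlgebra k W) : a * b = b * a := by
  have h1 : ∀ w : W, a * ExteriorAlgebra.ι k w = ExteriorAlgebra.ι k w * a := by
    intro w
    have sw : ∀ v : W, ExteriorAlgebra.ι k v * ExteriorAlgebra.ι k w =
        -(ExteriorAlgebra.ι k w * ExteriorAlgebra.ι k v) := fun v =>
      eq_neg_of_add_eq_zero_left (ExteriorAlgebra.ι_add_mul_swap v w)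
    induction a, ha using CliffordAlgebra.even_induction with
    | algebraMap r => exact Algebra.commutes r _
    | add x y hx hy ihx ihy => rw [add_mul, mul_add, ihx, ihy]
    | ι_mul_ι_mul m₁ m₂ x hx ih =>
      change ExteriorAlgebra.ι k m₁ * ExteriorAlgebra.ι k m₂ * x * ExteriorAlgebra.ι k w =
        ExteriorAlgebra.ι k w * (ExteriorAlgebra.ι k m₁ * ExteriorAlgebra.ι k m₂ * x)
      rw [mul_assoc, ih, ← mul_assoc, mul_assoc (ExteriorAlgebra.ι k m₁), sw m₂, mul_neg,
        ← mul_assoc, sw m₁]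
      simp only [neg_mul, neg_neg, mul_assoc]
  induction b using ExteriorAlgebra.induction with
  | algebraMap r => exact (Algebra.commutes r a).symm
  | ι w => exact h1 w
  | mul x y hx hy => rw [← mul_assoc, hx, mul_assoc, hy, mul_assoc]
  | add x y hx hy => rw [mul_add, add_mul, hx, hy]

theorem ext_odd_comm {a b : ExteriorAlgebra k W} (ha : a ∈ extGrading k W 1)
    (hb : b ∈ extGrading k W 1) : a * b = -(b * a) := by
  have sw : ∀ v w : W, ExteriorAlgebra.ι k v * ExteriorAlgebra.ι k w =
      -(ExteriorAlgebra.ι k w * ExteriorAlgebra.ι k v) := fun v w =>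
    eq_neg_of_add_eq_zero_left (ExteriorAlgebra.ι_add_mul_swap v w)
  have hev : ∀ m₁ m₂ : W, ExteriorAlgebra.ι k m₁ * ExteriorAlgebra.ι k m₂ ∈ extGrading k W 0 :=
    CliffordAlgebra.ι_mul_ι_mem_evenOdd_zero _
  have h1 : ∀ w : W, a * ExteriorAlgebra.ι k w = -(ExteriorAlgebra.ι k w * a) := by
    intro w
    induction a, ha using CliffordAlgebra.odd_induction with
    | ι v => exact sw v w
    | add x y hx hy ihx ihy => rw [add_mul, mul_add, ihx, ihy, neg_add]
    | ι_mul_ι_mul m₁ m₂ x hx ih =>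
      change ExteriorAlgebra.ι k m₁ * ExteriorAlgebra.ι k m₂ * x * ExteriorAlgebra.ι k w =
        -(ExteriorAlgebra.ι k w * (ExteriorAlgebra.ι k m₁ * ExteriorAlgebra.ι k m₂ * x))
      rw [mul_assoc, ih, mul_neg, ← mul_assoc, ext_even_comm (hev m₁ m₂), mul_assoc]
  induction b, hb using CliffordAlgebra.odd_induction with
  | ι v => exact h1 v
  | add x y hx hy ihx ihy => rw [mul_add, add_mul, ihx, ihy, neg_add]
  | ι_mul_ι_mul m₁ m₂ x hx ih =>
    change a * (ExteriorAlgebra.ι k m₁ * ExteriorAlgebra.ι k m₂ * x) =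
      -(ExteriorAlgebra.ι k m₁ * ExteriorAlgebra.ι k m₂ * x * a)
    rw [← mul_assoc, ← ext_even_comm (hev m₁ m₂) a, mul_assoc, ih, mul_neg,
      mul_assoc _ x a]

theorem ext_superComm (i j : ZMod 2) {a b : ExteriorAlgebra k W} (ha : a ∈ extGrading k W i)
    (hb : b ∈ extGrading k W j) : a * b = (-1 : k) ^ (i.val * j.val) • (b * a) := by
  rcases zmod_two i with rfl | rfl
  · rw [ZMod.val_zero, zero_mul, pow_zero, one_smul, ext_even_comm ha]
  · rcases zmod_two j with rfl | rfl
    · rw [ZMod.val_zero, mul_zero, pow_zero, one_smul, ext_even_comm hb]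
    · rw [ZMod.val_one, mul_one, pow_one, neg_smul, one_smul, ext_odd_comm ha hb]

theorem neg_one_pow_mul_eq_smul {A : Type*} [Ring A] [Algebra k A] (n : ℕ) (z : A) :
    (-1) ^ n * z = (-1 : k) ^ n • z := by
  rw [Algebra.smul_def, map_pow, map_neg, map_one]

variable (k W)

/-- The symmetric superalgebra `Sym(V) ⊗ Λ(W)` of the super vector space with even part `V` and
odd part `W`. -/
def symSuper : SAlg k where
  carrier := SymmetricAlgebra k V ⊗[k] ExteriorAlgebra k W
  grading i := LinearMap.range
    (LinearMap.lTensor (SymmetricAlgebra k V) (extGrading k W i).subtype)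
  gradedMonoid :=
    { one_mem := ⟨1 ⊗ₜ ⟨1, SetLike.GradedOne.one_mem⟩, rfl⟩
      mul_mem := by
        rintro i j _ _ ⟨x, rfl⟩ ⟨y, rfl⟩
        induction x with
        | zero => simp
        | add x x' hx hx' => rw [map_add, add_mul]; exact add_mem hx hx'
        | tmul s a =>
          induction y with
          | zero => simp
          | add y y' hy hy' => rw [map_add, mul_add]; exact add_mem hy hy'
          | tmul t b =>
            exact ⟨(s * t) ⊗ₜ ⟨a.1 * b.1, SetLike.mul_mem_graded a.2 b.2⟩,
              (Algebra.TensorProduct.tmul_mul_tmul s t a.1 b.1).symm⟩ }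
  isInternal := by
    rw [isInternal_iff]
    have hE := (isInternal_iff _).1 (DirectSum.Decomposition.isInternal (extGrading k W))
    refine ⟨fun v => ?_, ?_⟩
    · induction v with
      | zero => exact ⟨0, zero_mem _, 0, zero_mem _, add_zero _⟩
      | add x y hx hy =>
        obtain ⟨a, ha, b, hb, rfl⟩ := hx
        obtain ⟨c, hc, d, hd, rfl⟩ := hy
        exact ⟨_, add_mem ha hc, _, add_mem hb hd, add_add_add_comm _ _ _ _⟩
      | tmul s e =>
        obtain ⟨a, ha, b, hb, rfl⟩ := hE.1 e
        exact ⟨_, ⟨s ⊗ₜ ⟨a, ha⟩, rfl⟩, _, ⟨s ⊗ₜ ⟨b, hb⟩, rfl⟩, (TensorProduct.tmul_add _ _ _).symm⟩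
    · rintro _ ⟨x, rfl⟩ ⟨y, h⟩
      have h0 := congrArg (LinearMap.lTensor (SymmetricAlgebra k V)
        (GradedAlgebra.proj (extGrading k W) 1)) h
      have e1 : GradedAlgebra.proj (extGrading k W) 1 ∘ₗ (extGrading k W 1).subtype =
          (extGrading k W 1).subtype := by
        ext a
        exact DirectSum.decompose_of_mem_same _ a.2
      have e0 : GradedAlgebra.proj (extGrading k W) 1 ∘ₗ (extGrading k W 0).subtype = 0 := by
        ext a
        exact DirectSum.decompose_of_mem_ne _ a.2 (by decide)
      rw [← LinearMap.comp_apply, ← LinearMap.comp_apply, ← LinearMap.lTensor_comp,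
        ← LinearMap.lTensor_comp, e1, e0, LinearMap.lTensor_zero, LinearMap.zero_apply] at h0
      rw [← h, h0]
  superComm := by
    rintro i j _ _ ⟨x, rfl⟩ ⟨y, rfl⟩
    refine Eq.trans ?_ (neg_one_pow_mul_eq_smul (k := k) _ _).symm
    induction x with
    | zero => simp
    | add x x' hx hx' => rw [map_add, add_mul, mul_add, smul_add, hx, hx']
    | tmul s a =>
      induction y with
      | zero => simp
      | add y y' hy hy' => rw [map_add, add_mul, mul_add, smul_add, hy, hy']
      | tmul t b =>
        change (s ⊗ₜ[k] a.1) * (t ⊗ₜ[k] b.1) =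
          (-1 : k) ^ (i.val * j.val) • ((t ⊗ₜ[k] b.1) * (s ⊗ₜ[k] a.1))
        rw [Algebra.TensorProduct.tmul_mul_tmul, Algebra.TensorProduct.tmul_mul_tmul,
          ext_superComm i j a.2 b.2, TensorProduct.tmul_smul, mul_comm s t]

end Sym

/-! ### Superschemes -/

/-- Parity-preserving linear maps between super vector spaces. -/
def smodHom {k V W : Type*} [Field k] [AddCommMonoid V] [Module k V] [AddCommMonoid W] [Module k W]
    (𝒱 : ZMod 2 → Submodule k V) (𝒲 : ZMod 2 → Submodule k W) : Submodule k (V →ₗ[k] W) where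
  carrier := {d | ∀ i, ∀ v ∈ 𝒱 i, d v ∈ 𝒲 i}
  add_mem' hd he i v hv := add_mem (hd i v hv) (he i v hv)
  zero_mem' i _ _ := zero_mem (𝒲 i)
  smul_mem' c _ hd i v hv := (𝒲 i).smul_mem c (hd i v hv)

/-- The even part `V₀ ⊗ W₀ ⊕ V₁ ⊗ W₁` of the tensor product of super vector spaces. -/
def tensorEven {k V W : Type*} [Field k] [AddCommMonoid V] [Module k V] [AddCommMonoid W]
    [Module k W] (𝒱 : ZMod 2 → Submodule k V) (𝒲 : ZMod 2 → Submodule k W) :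
    Submodule k (V ⊗[k] W) :=
  ⨆ i : ZMod 2, LinearMap.range (TensorProduct.map (𝒱 i).subtype (𝒲 i).subtype)

/-- A superscheme: a space with a sheaf of superalgebras whose stalks are local, locally
isomorphic to spectra of superalgebras. -/
structure Superscheme (k : Type u) [Field k] extends SuperRingedSpace k where
  isLocalRing : ∀ x : toSuperRingedSpace, IsLocalRing (stalk presheaf x)
  locallyAffine : ∀ x : toSuperRingedSpace, ∃ (A : SAlg k)
    (j : A.Spec.toPresheafedSpace ⟶ toPresheafedSpace),
      PresheafedSpace.IsOpenImmersion j ∧ x ∈ Set.range j.base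

namespace Superscheme

variable {k : Type u} [Field k]

instance : CoeSort (Superscheme k) (Type u) := ⟨fun X => X.carrier⟩

/-- `X` is algebraic if it has a finite cover by open affine superschemes `Spec A` with `A` a
finitely generated superalgebra. -/
def IsAlgebraic (X : Superscheme k) : Prop :=
  ∃ (n : ℕ) (A : Fin n → SAlg k)
    (j : ∀ i, (A i).Spec.toPresheafedSpace ⟶ X.toPresheafedSpace),
    (∀ i, Algebra.FiniteType k (A i)) ∧ (∀ i, PresheafedSpace.IsOpenImmersion (j i)) ∧
      ∀ x : X, ∃ i, x ∈ Set.range (j i).base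

variable (X : Superscheme k) (x : X)

/-- The local superalgebra `𝒪_{X,x}`. -/
abbrev localRing : SAlg k := stalk X.presheaf x

instance : IsLocalRing (X.localRing x) := X.isLocalRing x

/-- The maximal ideal `𝔪_{X,x}` of `𝒪_{X,x}`. -/
def maxIdeal : Submodule k (X.localRing x) :=
  (maximalIdeal (X.localRing x)).restrictScalars k

/-- The super vector space `𝔪_{X,x} / 𝔪_{X,x}²`. -/
abbrev Cotangent : Type u :=
  X.maxIdeal x ⧸ (X.maxIdeal x * X.maxIdeal x).submoduleOf (X.maxIdeal x)

/-- The class in `𝔪_{X,x} / 𝔪_{X,x}²` of an element of `𝔪_{X,x}`. -/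
def cotangentMk : X.maxIdeal x →ₗ[k] X.Cotangent x := Submodule.mkQ _

/-- The even and odd parts of `𝔪_{X,x} / 𝔪_{X,x}²`: classes of even and odd elements. -/
def cotangentGrading (i : ZMod 2) : Submodule k (X.Cotangent x) :=
  (((X.localRing x).grading i).submoduleOf (X.maxIdeal x)).map (X.cotangentMk x)

/-- The parity-preserving linear maps `𝔪_{X,x} / 𝔪_{X,x}² ⟶ A`. -/
def cotangentHom (A : SAlg k) : Submodule k (X.Cotangent x →ₗ[k] A) :=
  smodHom (X.cotangentGrading x) A.grading

/-- The point `x` is rational: `k ⟶ 𝒪_{X,x} / 𝔪_{X,x}` is an isomorphism (it is automatically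
injective). -/
def IsRational : Prop :=
  ∀ f : X.localRing x, ∃ c : k, f - algebraMap k (X.localRing x) c ∈ X.maxIdeal x

variable {X x}

/-- The value `f(x) ∈ k` at a rational point: the image of `f` in `𝒪_{X,x} / 𝔪_{X,x} = k`. -/
def valueAt (hx : X.IsRational x) (f : X.localRing x) : k := (hx f).choose

theorem sub_valueAt_mem (hx : X.IsRational x) (f : X.localRing x) :
    f - algebraMap k (X.localRing x) (valueAt hx f) ∈ X.maxIdeal x := (hx f).choose_spec

/-- The differential `(df)_x ∈ 𝔪_{X,x} / 𝔪_{X,x}²`, the class of `f - f(x)`. -/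
def differential (hx : X.IsRational x) (f : X.localRing x) : X.Cotangent x :=
  X.cotangentMk x ⟨_, sub_valueAt_mem hx f⟩

/-- Superderivations `D : 𝒪_{X,x} ⟶ k` of parity `i`, where `𝒪_{X,x}` acts on `k` through
`f ↦ f(x)`: `k`-linear maps of parity `i` with
`D(f g) = D(f) g(x) + (-1)^{p(D) p(f)} f(x) D(g)` for homogeneous `f`. -/
def superDer (hx : X.IsRational x) (i : ZMod 2) :
    Submodule k (X.localRing x →ₗ[k] SAlg.base k) where
  carrier := {D | (∀ j, ∀ f ∈ (X.localRing x).grading j, D f ∈ (SAlg.base k).grading (i + j)) ∧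
    ∀ j, ∀ f ∈ (X.localRing x).grading j, ∀ g,
      D (f * g) = valueAt hx g • D f + ((-1) ^ (i.val * j.val) * valueAt hx f) • D g}
  add_mem' := by
    rintro D E ⟨hD, hD'⟩ ⟨hE, hE'⟩
    refine ⟨fun j f hf => add_mem (hD j f hf) (hE j f hf), fun j f hf g => ?_⟩
    rw [LinearMap.add_apply, LinearMap.add_apply, LinearMap.add_apply, hD' j f hf g, hE' j f hf g]
    module
  zero_mem' := ⟨fun j f hf => zero_mem _, fun j f hf g => by simp⟩
  smul_mem' := by
    rintro c D ⟨hD, hD'⟩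
    refine ⟨fun j f hf => Submodule.smul_mem _ c (hD j f hf), fun j f hf g => ?_⟩
    rw [LinearMap.smul_apply, LinearMap.smul_apply, LinearMap.smul_apply, hD' j f hf g]
    module

/-- The tangent space `T_x X = Der(𝒪_{X,x}, k)` at a rational point. -/
def tangentSpace (hx : X.IsRational x) : Submodule k (X.localRing x →ₗ[k] SAlg.base k) :=
  superDer hx 0 ⊔ superDer hx 1

/-- The even and odd parts of the tangent space. -/
def tangentGrading (hx : X.IsRational x) (i : ZMod 2) : Submodule k (tangentSpace hx) :=
  (superDer hx i).submoduleOf (tangentSpace hx)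

/-- Evaluation of tangent vectors at a germ `f`. -/
def tangentEval (hx : X.IsRational x) (f : X.localRing x) : tangentSpace hx →ₗ[k] k :=
  LinearMap.applyₗ f ∘ₗ (tangentSpace hx).subtype

/-- The vector space `(A ⊗ T_x X)₀`. -/
def tangentTensor (hx : X.IsRational x) (A : SAlg k) : Submodule k (A ⊗[k] tangentSpace hx) :=
  tensorEven A.grading (tangentGrading hx)

/-- The map `A ⊗ T_x X ⟶ A`, `a ⊗ D ↦ D(f) a`, for a germ `f`. -/
def tensorEval (hx : X.IsRational x) (A : SAlg k) (f : X.localRing x) :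
    A ⊗[k] tangentSpace hx →ₗ[k] A :=
  (TensorProduct.rid k A).toLinearMap ∘ₗ LinearMap.lTensor A (tangentEval hx f)

/-- The map `φ ⊗ id : A ⊗ T_x X ⟶ B ⊗ T_x X`. -/
def tensorMap (hx : X.IsRational x) {A B : SAlg k} (φ : A ⟶ B) :
    A ⊗[k] tangentSpace hx →ₗ[k] B ⊗[k] tangentSpace hx :=
  LinearMap.rTensor (tangentSpace hx) φ.toAlgHom.toLinearMap

/-- The symmetric superalgebra `Sym((T_x X)^*)` of the dual of the tangent superspace. -/
def symCotangent (hx : X.IsRational x) : SAlg k :=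
  symSuper k (Module.Dual k (tangentGrading hx 0)) (Module.Dual k (tangentGrading hx 1))

/-- The linear function `D ↦ D(f)` on the tangent superspace, as an element of
`Sym((T_x X)^*)`. -/
def coord (hx : X.IsRational x) (f : X.localRing x) : symCotangent hx :=
  ((SymmetricAlgebra.ι k (Module.Dual k (tangentGrading hx 0))
      (tangentEval hx f ∘ₗ (tangentGrading hx 0).subtype) ⊗ₜ[k] 1 +
    1 ⊗ₜ[k] ExteriorAlgebra.ι k (tangentEval hx f ∘ₗ (tangentGrading hx 1).subtype) :
      SymmetricAlgebra k (Module.Dual k (tangentGrading hx 0)) ⊗[k]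
        ExteriorAlgebra k (Module.Dual k (tangentGrading hx 1))))

end Superscheme

/-! ### Supergroups -/

/-- The only point of `Spec k`. -/
def basePoint (k : Type u) [Field k] : (SAlg.base k).Spec :=
  PrimeSpectrum.comap (SAlg.base k).evenVal (⊥ : PrimeSpectrum k)

/-- A section whose germ at `|g|(𝔭)` is invertible has a pullback with invertible value at `𝔭`. -/
theorem exists_value_pullback_mul {k : Type u} [Field k] {A : SAlg k} {Y : SuperRingedSpace k}
    (g : A.Spec.toPresheafedSpace ⟶ Y.toPresheafedSpace) (p : A.Spec) (V : Opens Y)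
    (hV : g.base p ∈ V) (s : Y.presheaf.obj (op V))
    (h : IsUnit (germ Y.presheaf (g.base p) V hV s)) :
    ∃ z : A.Loc p, SAlg.value (U := (Opens.map g.base).obj V) (g.c.app (op V) s) p hV * z = 1 := by
  have res : ∀ (W U : Opens Y) (hW : W ≤ U) (hx : g.base p ∈ W) (r : Y.presheaf.obj (op U)),
      SAlg.value (U := (Opens.map g.base).obj W)
        (g.c.app (op W) (Y.presheaf.map (homOfLE hW).op r)) p hx =
      SAlg.value (U := (Opens.map g.base).obj U) (g.c.app (op U) r) p (hW hx) := by
    intro W U hW hx r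
    exact congrArg (fun r => SAlg.value (U := (Opens.map g.base).obj W) r p hx)
      (DFunLike.congr_fun (F := SAlg.Hom _ _) (g.c.naturality (homOfLE hW).op) r)
  obtain ⟨b, hb⟩ := h.exists_right_inv
  obtain ⟨V', hV', t, rfl⟩ := exists_germ_eq Y.presheaf _ b
  have hx : g.base p ∈ V ⊓ V' := ⟨hV, hV'⟩
  have e : germ Y.presheaf (g.base p) (V ⊓ V') hx
      (Y.presheaf.map (homOfLE (inf_le_left : V ⊓ V' ≤ V)).op s *
        Y.presheaf.map (homOfLE (inf_le_right : V ⊓ V' ≤ V')).op t) =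
      germ Y.presheaf (g.base p) (V ⊓ V') hx 1 := by
    rw [map_mul, germ_res, germ_res, map_one]
    exact hb
  obtain ⟨W, hW, h1, h2, e⟩ := (germ_eq_iff _ _ _ _ _ _).1 e
  have e' := ((res W _ h1 hW _).symm.trans (congrArg (fun r => SAlg.value
    (U := (Opens.map g.base).obj W) (g.c.app (op W) r) p hW) e)).trans (res W _ h2 hW _)
  rw [map_mul, map_one] at e'
  refine ⟨SAlg.value (U := (Opens.map g.base).obj V') (g.c.app (op V') t) p hV', ?_⟩
  rw [← res _ _ inf_le_left hx, ← res _ _ inf_le_right hx]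
  exact e'

/-- An algebraic supergroup over `k`: an algebraic superscheme `X` with a group structure on
`h_X(A) = Hom(Spec A, X)` for every superalgebra `A`, functorial in `A`. -/
structure AlgebraicSupergroup (k : Type u) [Field k] [NeZero (2 : k)] extends Superscheme k where
  isAlgebraic : toSuperscheme.IsAlgebraic
  group : ∀ A : SAlg k, Group (A.Spec ⟶ toSuperRingedSpace)
  map_mul : ∀ {A B : SAlg k} (φ : A ⟶ B) (g h : A.Spec ⟶ toSuperRingedSpace),
    SAlg.specMap φ ≫ (g * h) = (SAlg.specMap φ ≫ g) * (SAlg.specMap φ ≫ h)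

namespace AlgebraicSupergroup

variable {k : Type u} [Field k] [NeZero (2 : k)] (G : AlgebraicSupergroup k)

/-- The `A`-points `G(A) = h_G(A)`. -/
def Points (A : SAlg k) : Type u := A.Spec ⟶ G.toSuperRingedSpace

instance (A : SAlg k) : Group (G.Points A) := G.group A

/-- The homomorphism `G(φ) : G(A) ⟶ G(B)`. -/
def map {A B : SAlg k} (φ : A ⟶ B) : G.Points A →* G.Points B :=
  MonoidHom.mk' (fun g => SAlg.specMap φ ≫ g) (G.map_mul φ)

theorem map_comp {A B C : SAlg k} (φ : A ⟶ B) (ψ : B ⟶ C) (g : G.Points A) :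
    G.map (φ ≫ ψ) g = G.map ψ (G.map φ g) := by
  refine (congrArg (· ≫ (g : A.Spec ⟶ G.toSuperRingedSpace)) (SAlg.specMap_comp φ ψ)).trans ?_
  exact Category.assoc _ _ _

/-- The pullback `g^*(s)` of a section `s` over `U` along `g : Spec A ⟶ G`. -/
def pullback {A : SAlg k} (g : G.Points A) (U : Opens G.toSuperscheme)
    (s : G.presheaf.obj (op U)) :
    A.Spec.presheaf.obj (op ((Opens.map (SuperRingedSpace.Hom.hom g).base).obj U)) :=
  (SuperRingedSpace.Hom.hom g).c.app (op U) s

/-- `Lie(G)(A) = ker(G(A(ε)) ⟶ G(A))`. -/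
def Lie (A : SAlg k) : Subgroup (G.Points A.dual) := (G.map A.dualProj).ker

/-- The homomorphism `Lie(G)(φ) : Lie(G)(A) ⟶ Lie(G)(B)`. -/
def lieMap {A B : SAlg k} (φ : A ⟶ B) : G.Lie A →* G.Lie B :=
  ((G.map (SAlg.dualMap φ)).comp (G.Lie A).subtype).codRestrict (G.Lie B) fun z => by
    change G.map B.dualProj (G.map (SAlg.dualMap φ) z.1) = 1
    rw [← map_comp, SAlg.dualMap_comp_dualProj, map_comp, show G.map A.dualProj z.1 = 1 from z.2,
      map_one]

/-- The unit `e : Spec k ⟶ G`. -/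
def unit : (SAlg.base k).Spec ⟶ G.toSuperRingedSpace := (1 : G.Points (SAlg.base k))

/-- The identity `1_G ∈ |G|`, the image of the unit. -/
def identity : G.toSuperscheme := G.unit.hom.base (basePoint k)

/-- The identity is a rational point. -/
theorem identity_isRational : G.toSuperscheme.IsRational G.identity := by
  intro f
  obtain ⟨V, hV, s, rfl⟩ := exists_germ_eq G.presheaf _ f
  obtain ⟨W, hW, i, r, t, h⟩ := (show (SAlg.base k).specSections
    ((Opens.map G.unit.hom.base).obj V) from G.unit.hom.c.app (op V) s).2 ⟨basePoint k, hV⟩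
  obtain ⟨ht, e⟩ := h ⟨basePoint k, hW⟩
  let t' : k := t.1
  have ht0 : t' ≠ 0 := fun h0 => ht (show t ∈ PrimeSpectrum.asIdeal (basePoint k) from by
    have : t = 0 := Subtype.ext h0
    rw [this]
    exact Ideal.zero_mem _)
  let r' : k := r
  refine ⟨r' / t', fun hu => ?_⟩
  have hu' : IsUnit (germ G.presheaf G.identity V hV (s - algebraMap k _ (r' / t'))) := by
    rw [map_sub, AlgHom.commutes]
    exact hu
  obtain ⟨z, hz⟩ := exists_value_pullback_mul (Y := G.toSuperRingedSpace) G.unit.hom (basePoint k)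
    V hV _ hu'
  have e0 : SAlg.value (U := (Opens.map G.unit.hom.base).obj V)
      (G.unit.hom.c.app (op V) (s - algebraMap k _ (r' / t'))) (basePoint k) hV = 0 := by
    rw [map_sub]
    have e1 : SAlg.value (U := (Opens.map G.unit.hom.base).obj V) (G.unit.hom.c.app (op V)
        (algebraMap k _ (r' / t'))) (basePoint k) hV = SAlg.value (algebraMap k
          ((SAlg.base k).Spec.presheaf.obj (op ((Opens.map G.unit.hom.base).obj V))) (r' / t'))
          (basePoint k) hV :=
      congrArg (fun r => SAlg.value (U := (Opens.map G.unit.hom.base).obj V) r (basePoint k) hV)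
        ((G.unit.hom.c.app (op V)).commutes' (r' / t'))
    refine sub_eq_zero.2 (e.trans (Eq.trans ?_ e1.symm))
    refine LocalizedModule.mk_eq.2 ⟨1, ?_⟩
    congr 1
    change (1 : k) * r' = t' * (r' / t')
    field_simp
  rw [e0, zero_mul] at hz
  obtain ⟨u, hu⟩ := LocalizedModule.mk_eq.1
    ((LocalizedModule.zero_mk 1).trans (hz.trans SAlg.loc_one_def))
  refine u.2 (show u.1 ∈ PrimeSpectrum.asIdeal (basePoint k) from ?_)
  have : u.1 = 0 := Subtype.ext (by
    have h2 : (u.1.1 : k) * (1 * 0) = u.1.1 * (1 * 1) := hu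
    rw [mul_one, mul_one, mul_zero, mul_zero] at h2
    exact h2.symm)
  rw [this]
  exact Ideal.zero_mem _

end AlgebraicSupergroup

end Super

end

open Super Super.Superscheme

/-! An element `z` of `Lie(G)(A)` is a morphism `Spec A(ε) ⟶ G` whose restriction to `Spec A` is the
unit of `G(A)`. That unit factors through `Spec k`, so topologically it is constant with value
`1_G`; since `ε` is nilpotent, `Spec A` and `Spec A(ε)` have the same points, and `z` is constant
too. The global sections of `Spec C` are `C`, so a morphism `Spec C ⟶ Y` that is constant with value
`y` is determined by a homomorphism `𝒪_{Y,y} ⟶ C` (`stalkHom`, `hom_ext_of_stalkHom`). Conversely, a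
homomorphism that takes nonunits to nilpotents defines such a morphism (`ofStalkHom`), because
nilpotent germs are never invertible.

Hence `z` amounts to a homomorphism `𝒪_{G,1} ⟶ A(ε)` of the form `f ↦ f(1_G) + ε δ(f)`. Here `δ`
kills constants and `m²`, so it is a parity-preserving linear map `d` on `m/m²`, and every such `d`
occurs by the Leibniz rule for the differential. Multiplication in `Lie(G)(A)` becomes addition
(`lieToHom_mul`) by functoriality alone: in `G(A(ε)(ε'))` take the product `u` of `z`, with
parameter `ε`, and `w`, with parameter `ε'`. Setting `ε' = 0` gives `z`, setting `ε = 0` gives `w`,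
and setting `ε' = ε` gives `z * w`; so the coefficient of `ε` in `z * w` is the sum of the two
linear coefficients of `u`.

For the tangent superspace, a superderivation kills `1` and `m²`, and a functional on `m/m²` of
parity `i` gives the superderivation `f ↦ δ(df)`. The sign in the super Leibniz rule is invisible,
because odd germs square to zero in characteristic different from 2 and therefore vanish at the
point. As `G` is algebraic, `m/m²` is finite-dimensional (`finite_cotangent_of_chart`). Therefore `A
⊗ (m/m²)^* ≅ Hom(m/m², A)`, which gives the second assertion, and `(m/m²)_i ≅ (T_i)^*`, which
together with the universal property of `Sym ⊗ Λ` gives the third. -/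

noncomputable section

namespace Super

/-! ### Global sections of affine superschemes and morphisms of superalgebras -/

namespace SAlg
variable {k : Type u} [Field k]

/-- The structure sheaf of `Spec A` is the sheaf of the `A₀`-module `A`, whose global sections are
the module itself. The equation `U = ⊤` is a hypothesis because the lemma is applied to preimages of
open sets under constant maps. -/
theorem toSection_bijective (A : SAlg k) {U : Opens A.Spec} (hU : U = ⊤) :
    Function.Bijective (A.toSection U) := by
  subst hU
  exact AlgebraicGeometry.StructureSheaf.toOpenₗ_top_bijective (R := A.Even) (M := A)

theorem specMapHom_toSection {A B : SAlg k} (φ : A ⟶ B) (U : Opens A.Spec) (a : A) :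
    (specMapHom φ).c.app (op U) (A.toSection U a) =
      B.toSection ((Opens.map (specMapHom φ).base).obj U) (φ a) := by
  refine section_ext fun p hp => ?_
  change locMap φ p (LocalizedModule.mk a 1) = LocalizedModule.mk (φ a) 1
  refine (locMap_mk φ p a 1).trans ?_
  congr 1
  exact Subtype.ext (map_one (evenMap φ))

section Hom
variable {A B : SAlg k} (f : A ⟶ B)

theorem hom_zero : f 0 = 0 := f.map_zero'
theorem hom_one : f 1 = 1 := f.map_one'
theorem hom_add (a b : A) : f (a + b) = f a + f b := f.map_add' a b
theorem hom_mul (a b : A) : f (a * b) = f a * f b := f.map_mul' a b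
theorem hom_sub (a b : A) : f (a - b) = f a - f b := map_sub f.toAlgHom a b
theorem hom_smul (c : k) (a : A) : f (c • a) = c • f a := map_smul f.toAlgHom c a
theorem hom_algebraMap (r : k) : f (algebraMap k A r) = algebraMap k B r := f.commutes' r

end Hom

theorem base_grading_zero : (base k).grading 0 = ⊤ :=
  show (if (0 : ZMod 2) = 0 then (⊤ : Submodule k k) else ⊥) = ⊤ from if_pos rfl

theorem base_grading_one : (base k).grading 1 = ⊥ :=
  show (if (1 : ZMod 2) = 0 then (⊤ : Submodule k k) else ⊥) = ⊥ from if_neg one_ne_zero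

theorem base_mem_zero (a : base k) : a ∈ (base k).grading 0 :=
  base_grading_zero (k := k) ▸ Submodule.mem_top

theorem base_eq_zero {a : base k} (ha : a ∈ (base k).grading 1) : a = 0 :=
  (Submodule.mem_bot k).1 (base_grading_one (k := k) ▸ ha)

/-- The unique morphism from the ground field. -/
def fromBase (A : SAlg k) : base k ⟶ A where
  toFun c := algebraMap k A c
  map_one' := map_one _
  map_mul' := map_mul _
  map_zero' := map_zero _
  map_add' := map_add _
  commutes' _ := rfl
  map_mem' i a ha := by
    rcases zmod_two i with rfl | rfl
    · exact A.evenSubalgebra.algebraMap_mem a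
    · obtain rfl := base_eq_zero ha
      exact (map_zero (algebraMap k A)).symm ▸ zero_mem _

end SAlg

/-! ### Morphisms from affine superschemes supported at a point -/

namespace SuperRingedSpace
variable {k : Type u} [Field k] {Y : SuperRingedSpace k} {C : SAlg k}

section StalkHom
variable (g : C.Spec ⟶ Y) {y : Y} (hg : ∀ p : C.Spec, g.hom.base p = y)

/-- `c ∈ C` is the pullback of the germ `f` along the morphism `g`. -/
def IsPullback (f : stalk Y.presheaf y) (c : C) : Prop :=
  ∃ (U : Opens Y) (hU : y ∈ U) (s : Y.presheaf.obj (op U)), germ Y.presheaf y U hU s = f ∧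
    g.hom.c.app (op U) s = C.toSection ((Opens.map g.hom.base).obj U) c

include hg in
theorem preimage_eq_top {U : Opens Y} (hU : y ∈ U) : (Opens.map g.hom.base).obj U = ⊤ :=
  Opens.ext (Set.eq_univ_of_forall fun p => by
    change g.hom.base p ∈ U
    rwa [hg p])

theorem pullback_res {U V : Opens Y} (h : V ≤ U) (s : Y.presheaf.obj (op U)) (c : C)
    (e : g.hom.c.app (op U) s = C.toSection ((Opens.map g.hom.base).obj U) c) :
    g.hom.c.app (op V) (Y.presheaf.map (homOfLE h).op s) =
      C.toSection ((Opens.map g.hom.base).obj V) c := by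
  refine (DFunLike.congr_fun (F := SAlg.Hom _ _) (g.hom.c.naturality (homOfLE h).op) s).trans ?_
  exact congrArg (C.Spec.presheaf.map ((Opens.map g.hom.base).map (homOfLE h)).op) e

include hg in
theorem exists_isPullback (f : stalk Y.presheaf y) : ∃ c, IsPullback g f c := by
  obtain ⟨U, hU, s, rfl⟩ := exists_germ_eq Y.presheaf y f
  obtain ⟨c, hc⟩ := (C.toSection_bijective (preimage_eq_top g hg hU)).2 (g.hom.c.app (op U) s)
  exact ⟨c, U, hU, s, rfl, hc.symm⟩

include hg in
-- The choice of a representative of the germ does not matter: two representatives agree on a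
-- smaller neighbourhood of `y`, whose preimage is still all of `Spec C`, so that nothing is lost by
-- restricting.
theorem IsPullback.pullback_eq {f : stalk Y.presheaf y} {c : C} (h : IsPullback g f c)
    (U : Opens Y) (hU : y ∈ U) (s : Y.presheaf.obj (op U))
    (hs : germ Y.presheaf y U hU s = f) :
    g.hom.c.app (op U) s = C.toSection ((Opens.map g.hom.base).obj U) c := by
  obtain ⟨V, hV, t, ht, e⟩ := h
  obtain ⟨W, hW, hWU, hWV, e'⟩ := (germ_eq_iff _ _ hU hV s t).1 (hs.trans ht.symm)
  obtain ⟨b, hb⟩ := (C.toSection_bijective (preimage_eq_top g hg hU)).2 (g.hom.c.app (op U) s)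
  have h1 := pullback_res g hWU s b hb.symm
  have h2 := pullback_res g hWV t c e
  rw [e', h2] at h1
  rw [← hb, (C.toSection_bijective (preimage_eq_top g hg hW)).1 h1]

include hg in
theorem IsPullback.unique {f : stalk Y.presheaf y} {b c : C} (hb : IsPullback g f b)
    (hc : IsPullback g f c) : b = c := by
  obtain ⟨U, hU, s, hs, e⟩ := hb
  exact (C.toSection_bijective (preimage_eq_top g hg hU)).1
    (e.symm.trans (hc.pullback_eq g hg U hU s hs))

/-- The homomorphism `𝒪_{Y,y} ⟶ C` defined by a morphism `Spec C ⟶ Y` with image `y`. -/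
def stalkHom : stalk Y.presheaf y ⟶ C where
  toFun f := (exists_isPullback g hg f).choose
  map_one' := by
    refine (exists_isPullback g hg _).choose_spec.unique g hg
      ⟨⊤, trivial, 1, map_one _, ?_⟩
    exact (SAlg.hom_one (g.hom.c.app (op ⊤))).trans (SAlg.hom_one (C.toSection _)).symm
  map_zero' := by
    refine (exists_isPullback g hg _).choose_spec.unique g hg
      ⟨⊤, trivial, 0, map_zero _, ?_⟩
    exact (SAlg.hom_zero (g.hom.c.app (op ⊤))).trans (SAlg.hom_zero (C.toSection _)).symm
  map_mul' a b := by
    refine (exists_isPullback g hg _).choose_spec.unique g hg ?_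
    obtain ⟨U, hU, s, t, hs, ht⟩ := exists_germ_eq₂ Y.presheaf y a b
    refine ⟨U, hU, s * t, (map_mul _ s t).trans (congrArg₂ (· * ·) hs ht), ?_⟩
    refine (SAlg.hom_mul (g.hom.c.app (op U)) s t).trans
      (Eq.trans ?_ (SAlg.hom_mul (C.toSection _) _ _).symm)
    exact congrArg₂ (· * ·) ((exists_isPullback g hg a).choose_spec.pullback_eq g hg U hU s hs)
      ((exists_isPullback g hg b).choose_spec.pullback_eq g hg U hU t ht)
  map_add' a b := by
    refine (exists_isPullback g hg _).choose_spec.unique g hg ?_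
    obtain ⟨U, hU, s, t, hs, ht⟩ := exists_germ_eq₂ Y.presheaf y a b
    refine ⟨U, hU, s + t, (map_add _ s t).trans (congrArg₂ (· + ·) hs ht), ?_⟩
    refine (SAlg.hom_add (g.hom.c.app (op U)) s t).trans
      (Eq.trans ?_ (SAlg.hom_add (C.toSection _) _ _).symm)
    exact congrArg₂ (· + ·) ((exists_isPullback g hg a).choose_spec.pullback_eq g hg U hU s hs)
      ((exists_isPullback g hg b).choose_spec.pullback_eq g hg U hU t ht)
  commutes' r := by
    refine (exists_isPullback g hg _).choose_spec.unique g hg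
      ⟨⊤, trivial, algebraMap k _ r, AlgHom.commutes _ r, ?_⟩
    exact ((g.hom.c.app (op ⊤)).commutes' r).trans ((C.toSection _).commutes' r).symm
  map_mem' i f hf := by
    obtain ⟨U, hU, s, hs, rfl⟩ := hf
    have e := (exists_isPullback g hg _).choose_spec.pullback_eq g hg U hU s rfl
    generalize (exists_isPullback g hg (germ Y.presheaf y U hU s)).choose = c at e
    have hc := SAlg.map_mem (g.hom.c.app (op U)) hs
    -- `toSection` is only known to preserve parity. The parity of `c` is recovered by splitting
    -- `c`: the component of the wrong parity has zero image, hence is zero by injectivity.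
    obtain ⟨b0, h0, b1, h1, hb⟩ := SAlg.exists_decomp c
    have hi := preimage_eq_top g hg hU
    have hS := ((isInternal_iff _).1
      (C.Spec.presheaf.obj (op ((Opens.map g.hom.base).obj U))).isInternal).2
    have h0' := SAlg.map_mem (C.toSection ((Opens.map g.hom.base).obj U)) h0
    have h1' := SAlg.map_mem (C.toSection ((Opens.map g.hom.base).obj U)) h1
    have e' : g.hom.c.app (op U) s = C.toSection ((Opens.map g.hom.base).obj U) b0 +
      C.toSection ((Opens.map g.hom.base).obj U) b1 := by
      rw [← hb] at e
      exact e.trans (SAlg.hom_add (C.toSection _) b0 b1)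
    rw [e'] at hc
    subst hb
    rcases zmod_two i with rfl | rfl
    · have := hS _ ((Submodule.add_mem_iff_right _ h0').1 hc) h1'
      have : b1 = 0 :=
        (C.toSection_bijective hi).1 (this.trans (SAlg.hom_zero (C.toSection _)).symm)
      subst this
      simpa using h0
    · have := hS _ h0' ((Submodule.add_mem_iff_left _ h1').1 hc)
      have : b0 = 0 :=
        (C.toSection_bijective hi).1 (this.trans (SAlg.hom_zero (C.toSection _)).symm)
      subst this
      simpa using h1

theorem stalkHom_germ (U : Opens Y) (hU : y ∈ U) (s : Y.presheaf.obj (op U)) :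
    g.hom.c.app (op U) s =
      C.toSection ((Opens.map g.hom.base).obj U) (stalkHom g hg (germ Y.presheaf y U hU s)) :=
  (exists_isPullback g hg _).choose_spec.pullback_eq g hg U hU s rfl

theorem stalkHom_eq_of_pullback (U : Opens Y) (hU : y ∈ U) (s : Y.presheaf.obj (op U)) (c : C)
    (h : g.hom.c.app (op U) s = C.toSection ((Opens.map g.hom.base).obj U) c) :
    stalkHom g hg (germ Y.presheaf y U hU s) = c :=
  (C.toSection_bijective (preimage_eq_top g hg hU)).1
    ((stalkHom_germ g hg U hU s).symm.trans h)

end StalkHom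

/-- Pulled-back sections are compared pointwise, and a point in the preimage of `U` forces `y ∈ U`.
So open sets that miss `y` need no separate treatment. -/
theorem hom_ext_of_stalkHom {g g' : C.Spec ⟶ Y} {y : Y} (hg : ∀ p : C.Spec, g.hom.base p = y)
    (hg' : ∀ p : C.Spec, g'.hom.base p = y) (h : stalkHom g hg = stalkHom g' hg') : g = g' := by
  obtain ⟨⟨b, c⟩, l⟩ := g
  obtain ⟨⟨b', c'⟩, l'⟩ := g'
  obtain rfl : b = b' := by
    ext p
    exact (hg p).trans (hg' p).symm
  suffices c = c' by
    subst this
    rfl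
  apply NatTrans.ext
  funext U
  refine SAlg.hom_ext fun s => ?_
  refine SAlg.section_ext (A := C) (U := (Opens.map b).obj U.unop) fun p hp => ?_
  have hU : y ∈ U.unop := (hg p) ▸ (show b p ∈ U.unop from hp)
  have e := (stalkHom_germ (Y := Y) _ hg U.unop hU s).trans
    (congrArg (fun ψ => C.toSection ((Opens.map b).obj U.unop)
      ((ψ : stalk Y.presheaf y ⟶ C) (germ Y.presheaf y U.unop hU s))) h)
  exact congrArg (fun r => SAlg.value (U := (Opens.map b).obj U.unop) r p hp)
    (e.trans (stalkHom_germ _ hg' U.unop hU s).symm)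

theorem stalkHom_specMap [NeZero (2 : k)] {D : SAlg k} (φ : C ⟶ D) (g : C.Spec ⟶ Y) {y : Y}
    (hg : ∀ p : C.Spec, g.hom.base p = y)
    (hg' : ∀ p : D.Spec, (SAlg.specMap φ ≫ g).hom.base p = y) :
    stalkHom (SAlg.specMap φ ≫ g) hg' = stalkHom g hg ≫ φ := by
  refine SAlg.hom_ext fun f => ?_
  obtain ⟨U, hU, s, rfl⟩ := exists_germ_eq Y.presheaf y f
  refine stalkHom_eq_of_pullback _ hg' U hU s _ ?_
  refine (congrArg ((SAlg.specMapHom φ).c.app (op ((Opens.map g.hom.base).obj U)))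
    (stalkHom_germ g hg U hU s)).trans ?_
  exact SAlg.specMapHom_toSection φ _ _

/-- A power of an invertible nilpotent germ would make `0` invertible in the stalk, hence `1 = 0` in
`C_𝔭`, which means that some element outside `𝔭` is zero. This supplies the locality on stalks of
the morphisms built by `ofStalkHom`. -/
theorem not_isUnit_germ_toSection {p : C.Spec} {U : Opens C.Spec} (hp : p ∈ U) {c : C}
    (hc : IsNilpotent c) : ¬ IsUnit (germ C.Spec.presheaf p U hp (C.toSection U c)) := by
  intro h
  have h0 : IsNilpotent (germ C.Spec.presheaf p U hp (C.toSection U c)) :=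
    (hc.map (C.toSection U).toAlgHom).map (germ C.Spec.presheaf p U hp)
  obtain ⟨n, hn⟩ := h0
  obtain ⟨z, hz⟩ := SAlg.isUnit_value_of_isUnit_germ (s := 0) hp (by
    rw [map_zero, ← hn]
    exact h.pow n)
  replace hz : (0 : C.Loc p) * z = 1 := hz
  rw [zero_mul] at hz
  obtain ⟨u, hu⟩ := LocalizedModule.mk_eq.1
    ((LocalizedModule.zero_mk 1).trans (hz.trans SAlg.loc_one_def))
  refine u.2 (show u.1 ∈ PrimeSpectrum.asIdeal p from ?_)
  have : u.1 = 0 := Subtype.ext (by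
    have h2 : u.1.1 * ((1 : C) * 0) = u.1.1 * (1 * 1) := hu
    rw [mul_one, mul_one, mul_zero, mul_zero] at h2
    exact h2.symm)
  rw [this]
  exact Ideal.zero_mem _

/-- Pullback of sections along the morphism `Spec C ⟶ Y` with image `y` that is defined by a
homomorphism `𝒪_{Y,y} ⟶ C`. -/
def constPullback {y : Y} (ψ : stalk Y.presheaf y ⟶ C) (U : Opens Y) :
    Y.presheaf.obj (op U) ⟶ C.specObj ((Opens.map
      (TopCat.ofHom (ContinuousMap.const (PrimeSpectrum.Top C.Even) y))).obj U) where
  toFun s := (⟨fun x => LocalizedModule.mk (ψ (germ Y.presheaf y U x.2 s)) 1,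
    fun x => ⟨_, x.2, 𝟙 _, ψ (germ Y.presheaf y U x.2 s), 1, fun z =>
      ⟨fun h => z.1.2.ne_top ((Ideal.eq_top_iff_one _).2 h), rfl⟩⟩⟩ : C.specSections _)
  map_one' := Subtype.ext <| funext fun p => by
    refine Eq.trans ?_ SAlg.loc_one_def.symm
    exact congrArg (LocalizedModule.mk · 1) ((congrArg ψ (map_one _)).trans ψ.map_one')
  map_mul' s t := Subtype.ext <| funext fun p => by
    refine Eq.trans ?_ (LocalizedModule.mk_mul_mk ..).symm
    rw [mul_one]
    exact congrArg (LocalizedModule.mk · 1) ((congrArg ψ (map_mul _ s t)).trans (ψ.map_mul' _ _))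
  map_zero' := Subtype.ext <| funext fun p => by
    refine Eq.trans ?_ (LocalizedModule.zero_mk 1)
    exact congrArg (LocalizedModule.mk · 1) ((congrArg ψ (map_zero _)).trans ψ.map_zero')
  map_add' s t := Subtype.ext <| funext fun p => by
    refine Eq.trans ?_ (SAlg.loc_mk_add _ _ _).symm
    exact congrArg (LocalizedModule.mk · 1) ((congrArg ψ (map_add _ s t)).trans (ψ.map_add' _ _))
  commutes' r := Subtype.ext <| funext fun p =>
    congrArg (LocalizedModule.mk · 1) ((congrArg ψ (AlgHom.commutes _ r)).trans (ψ.commutes' r))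
  map_mem' i s hs x := ⟨_, SAlg.map_mem ψ ⟨U, x.2, s, hs, rfl⟩, 1, rfl⟩

/-- The map `Spec C ⟶ Y` with image `y` and a homomorphism `𝒪_{Y,y} ⟶ C`, as a morphism of
presheafed spaces. -/
def constHom {y : Y} (ψ : stalk Y.presheaf y ⟶ C) :
    C.Spec.toPresheafedSpace ⟶ Y.toPresheafedSpace where
  base := TopCat.ofHom (ContinuousMap.const (PrimeSpectrum.Top C.Even) y)
  c :=
    { app := fun U => constPullback ψ U.unop
      naturality := fun _ _ i => SAlg.hom_ext fun s => Subtype.ext <| funext fun p =>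
        congrArg (fun f => (LocalizedModule.mk (ψ f) 1 : C.Loc p.1))
          (germ_res Y.presheaf y i.unop.le p.2 s) }

theorem constHom_app {y : Y} (ψ : stalk Y.presheaf y ⟶ C) (U : Opens Y) (hU : y ∈ U)
    (s : Y.presheaf.obj (op U)) :
    (constHom ψ).c.app (op U) s =
      C.toSection ((Opens.map (constHom ψ).base).obj U) (ψ (germ Y.presheaf y U hU s)) := rfl

/-- The morphism `Spec C ⟶ Y` with image `y` defined by a homomorphism `ψ : 𝒪_{Y,y} ⟶ C` that
takes nonunits to nilpotent elements. -/
def ofStalkHom {y : Y} (ψ : stalk Y.presheaf y ⟶ C)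
    (hψ : ∀ f : stalk Y.presheaf y, ¬ IsUnit f → IsNilpotent (ψ f)) : C.Spec ⟶ Y where
  hom := constHom ψ
  isLocal p V hV s h := by
    refine Classical.byContradiction fun hs => ?_
    have e : (constHom ψ).c.app (op V) s = C.toSection ((Opens.map (constHom ψ).base).obj V)
      (ψ (germ Y.presheaf y V hV s)) := constHom_app ψ V hV s
    rw [e] at h
    exact not_isUnit_germ_toSection (C := C) (p := p)
      (U := (Opens.map (constHom ψ).base).obj V) hV (hψ _ hs) h

theorem stalkHom_ofStalkHom {y : Y} (ψ : stalk Y.presheaf y ⟶ C)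
    (hψ : ∀ f : stalk Y.presheaf y, ¬ IsUnit f → IsNilpotent (ψ f)) :
    stalkHom (ofStalkHom ψ hψ) (fun _ => rfl) = ψ := by
  refine SAlg.hom_ext fun f => ?_
  obtain ⟨U, hU, s, rfl⟩ := exists_germ_eq Y.presheaf y f
  exact stalkHom_eq_of_pullback _ _ U hU s _ (constHom_app ψ U hU s)

end SuperRingedSpace

/-- In a local ring, a right multiple of a nonunit is a nonunit. -/
theorem mul_mem_maximalIdeal {R : Type*} [Ring R] [IsLocalRing R] {a : R}
    (ha : a ∈ maximalIdeal R) (c : R) : a * c ∈ maximalIdeal R := by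
  rintro ⟨u, hu⟩
  -- `b` is a right inverse of `a`. Since `b * a` lies in the left ideal of nonunits, `1 - b * a` is
  -- a unit; but `(1 - b * a) * b = 0`, so `b = 0`, contradicting `a * b = 1`.
  set b := c * (↑u⁻¹ : R) with hb
  have h : a * b = 1 := by rw [hb, ← mul_assoc, ← hu, Units.mul_inv]
  have hba : b * a ∈ maximalIdeal R := (maximalIdeal R).mul_mem_left b ha
  have hadd : b * a + (1 - b * a) = 1 := add_sub_cancel _ _
  have h1 : IsUnit (1 - b * a) :=
    (IsLocalRing.isUnit_or_isUnit_of_add_one hadd).resolve_left hba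
  have h2 : (1 - b * a) * b = 0 := by rw [sub_mul, one_mul, mul_assoc, h, mul_one, sub_self]
  have h3 : b = 0 := h1.mul_right_eq_zero.1 h2
  rw [h3, mul_zero] at h
  exact zero_ne_one h

/-! ### Values at a rational point and the grading of the cotangent space -/

namespace Superscheme

variable {k : Type u} [Field k] {X : Superscheme k} {x : X}

theorem mul_mem_maxIdeal_left (f : X.localRing x) {g : X.localRing x} (hg : g ∈ X.maxIdeal x) :
    f * g ∈ X.maxIdeal x := (maximalIdeal (X.localRing x)).mul_mem_left f hg

theorem mul_mem_maxIdeal_right {f : X.localRing x} (hf : f ∈ X.maxIdeal x) (g : X.localRing x) :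
    f * g ∈ X.maxIdeal x := mul_mem_maximalIdeal (R := X.localRing x) hf g

theorem algebraMap_mem_maxIdeal {c : k} (h : algebraMap k (X.localRing x) c ∈ X.maxIdeal x) :
    c = 0 := by
  by_contra hc
  exact h ((IsUnit.mk0 c hc).map (algebraMap k (X.localRing x)))

/-- Nonzero constants are units, so `k` meets the maximal ideal only in zero. This uniqueness is
what makes the chosen value `valueAt` additive and multiplicative. -/
theorem eq_of_sub_mem {f : X.localRing x} {a b : k}
    (ha : f - algebraMap k (X.localRing x) a ∈ X.maxIdeal x)
    (hb : f - algebraMap k (X.localRing x) b ∈ X.maxIdeal x) : a = b := by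
  have h := (X.maxIdeal x).sub_mem hb ha
  rw [sub_sub_sub_cancel_left, ← map_sub] at h
  exact sub_eq_zero.1 (algebraMap_mem_maxIdeal h)

variable (hx : X.IsRational x)

theorem valueAt_eq {f : X.localRing x} {c : k}
    (h : f - algebraMap k (X.localRing x) c ∈ X.maxIdeal x) : valueAt hx f = c :=
  eq_of_sub_mem (sub_valueAt_mem hx f) h

theorem valueAt_algebraMap (c : k) : valueAt hx (algebraMap k (X.localRing x) c) = c :=
  valueAt_eq hx (by rw [sub_self]; exact zero_mem _)

theorem valueAt_add (f g : X.localRing x) : valueAt hx (f + g) = valueAt hx f + valueAt hx g :=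
  valueAt_eq hx (by
    rw [map_add, add_sub_add_comm]
    exact add_mem (sub_valueAt_mem hx f) (sub_valueAt_mem hx g))

theorem valueAt_mul (f g : X.localRing x) : valueAt hx (f * g) = valueAt hx f * valueAt hx g :=
  valueAt_eq hx (by
    have e : f * g - algebraMap k (X.localRing x) (valueAt hx f * valueAt hx g) =
        (f - algebraMap k (X.localRing x) (valueAt hx f)) * g +
          algebraMap k (X.localRing x) (valueAt hx f) *
            (g - algebraMap k (X.localRing x) (valueAt hx g)) := by
      rw [map_mul, sub_mul, mul_sub, sub_add_sub_cancel]
    rw [e]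
    exact add_mem (mul_mem_maxIdeal_right (sub_valueAt_mem hx f) g)
      (mul_mem_maxIdeal_left _ (sub_valueAt_mem hx g)))

/-- Evaluation at a rational point, as a homomorphism of algebras. -/
def valueHom : X.localRing x →ₐ[k] k where
  toFun := valueAt hx
  map_one' := by simpa using valueAt_algebraMap hx 1
  map_mul' := valueAt_mul hx
  map_zero' := by simpa using valueAt_algebraMap hx 0
  map_add' := valueAt_add hx
  commutes' := valueAt_algebraMap hx

theorem valueAt_eq_zero_iff {f : X.localRing x} : valueAt hx f = 0 ↔ f ∈ X.maxIdeal x := by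
  refine ⟨fun h => ?_, fun h => valueAt_eq hx (by rwa [map_zero, sub_zero])⟩
  have := sub_valueAt_mem hx f
  rwa [h, map_zero, sub_zero] at this

theorem valueAt_smul (c : k) (f : X.localRing x) : valueAt hx (c • f) = c * valueAt hx f :=
  map_smul (valueHom hx) c f

theorem valueAt_one : valueAt hx 1 = 1 := map_one (valueHom hx)

/-- Odd elements have square zero because `2` is invertible, and the square of a unit is a unit.
Through this lemma the maximal ideal is graded and odd germs have value zero. -/
theorem odd_mem_maxIdeal [NeZero (2 : k)] {f : X.localRing x}
    (hf : f ∈ (X.localRing x).grading 1) : f ∈ X.maxIdeal x := fun h => by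
  have h0 := h.mul h
  rw [SAlg.odd_sq hf] at h0
  exact not_isUnit_zero h0

theorem exists_decomp_maxIdeal [NeZero (2 : k)] {f : X.localRing x} (hf : f ∈ X.maxIdeal x) :
    ∃ a ∈ (X.localRing x).grading 0, a ∈ X.maxIdeal x ∧
      ∃ b ∈ (X.localRing x).grading 1, b ∈ X.maxIdeal x ∧ a + b = f := by
  obtain ⟨a, ha, b, hb, rfl⟩ := SAlg.exists_decomp f
  have hb' := odd_mem_maxIdeal hb
  exact ⟨a, ha, (Submodule.add_mem_iff_left _ hb').1 hf, b, hb, hb', rfl⟩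

/-- A product of two elements of `m` splits by expanding their homogeneous components, which again
lie in `m`. Thus `m²` is a graded subspace, as is needed for a grading on `m/m²`. -/
theorem exists_decomp_maxIdeal_sq [NeZero (2 : k)] {f : X.localRing x}
    (hf : f ∈ X.maxIdeal x * X.maxIdeal x) :
    ∃ a ∈ (X.localRing x).grading 0, a ∈ X.maxIdeal x * X.maxIdeal x ∧
      ∃ b ∈ (X.localRing x).grading 1, b ∈ X.maxIdeal x * X.maxIdeal x ∧ a + b = f := by
  induction hf using Submodule.mul_induction_on' with
  | mem_mul_mem f hf g hg =>
    obtain ⟨a, ha, ha', b, hb, hb', rfl⟩ := exists_decomp_maxIdeal hf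
    obtain ⟨c, hc, hc', d, hd, hd', rfl⟩ := exists_decomp_maxIdeal hg
    refine ⟨a * c + b * d, add_mem (SetLike.mul_mem_graded ha hc) (SetLike.mul_mem_graded hb hd),
      add_mem (Submodule.mul_mem_mul ha' hc') (Submodule.mul_mem_mul hb' hd'),
      a * d + b * c, add_mem ?_ ?_,
      add_mem (Submodule.mul_mem_mul ha' hd') (Submodule.mul_mem_mul hb' hc'), ?_⟩
    · simpa using SetLike.mul_mem_graded (A := (X.localRing x).grading) ha hd
    · simpa using SetLike.mul_mem_graded (A := (X.localRing x).grading) hb hc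
    · noncomm_ring
  | add f hf g hg ihf ihg =>
    obtain ⟨a, ha, ha', b, hb, hb', rfl⟩ := ihf
    obtain ⟨c, hc, hc', d, hd, hd', rfl⟩ := ihg
    exact ⟨_, add_mem ha hc, add_mem ha' hc', _, add_mem hb hd, add_mem hb' hd',
      add_add_add_comm _ _ _ _⟩

theorem cotangentMk_eq_zero_iff {f : X.maxIdeal x} :
    X.cotangentMk x f = 0 ↔ f.1 ∈ X.maxIdeal x * X.maxIdeal x :=
  Submodule.Quotient.mk_eq_zero _

theorem cotangentMk_surjective : Function.Surjective (X.cotangentMk x) := Submodule.mkQ_surjective _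

/-- For directness, let an even `f` and an odd `g` have the same class, and split `g - f = a + b`
inside `m²`. Then `f + a = g - b` is both even and odd, hence zero, and `f = -a` lies in `m²`. -/
theorem cotangentGrading_isInternal [NeZero (2 : k)] :
    DirectSum.IsInternal (X.cotangentGrading x) := by
  rw [isInternal_iff]
  refine ⟨fun w => ?_, ?_⟩
  · obtain ⟨f, rfl⟩ := cotangentMk_surjective w
    obtain ⟨a, ha, ha', b, hb, hb', e⟩ := exists_decomp_maxIdeal f.2
    exact ⟨_, ⟨⟨a, ha'⟩, ha, rfl⟩, _, ⟨⟨b, hb'⟩, hb, rfl⟩, by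
      rw [← map_add]; exact congrArg _ (Subtype.ext e)⟩
  · rintro _ ⟨f, hf, rfl⟩ ⟨g, hg, h⟩
    have h' : X.cotangentMk x (g - f) = 0 := by rw [map_sub, h, sub_self]
    obtain ⟨a, ha, ha', b, hb, hb', e⟩ := exists_decomp_maxIdeal_sq (cotangentMk_eq_zero_iff.1 h')
    refine cotangentMk_eq_zero_iff.2 ?_
    replace e : a + b = g.1 - f.1 := e
    have h0 : f.1 + a ∈ (X.localRing x).grading 0 := add_mem hf ha
    have h1 : f.1 + a ∈ (X.localRing x).grading 1 := by
      have : f.1 + a = g.1 - b := eq_sub_of_add_eq (by rw [add_assoc, e, add_sub_cancel])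
      rw [this]
      exact sub_mem hg hb
    have h2 := ((isInternal_iff _).1 (X.localRing x).isInternal).2 _ h0 h1
    rw [eq_neg_of_add_eq_zero_left h2]
    exact neg_mem ha'

/-! ### The differential -/

theorem differential_add (f g : X.localRing x) :
    differential hx (f + g) = differential hx f + differential hx g := by
  unfold differential
  rw [← map_add]
  refine congrArg _ (Subtype.ext ?_)
  change f + g - algebraMap k _ (valueAt hx (f + g)) = _
  rw [valueAt_add, map_add, add_sub_add_comm]
  rfl

theorem differential_smul (c : k) (f : X.localRing x) :
    differential hx (c • f) = c • differential hx f := by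
  unfold differential
  rw [← map_smul]
  refine congrArg _ (Subtype.ext ?_)
  change c • f - algebraMap k _ (valueAt hx (c • f)) = c • (f - algebraMap k _ (valueAt hx f))
  rw [valueAt_smul, map_mul, smul_sub, Algebra.smul_def c (algebraMap k _ _)]

/-- The differential `f ↦ (df)_x`, as a linear map. -/
def differentialₗ : X.localRing x →ₗ[k] X.Cotangent x where
  toFun := differential hx
  map_add' := differential_add hx
  map_smul' := differential_smul hx

theorem differential_of_mem {f : X.localRing x} (hf : f ∈ X.maxIdeal x) :
    differential hx f = X.cotangentMk x ⟨f, hf⟩ := by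
  unfold differential
  refine congrArg _ (Subtype.ext ?_)
  change f - algebraMap k _ (valueAt hx f) = f
  rw [(valueAt_eq_zero_iff hx).2 hf, map_zero, sub_zero]

theorem differential_algebraMap (c : k) :
    differential hx (algebraMap k (X.localRing x) c) = 0 := by
  refine cotangentMk_eq_zero_iff.2 ?_
  change algebraMap k _ c - algebraMap k _ (valueAt hx (algebraMap k _ c)) ∈ _
  rw [valueAt_algebraMap, sub_self]
  exact zero_mem _

/-- The two sides differ by the class of `(f - f(x)) (g - g(x))`, which lies in `m²`. No sign
occurs, as only scalars are moved past germs. -/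
theorem differential_mul (f g : X.localRing x) :
    differential hx (f * g) =
      valueAt hx f • differential hx g + valueAt hx g • differential hx f := by
  unfold differential
  rw [← map_smul, ← map_smul, ← map_add, ← sub_eq_zero, ← map_sub]
  refine cotangentMk_eq_zero_iff.2 ?_
  have e : f * g - algebraMap k _ (valueAt hx (f * g)) -
      (valueAt hx f • (g - algebraMap k _ (valueAt hx g)) +
        valueAt hx g • (f - algebraMap k _ (valueAt hx f))) =
      (f - algebraMap k (X.localRing x) (valueAt hx f)) *
        (g - algebraMap k (X.localRing x) (valueAt hx g)) := by
    rw [valueAt_mul, map_mul, Algebra.smul_def, Algebra.smul_def, Algebra.commutes (valueAt hx g),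
      Algebra.commutes (valueAt hx f)]
    simp only [sub_mul, mul_sub]
    rw [← map_mul, ← map_mul, mul_comm (valueAt hx g), Algebra.commutes (valueAt hx f) g]
    abel
  have h := Submodule.mul_mem_mul (sub_valueAt_mem hx f) (sub_valueAt_mem hx g)
  rw [← e] at h
  exact h

theorem exists_differential_eq (w : X.Cotangent x) :
    ∃ f ∈ X.maxIdeal x, differential hx f = w := by
  obtain ⟨f, rfl⟩ := cotangentMk_surjective w
  exact ⟨f.1, f.2, differential_of_mem hx f.2⟩

theorem valueAt_odd [NeZero (2 : k)] {f : X.localRing x} (hf : f ∈ (X.localRing x).grading 1) :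
    valueAt hx f = 0 := (valueAt_eq_zero_iff hx).2 (odd_mem_maxIdeal hf)

/-- Subtracting the value respects parity: constants are even, and the value of an odd germ is zero.
-/
theorem differential_mem [NeZero (2 : k)] {i : ZMod 2} {f : X.localRing x}
    (hf : f ∈ (X.localRing x).grading i) : differential hx f ∈ X.cotangentGrading x i := by
  refine ⟨⟨_, sub_valueAt_mem hx f⟩, ?_, rfl⟩
  rcases zmod_two i with rfl | rfl
  · exact sub_mem hf ((X.localRing x).evenSubalgebra.algebraMap_mem _)
  · change f - algebraMap k _ (valueAt hx f) ∈ (X.localRing x).grading 1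
    rw [valueAt_odd hx hf, map_zero, sub_zero]
    exact hf

end Superscheme

/-! ### Affine charts and the finite dimension of the cotangent space -/

namespace Superscheme

variable {k : Type u} [Field k] {X : Superscheme k}

section Chart
variable {A : SAlg k} (j : A.Spec.toPresheafedSpace ⟶ X.toPresheafedSpace)

/-- The value at `p` of the pullback of a section along an open immersion of an affine
superscheme. -/
def chartValue {W : Opens X} (s : X.presheaf.obj (op W)) (p : A.Spec) (hp : j.base p ∈ W) :
    A.Loc p :=
  SAlg.value (U := (Opens.map j.base).obj W) (j.c.app (op W) s) p hp

theorem chartValue_mul {W : Opens X} (s t : X.presheaf.obj (op W)) (p : A.Spec)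
    (hp : j.base p ∈ W) : chartValue j (s * t) p hp = chartValue j s p hp * chartValue j t p hp :=
  congrArg (fun r => SAlg.value (U := (Opens.map j.base).obj W) r p hp)
    (SAlg.hom_mul (j.c.app (op W)) s t)

theorem chartValue_one {W : Opens X} (p : A.Spec) (hp : j.base p ∈ W) :
    chartValue j (1 : X.presheaf.obj (op W)) p hp = 1 :=
  congrArg (fun r => SAlg.value (U := (Opens.map j.base).obj W) r p hp)
    (SAlg.hom_one (j.c.app (op W)))

theorem chartValue_res {W U : Opens X} (h : W ≤ U) (s : X.presheaf.obj (op U)) (p : A.Spec)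
    (hp : j.base p ∈ W) :
    chartValue j (X.presheaf.map (homOfLE h).op s) p hp = chartValue j s p (h hp) :=
  congrArg (fun r => SAlg.value (U := (Opens.map j.base).obj W) r p hp)
    (DFunLike.congr_fun (F := SAlg.Hom _ _) (j.c.naturality (homOfLE h).op) s)

variable [hj : PresheafedSpace.IsOpenImmersion j]

/-- The image of an open set under an open immersion. -/
abbrev imageOpen (V : Opens A.Spec) : Opens X := hj.base_open.functor.obj V

theorem mem_imageOpen {V : Opens A.Spec} {p : A.Spec} (hp : p ∈ V) : j.base p ∈ imageOpen j V :=
  ⟨p, hp, rfl⟩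

theorem preimage_imageOpen_le (V : Opens A.Spec) :
    (Opens.map j.base).obj (imageOpen j V) ≤ V := by
  rintro q ⟨q', hq', e⟩
  exact hj.base_open.injective e ▸ hq'

theorem chart_inv_apply (V : Opens A.Spec)
    (r : A.Spec.presheaf.obj (op ((Opens.map j.base).obj (imageOpen j V)))) :
    j.c.app (op (imageOpen j V)) (inv (j.c.app (op (imageOpen j V))) r) = r :=
  DFunLike.congr_fun (F := SAlg.Hom _ _) (IsIso.inv_hom_id (j.c.app (op (imageOpen j V)))) r

theorem chart_app_injective (V : Opens A.Spec) :
    Function.Injective (j.c.app (op (imageOpen j V))) := by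
  intro s t h
  have key : ∀ s,
      inv (j.c.app (op (imageOpen j V))) (j.c.app (op (imageOpen j V)) s) = s := fun s =>
    DFunLike.congr_fun (F := SAlg.Hom _ _) (IsIso.hom_inv_id (j.c.app (op (imageOpen j V)))) s
  rw [← key s, h, key t]

theorem exists_chartValue_eq (V : Opens A.Spec) (r : A.Spec.presheaf.obj (op V)) :
    ∃ s : X.presheaf.obj (op (imageOpen j V)), ∀ q (hq : q ∈ V),
      chartValue j s q (mem_imageOpen j hq) = SAlg.value r q hq := by
  refine ⟨inv (j.c.app (op (imageOpen j V)))
    (A.Spec.presheaf.map (homOfLE (preimage_imageOpen_le j V)).op r), fun q hq => ?_⟩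
  exact congrArg (fun r => SAlg.value (U := (Opens.map j.base).obj (imageOpen j V)) r q
    (mem_imageOpen j hq)) (chart_inv_apply j V _)

/-- Over the image of an open subset of the chart, pullback along the open immersion is an
isomorphism on sections. Sections of the structure sheaf of `Spec A` are functions with values in
the localizations, so equal values near `p` give equal germs. -/
theorem germ_eq_of_chartValue_eq {W W' : Opens X} (s : X.presheaf.obj (op W))
    (t : X.presheaf.obj (op W')) (p : A.Spec) (hp : j.base p ∈ W) (hp' : j.base p ∈ W')
    (V : Opens A.Spec) (hV : p ∈ V)
    (h : ∀ q (_ : q ∈ V) (hW : j.base q ∈ W) (hW' : j.base q ∈ W'),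
      chartValue j s q hW = chartValue j t q hW') :
    germ X.presheaf (j.base p) W hp s = germ X.presheaf (j.base p) W' hp' t := by
  let V' : Opens A.Spec := V ⊓ (Opens.map j.base).obj W ⊓ (Opens.map j.base).obj W'
  have h1 : imageOpen j V' ≤ W := by
    rintro _ ⟨q, hq, rfl⟩
    exact hq.1.2
  have h2 : imageOpen j V' ≤ W' := by
    rintro _ ⟨q, hq, rfl⟩
    exact hq.2
  refine (germ_eq_iff X.presheaf _ hp hp' s t).2
    ⟨imageOpen j V', mem_imageOpen j ⟨⟨hV, hp⟩, hp'⟩, h1, h2, chart_app_injective j V' ?_⟩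
  refine SAlg.section_ext (U := (Opens.map j.base).obj (imageOpen j V')) fun q hq => ?_
  have hq' := preimage_imageOpen_le j V' hq
  exact (chartValue_res j h1 s q hq).trans
    ((h q hq'.1.1 hq'.1.2 hq'.2).trans (chartValue_res j h2 t q hq).symm)

/-- The sections over the image of an affine chart defined by the elements of its algebra. -/
def chartSection : A ⟶ X.presheaf.obj (op (imageOpen j ⊤)) :=
  A.toSection _ ≫ inv (j.c.app (op (imageOpen j ⊤)))

theorem chartValue_chartSection (a : A) (p : A.Spec) (hp : j.base p ∈ imageOpen j ⊤) :
    chartValue j (chartSection j a) p hp = LocalizedModule.mk a 1 :=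
  congrArg (fun r => SAlg.value (U := (Opens.map j.base).obj (imageOpen j ⊤)) r p hp)
    (chart_inv_apply j ⊤ (A.toSection _ a))

/-- The germ at a point of an affine chart of an element of its algebra. -/
def chartGerm (p : A.Spec) : A →ₐ[k] X.localRing (j.base p) :=
  (germ X.presheaf (j.base p) (imageOpen j ⊤) (mem_imageOpen j trivial)).comp
    (chartSection j).toAlgHom

theorem germ_mul_eq {W W' : Opens X} (s : X.presheaf.obj (op W)) (t : X.presheaf.obj (op W'))
    (y : X) (hp : y ∈ W) (hp' : y ∈ W') :
    germ X.presheaf y W hp s * germ X.presheaf y W' hp' t =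
      germ X.presheaf y (W ⊓ W') (show y ∈ W ⊓ W' from ⟨hp, hp'⟩)
        (X.presheaf.map (homOfLE (inf_le_left : W ⊓ W' ≤ W)).op s *
          X.presheaf.map (homOfLE (inf_le_right : W ⊓ W' ≤ W')).op t) := by
  rw [map_mul, germ_res, germ_res]

/-- Near `p` the pullback of `f` is a fraction `a / t`; clearing the denominator gives the equation.
Together with the invertibility of the germ of `t`, this replaces an identification of the stalk
with `A_𝔭`. -/
theorem exists_mul_chartGerm_eq (p : A.Spec) (f : X.localRing (j.base p)) :
    ∃ (a : A) (t : A.Even), t ∉ PrimeSpectrum.asIdeal p ∧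
      f * chartGerm j p t.1 = chartGerm j p a := by
  obtain ⟨U, hU, s, rfl⟩ := exists_germ_eq X.presheaf _ f
  obtain ⟨V, hV, i, a, t, h⟩ := (show A.specSections ((Opens.map j.base).obj U) from
    j.c.app (op U) s).2 ⟨p, hU⟩
  refine ⟨a, t, (h ⟨p, hV⟩).1, ?_⟩
  refine (germ_mul_eq s (chartSection j t.1) (j.base p) hU (mem_imageOpen j trivial)).trans ?_
  refine germ_eq_of_chartValue_eq j _ _ p _ _ V hV fun q hq hW hW' => ?_
  obtain ⟨ht, e⟩ := h ⟨q, hq⟩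
  rw [chartValue_mul, chartValue_res, chartValue_res, chartValue_chartSection]
  refine Eq.trans ?_ (chartValue_chartSection j a q hW').symm
  refine (congrArg (· * (LocalizedModule.mk t.1 1 : A.Loc q)) e).trans ?_
  refine (LocalizedModule.mk_mul_mk ..).trans ?_
  refine LocalizedModule.mk_eq.2 ⟨1, ?_⟩
  congr 1
  change 1 * (a * t.1) = (t * 1).1 * a
  rw [mul_one, one_mul, SAlg.even_comm t.2]

/-- The inverse is the germ of the section `1 / t` over the basic open set of `t`. -/
theorem exists_mul_chartGerm_eq_one (p : A.Spec) {t : A.Even} (ht : t ∉ PrimeSpectrum.asIdeal p) :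
    ∃ f : X.localRing (j.base p), f * chartGerm j p t.1 = 1 := by
  let V : Opens A.Spec := PrimeSpectrum.basicOpen t
  let r : A.Spec.presheaf.obj (op V) := (⟨fun q => LocalizedModule.mk 1 ⟨t, q.2⟩,
    fun q => ⟨V, q.2, 𝟙 _, 1, t, fun w => ⟨w.2, rfl⟩⟩⟩ : A.specSections V)
  obtain ⟨s, hs⟩ := exists_chartValue_eq j V r
  refine ⟨germ X.presheaf (j.base p) _ (mem_imageOpen j ht) s, ?_⟩
  refine (germ_mul_eq s (chartSection j t.1) (j.base p) (mem_imageOpen j ht)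
    (mem_imageOpen j trivial)).trans
    (Eq.trans ?_ (map_one (germ X.presheaf (j.base p) ⊤ trivial)))
  refine germ_eq_of_chartValue_eq j _ _ p _ _ V ht fun q hq hW hW' => ?_
  rw [chartValue_mul, chartValue_res, chartValue_res, chartValue_chartSection, chartValue_one,
    hs q hq]
  refine (LocalizedModule.mk_mul_mk ..).trans (Eq.trans ?_ SAlg.loc_one_def.symm)
  refine LocalizedModule.mk_eq.2 ⟨1, ?_⟩
  congr 1
  change 1 * (1 * t.1) = (t * 1).1 * 1
  rw [mul_one, one_mul, one_mul, mul_one]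

/-- By the Leibniz rule, the differentials of a finite set of generators of `A` span those of all
elements of `A`. For a general germ `f` with `f t = a`, the rule gives `t(x) df = da - f(x) dt`, and
`t(x) ≠ 0` because the germ of `t` is invertible. -/
theorem finite_cotangent_of_chart [Algebra.FiniteType k A] (p : A.Spec)
    (hx : X.IsRational (j.base p)) : Module.Finite k (X.Cotangent (j.base p)) := by
  obtain ⟨S, hS⟩ := Algebra.FiniteType.out (R := k) (A := A)
  let δ : A →ₗ[k] X.Cotangent (j.base p) := differentialₗ hx ∘ₗ (chartGerm j p).toLinearMap
  have hδ : ∀ a, δ a = differential hx (chartGerm j p a) := fun _ => rfl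
  let P : Submodule k (X.Cotangent (j.base p)) := Submodule.span k (δ '' S)
  have h1 : ∀ a, δ a ∈ P := by
    intro a
    have ha : a ∈ Algebra.adjoin k (S : Set A) := hS ▸ Algebra.mem_top
    induction ha using Algebra.adjoin_induction with
    | mem a ha => exact Submodule.subset_span ⟨a, ha, rfl⟩
    | algebraMap c =>
      rw [hδ, AlgHom.commutes, differential_algebraMap]
      exact zero_mem _
    | add a b _ _ ha hb => rw [map_add]; exact add_mem ha hb
    | mul a b _ _ ha hb =>
      rw [hδ, map_mul, differential_mul]
      exact add_mem (P.smul_mem _ hb) (P.smul_mem _ ha)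
  refine ⟨⟨(S.finite_toSet.image δ).toFinset, ?_⟩⟩
  rw [Set.Finite.coe_toFinset, Submodule.eq_top_iff']
  intro w
  obtain ⟨f, -, rfl⟩ := exists_differential_eq hx w
  obtain ⟨a, t, ht, e⟩ := exists_mul_chartGerm_eq j p f
  obtain ⟨g, hg⟩ := exists_mul_chartGerm_eq_one j p ht
  have hv : valueAt hx (chartGerm j p t.1) ≠ 0 := by
    intro h0
    have := valueAt_one hx
    rw [← hg, valueAt_mul, h0, mul_zero] at this
    exact zero_ne_one this
  have e' : valueAt hx (chartGerm j p t.1) • differential hx f =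
      δ a - valueAt hx f • δ t.1 := by
    rw [hδ, hδ, ← e, differential_mul, add_sub_cancel_left]
  rw [← inv_smul_smul₀ hv (differential hx f), e']
  exact P.smul_mem _ (sub_mem (h1 _) (P.smul_mem _ (h1 _)))

end Chart

theorem IsAlgebraic.finite_cotangent (h : X.IsAlgebraic) {x : X} (hx : X.IsRational x) :
    Module.Finite k (X.Cotangent x) := by
  obtain ⟨n, A, j, hA, hj, hcov⟩ := h
  obtain ⟨i, p, rfl⟩ := hcov x
  have := hA i
  have := hj i
  exact finite_cotangent_of_chart (j i) p hx

end Superscheme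

theorem add_eq_one_of_ne {i j : ZMod 2} (h : i ≠ j) : i + j = 1 := by revert i j; decide

/-- Linear functionals extend from a subspace. An additive monoid suffices for `M`, since the scalar
`-1` provides negatives. -/
theorem exists_comp_eq_of_injective {k M N : Type*} [Field k] [AddCommMonoid M] [Module k M]
    [AddCommGroup N] [Module k N] {r : M →ₗ[k] N} (hr : Function.Injective r) (l : M →ₗ[k] k) :
    ∃ L : N →ₗ[k] k, L ∘ₗ r = l := by
  let : AddCommGroup M := Module.addCommMonoidToAddCommGroup k
  exact LinearMap.dualMap_surjective_of_injective hr l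

/-- The projection of a super vector space onto its part of parity `i`. -/
theorem exists_projection {k V : Type*} [Field k] [AddCommGroup V] [Module k V]
    {𝒱 : ZMod 2 → Submodule k V} (h : DirectSum.IsInternal 𝒱) (i : ZMod 2) :
    ∃ π : V →ₗ[k] 𝒱 i, (∀ w : 𝒱 i, π w = w) ∧ ∀ j ≠ i, ∀ w ∈ 𝒱 j, π w = 0 := by
  have := h.chooseDecomposition
  refine ⟨DirectSum.component k _ _ i ∘ₗ (DirectSum.decomposeLinearEquiv 𝒱).toLinearMap,
    fun w => ?_, fun j hj w hw => ?_⟩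
  · exact Subtype.ext (DirectSum.decompose_of_mem_same 𝒱 w.2)
  · exact Subtype.ext (DirectSum.decompose_of_mem_ne 𝒱 hw hj)

/-! ### Tangent vectors and their duality with the cotangent space -/

namespace Superscheme

variable {k : Type u} [Field k] {X : Superscheme k} {x : X} (hx : X.IsRational x)

theorem superDer_one {i : ZMod 2} {D : X.localRing x →ₗ[k] SAlg.base k} (hD : D ∈ superDer hx i) :
    D 1 = 0 := by
  have h := hD.2 0 1 SetLike.GradedOne.one_mem 1
  rw [mul_one, ZMod.val_zero, mul_zero, pow_zero, one_mul, valueAt_one, one_smul] at h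
  exact left_eq_add.1 h

/-- The Leibniz rule is available for a homogeneous first factor only, so `f` is split into its
components. Both lie in `m`, and all values in the rule vanish, whatever the sign. -/
theorem superDer_mul [NeZero (2 : k)] {i : ZMod 2} {D : X.localRing x →ₗ[k] SAlg.base k}
    (hD : D ∈ superDer hx i) {f g : X.localRing x} (hf : f ∈ X.maxIdeal x)
    (hg : g ∈ X.maxIdeal x) : D (f * g) = 0 := by
  obtain ⟨a, ha, ha', b, hb, hb', rfl⟩ := exists_decomp_maxIdeal hf
  have h0 := hD.2 0 a ha g
  have h1 := hD.2 1 b hb g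
  rw [(valueAt_eq_zero_iff hx).2 hg, (valueAt_eq_zero_iff hx).2 ha', mul_zero, zero_smul, zero_smul,
    add_zero] at h0
  rw [(valueAt_eq_zero_iff hx).2 hg, (valueAt_eq_zero_iff hx).2 hb', mul_zero, zero_smul, zero_smul,
    add_zero] at h1
  rw [add_mul, map_add, h0, h1, add_zero]

theorem tangentEval_one (D : tangentSpace hx) : tangentEval hx 1 D = 0 := by
  obtain ⟨D, hD⟩ := D
  obtain ⟨D0, h0, D1, h1, rfl⟩ := Submodule.mem_sup.1 hD
  refine (LinearMap.add_apply D0 D1 _).trans ?_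
  rw [superDer_one hx h0, superDer_one hx h1]
  exact add_zero (0 : k)

theorem tangentEval_mul [NeZero (2 : k)] {f g : X.localRing x} (hf : f ∈ X.maxIdeal x)
    (hg : g ∈ X.maxIdeal x) (D : tangentSpace hx) : tangentEval hx (f * g) D = 0 := by
  obtain ⟨D, hD⟩ := D
  obtain ⟨D0, h0, D1, h1, rfl⟩ := Submodule.mem_sup.1 hD
  refine (LinearMap.add_apply D0 D1 _).trans ?_
  rw [superDer_mul hx h0 hf hg, superDer_mul hx h1 hf hg]
  exact add_zero (0 : k)

/-- Evaluation of tangent vectors at germs, as a bilinear map. -/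
def tangentEvalₗ : X.localRing x →ₗ[k] tangentSpace hx →ₗ[k] k where
  toFun := tangentEval hx
  map_add' f g := LinearMap.ext fun D => map_add D.1 f g
  map_smul' c f := LinearMap.ext fun D => map_smul D.1 c f

theorem tensorEval_tensorMap {A B : SAlg k} (φ : A ⟶ B) (f : X.localRing x)
    (t : A ⊗[k] tangentSpace hx) :
    tensorEval hx B f (tensorMap hx φ t) = φ (tensorEval hx A f t) := by
  induction t with
  | zero => rw [map_zero, map_zero, map_zero, SAlg.hom_zero]
  | add s t hs ht => rw [map_add, map_add, map_add, SAlg.hom_add, hs, ht]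
  | tmul a D =>
    have h : ∀ (C : SAlg k) (c : C), tensorEval hx C f (c ⊗ₜ D) = tangentEval hx f D • c :=
      fun C c => TensorProduct.rid_tmul c (tangentEval hx f D)
    rw [h, SAlg.hom_smul]
    exact h B (φ a)

variable [NeZero (2 : k)]

theorem tangentEval_sq {f : X.localRing x} (hf : f ∈ X.maxIdeal x * X.maxIdeal x) :
    tangentEvalₗ hx f = 0 := by
  induction hf using Submodule.mul_induction_on' with
  | mem_mul_mem f hf g hg => exact LinearMap.ext (tangentEval_mul hx hf hg)
  | add f hf g hg ihf ihg => rw [map_add, ihf, ihg, add_zero]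

/-- The pairing between the cotangent and the tangent space at a rational point. -/
def pairing : X.Cotangent x →ₗ[k] tangentSpace hx →ₗ[k] k :=
  Submodule.liftQ _ (tangentEvalₗ hx ∘ₗ (X.maxIdeal x).subtype) fun _ hf => tangentEval_sq hx hf

theorem pairing_differential (f : X.localRing x) :
    pairing hx (differential hx f) = tangentEval hx f := by
  refine LinearMap.ext fun D => ?_
  refine (map_sub D.1 f (algebraMap k _ (valueAt hx f))).trans ?_
  have h1 : D.1 1 = 0 := tangentEval_one hx D
  rw [Algebra.algebraMap_eq_smul_one, map_smul, h1, smul_zero]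
  exact sub_zero _

/-- A tangent vector of parity `j` takes a germ of parity `i` to the part of `k` of parity `i + j =
1`, which is zero. -/
theorem pairing_eq_zero {i j : ZMod 2} (hij : i ≠ j) {w : X.Cotangent x}
    (hw : w ∈ X.cotangentGrading x i) {D : tangentSpace hx} (hD : D ∈ tangentGrading hx j) :
    pairing hx w D = 0 := by
  obtain ⟨f, hf, rfl⟩ := hw
  have h := (show D.1 ∈ superDer hx j from hD).1 i f.1 hf
  have e : j + i = 1 := add_eq_one_of_ne hij.symm
  rw [e] at h
  exact SAlg.base_eq_zero h

/-- The linear functional on the cotangent space defined by a tangent vector. -/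
def toDual : tangentSpace hx →ₗ[k] X.Cotangent x →ₗ[k] k := (pairing hx).flip

theorem toDual_apply (D : tangentSpace hx) (w : X.Cotangent x) :
    toDual hx D w = pairing hx w D := rfl

theorem toDual_injective : Function.Injective (toDual hx) := by
  intro D E h
  refine Subtype.ext (LinearMap.ext fun f => ?_)
  have := LinearMap.congr_fun h (differential hx f)
  rwa [toDual_apply, toDual_apply, pairing_differential] at this

/-- The tangent vector is `f ↦ δ(df)`. Its ordinary Leibniz rule is also the super one: the sign can
be nontrivial only for odd `f`, and then it multiplies `f(x) = 0`. The vanishing of `δ` on the other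
part makes the derivation homogeneous of parity `i`. -/
theorem exists_tangent {i : ZMod 2} (δ : X.Cotangent x →ₗ[k] k)
    (hδ : ∀ j ≠ i, ∀ w ∈ X.cotangentGrading x j, δ w = 0) :
    ∃ D ∈ tangentGrading hx i, toDual hx D = δ := by
  let E : X.localRing x →ₗ[k] SAlg.base k := δ ∘ₗ differentialₗ hx
  have hE : E ∈ superDer hx i := by
    refine ⟨fun j f hf => ?_, fun j f hf g => ?_⟩
    · by_cases hj : j = i
      · have : i + j = 0 := hj ▸ CharTwo.add_self_eq_zero j
        rw [this]
        exact SAlg.base_mem_zero _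
      · have : E f = 0 := hδ j hj _ (differential_mem hx hf)
        rw [this]
        exact zero_mem _
    · have h1 : E (f * g) = valueAt hx f • E g + valueAt hx g • E f := by
        refine (congrArg δ (differential_mul hx f g)).trans ?_
        rw [map_add, map_smul, map_smul]
        rfl
      rw [h1, add_comm]
      rcases zmod_two j with rfl | rfl
      · rw [ZMod.val_zero, mul_zero, pow_zero, one_mul]
      · rw [valueAt_odd hx hf, mul_zero]
  have hi : superDer hx i ≤ tangentSpace hx := by
    rcases zmod_two i with rfl | rfl
    · exact le_sup_left
    · exact le_sup_right
  refine ⟨⟨E, hi hE⟩, hE, LinearMap.ext fun w => ?_⟩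
  obtain ⟨f, hf, rfl⟩ := exists_differential_eq hx w
  rw [toDual_apply, pairing_differential]
  rfl

/-- The map `(m/m²)_i ⟶ (T_i)^*`. -/
def cotangentToDual (i : ZMod 2) :
    X.cotangentGrading x i →ₗ[k] Module.Dual k (tangentGrading hx i) :=
  (LinearMap.lcomp k k (tangentGrading hx i).subtype) ∘ₗ pairing hx ∘ₗ
    (X.cotangentGrading x i).subtype

/-- Injectivity: a functional on `(m/m²)_i`, extended by zero, comes from a tangent vector of parity
`i`, and functionals separate points. Surjectivity: `T_i` embeds in the dual of `(m/m²)_i`, so a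
functional on `T_i` extends to that dual, and by finite dimension the extension is evaluation at a
vector of `(m/m²)_i`. -/
theorem cotangentToDual_bijective [Module.Finite k (X.Cotangent x)] (i : ZMod 2) :
    Function.Bijective (cotangentToDual hx i) := by
  obtain ⟨π, h1, h2⟩ := exists_projection (cotangentGrading_isInternal (X := X) (x := x)) i
  constructor
  · rw [injective_iff_map_eq_zero]
    intro w hw
    rw [← Module.forall_dual_apply_eq_zero_iff k]
    intro δ
    obtain ⟨D, hD, e⟩ := exists_tangent hx (i := i) (δ ∘ₗ π)
      fun j hj w hw => by rw [LinearMap.comp_apply, h2 j hj w hw, map_zero]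
    have h3 : toDual hx D w = 0 := LinearMap.congr_fun hw ⟨D, hD⟩
    rwa [e, LinearMap.comp_apply, h1] at h3
  · let r : tangentGrading hx i →ₗ[k] Module.Dual k (X.cotangentGrading x i) :=
      (cotangentToDual hx i).flip
    have hr : Function.Injective r := by
      intro D E h
      refine Subtype.ext (toDual_injective hx (LinearMap.ext fun w => ?_))
      obtain ⟨w0, hw0, w1, hw1, rfl⟩ := ((isInternal_iff _).1
        (cotangentGrading_isInternal (X := X) (x := x))).1 w
      have key : ∀ j, ∀ w ∈ X.cotangentGrading x j, toDual hx D.1 w = toDual hx E.1 w := by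
        intro j w hw
        by_cases hj : j = i
        · subst hj
          exact LinearMap.congr_fun h ⟨w, hw⟩
        · exact (pairing_eq_zero hx hj hw D.2).trans (pairing_eq_zero hx hj hw E.2).symm
      rw [map_add, map_add, key 0 _ hw0, key 1 _ hw1]
    intro l
    obtain ⟨L, rfl⟩ := exists_comp_eq_of_injective hr l
    obtain ⟨w, rfl⟩ := (Module.evalEquiv k (X.cotangentGrading x i)).surjective L
    exact ⟨w, rfl⟩

/-! ### `(A ⊗ T)₀ ≅ Hom(m/m², A)` -/

/-- The map `A ⊗ T ⟶ Hom(m/m², A)`, `a ⊗ D ↦ ([f] ↦ D(f) a)`. -/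
def tensorToHom (A : SAlg k) : A ⊗[k] tangentSpace hx →ₗ[k] X.Cotangent x →ₗ[k] A :=
  dualTensorHom k (X.Cotangent x) A ∘ₗ (TensorProduct.comm k A _).toLinearMap ∘ₗ
    LinearMap.lTensor A (toDual hx)

theorem tensorToHom_tmul (A : SAlg k) (a : A) (D : tangentSpace hx) (w : X.Cotangent x) :
    tensorToHom hx A (a ⊗ₜ D) w = pairing hx w D • a := rfl

theorem tensorToHom_mk (A : SAlg k) (t : A ⊗[k] tangentSpace hx) (f : X.maxIdeal x) :
    tensorToHom hx A t (X.cotangentMk x f) = tensorEval hx A f.1 t := by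
  induction t with
  | zero => rw [map_zero, map_zero]; rfl
  | add s t hs ht => rw [map_add, map_add, ← hs, ← ht]; rfl
  | tmul a D => exact ((TensorProduct.rid_tmul a (tangentEval hx f.1 D))).symm

/-- The embedding of `T` in `(m/m²)^*` stays injective after tensoring over a field, and `(m/m²)^* ⊗
A` is all of `Hom(m/m², A)` by finite dimension. -/
theorem tensorToHom_injective [Module.Finite k (X.Cotangent x)] (A : SAlg k) :
    Function.Injective (tensorToHom hx A) := by
  have h1 : Function.Injective (dualTensorHom k (X.Cotangent x) A) :=
    (dualTensorHomEquiv k (X.Cotangent x) A).injective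
  exact h1.comp ((TensorProduct.comm k A _).injective.comp
    (Module.Flat.lTensor_preserves_injective_linearMap _ (toDual_injective hx)))

theorem tensorToHom_mem (A : SAlg k) {t : A ⊗[k] tangentSpace hx} (ht : t ∈ tangentTensor hx A) :
    tensorToHom hx A t ∈ X.cotangentHom x A := by
  suffices tangentTensor hx A ≤ (X.cotangentHom x A).comap (tensorToHom hx A) from this ht
  refine iSup_le fun i => ?_
  rintro _ ⟨s, rfl⟩
  refine Submodule.mem_comap.2 ?_
  induction s with
  | zero => rw [map_zero, map_zero]; exact zero_mem _
  | add s t hs ht => rw [map_add, map_add]; exact add_mem hs ht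
  | tmul a D =>
    intro j w hw
    rw [TensorProduct.map_tmul, tensorToHom_tmul]
    by_cases hj : j = i
    · subst hj
      exact Submodule.smul_mem _ _ a.2
    · have : pairing hx w ((tangentGrading hx i).subtype D) = 0 := pairing_eq_zero hx hj hw D.2
      rw [this, zero_smul]
      exact zero_mem _

/-- For each parity `i`, take a basis `b n` of `(m/m²)_i` and the tangent vectors `D n` given by the
coordinate functionals, extended by zero. Then `∑ d(b n) ⊗ D n` induces `d` on the part of parity
`i` and zero on the other; it lies in `(A ⊗ T)₀` because `d` preserves parity. -/
theorem exists_tensorToHom_eq [Module.Finite k (X.Cotangent x)] {A : SAlg k}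
    {d : X.Cotangent x →ₗ[k] A} (hd : d ∈ X.cotangentHom x A) :
    ∃ t ∈ tangentTensor hx A, tensorToHom hx A t = d := by
  have part : ∀ i : ZMod 2, ∃ t ∈ tangentTensor hx A, ∀ j, ∀ w ∈ X.cotangentGrading x j,
      tensorToHom hx A t w = if j = i then d w else 0 := by
    intro i
    obtain ⟨π, h1, h2⟩ := exists_projection (cotangentGrading_isInternal (X := X) (x := x)) i
    let b := Module.finBasis k (X.cotangentGrading x i)
    have hD := fun n => exists_tangent hx (i := i) (b.coord n ∘ₗ π)
      fun j hj w hw => by rw [LinearMap.comp_apply, h2 j hj w hw, map_zero]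
    choose D hD hD' using hD
    refine ⟨∑ n, d (b n) ⊗ₜ D n, sum_mem fun n _ => ?_, fun j w hw => ?_⟩
    · exact Submodule.mem_iSup_of_mem i
        ⟨⟨d (b n), hd i _ (b n).2⟩ ⊗ₜ ⟨D n, hD n⟩, TensorProduct.map_tmul _ _ _ _⟩
    · rw [map_sum, LinearMap.sum_apply]
      have e : ∀ n, tensorToHom hx A (d (b n) ⊗ₜ D n) w = b.coord n (π w) • d (b n) := by
        intro n
        rw [tensorToHom_tmul, ← toDual_apply, hD']
        rfl
      rw [Finset.sum_congr rfl fun n _ => e n]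
      by_cases hj : j = i
      · subst hj
        rw [if_pos rfl, show π w = ⟨w, hw⟩ from h1 ⟨w, hw⟩]
        have := congrArg (fun v => d v.1) (b.sum_repr ⟨w, hw⟩)
        refine Eq.trans ?_ this
        rw [AddSubmonoidClass.coe_finsetSum, map_sum]
        exact Finset.sum_congr rfl fun n _ => (map_smul d _ _).symm
      · rw [if_neg hj, h2 j hj w hw]
        simp
  obtain ⟨t0, ht0, e0⟩ := part 0
  obtain ⟨t1, ht1, e1⟩ := part 1
  refine ⟨t0 + t1, add_mem ht0 ht1, LinearMap.ext fun w => ?_⟩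
  obtain ⟨w0, hw0, w1, hw1, rfl⟩ := ((isInternal_iff _).1
    (cotangentGrading_isInternal (X := X) (x := x))).1 w
  rw [map_add (tensorToHom hx A), LinearMap.add_apply, map_add, map_add, e0 0 _ hw0, e0 1 _ hw1,
    e1 0 _ hw0, e1 1 _ hw1, if_pos rfl, if_pos rfl, if_neg one_ne_zero, if_neg zero_ne_one, add_zero, zero_add,
    map_add]

/-- The isomorphism `(A ⊗ T)₀ ≅ Hom(m/m², A)`. -/
def tangentTensorEquiv [Module.Finite k (X.Cotangent x)] (A : SAlg k) :
    tangentTensor hx A ≃ₗ[k] X.cotangentHom x A :=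
  LinearEquiv.ofBijective
    ((tensorToHom hx A).restrict fun _ ht => tensorToHom_mem hx A ht)
    ⟨fun s t h => Subtype.ext (tensorToHom_injective hx A (congrArg Subtype.val h)),
      fun d => by
        obtain ⟨t, ht, e⟩ := exists_tensorToHom_eq hx d.2
        exact ⟨⟨t, ht⟩, Subtype.ext e⟩⟩

theorem tangentTensorEquiv_mk [Module.Finite k (X.Cotangent x)] (A : SAlg k)
    (t : tangentTensor hx A) (f : X.maxIdeal x) :
    (tangentTensorEquiv hx A t).1 (X.cotangentMk x f) = tensorEval hx A f.1 t.1 :=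
  tensorToHom_mk hx A t.1 f

/-- `tensorMap` acts on the whole of `A ⊗ T`, so the image of `t` enters as an element `t'` of the
even part with the prescribed underlying tensor. -/
theorem tangentTensorEquiv_naturality [Module.Finite k (X.Cotangent x)] {A B : SAlg k} (φ : A ⟶ B)
    (t : tangentTensor hx A) (t' : tangentTensor hx B) (h : t'.1 = tensorMap hx φ t.1)
    (w : X.Cotangent x) :
    (tangentTensorEquiv hx B t').1 w = φ ((tangentTensorEquiv hx A t).1 w) := by
  obtain ⟨f, rfl⟩ := cotangentMk_surjective w
  rw [tangentTensorEquiv_mk, tangentTensorEquiv_mk, h, tensorEval_tensorMap]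

end Superscheme

/-! ### The universal property of the symmetric superalgebra -/

section SymLift
variable {k : Type u} [Field k] {V W : Type u} [AddCommGroup V] [Module k V]
  [AddCommGroup W] [Module k W] {A : SAlg k}

/-- The algebra homomorphism `Sym(V) ⟶ A` defined by a linear map from `V` to the even part. -/
def symmetricLift (α : V →ₗ[k] A) (hα : ∀ v, α v ∈ A.grading 0) : SymmetricAlgebra k V →ₐ[k] A :=
  A.evenSubalgebra.val.comp
    (show SymmetricAlgebra k V →ₐ[k] A.evenSubalgebra from
      SymmetricAlgebra.lift (A := A.Even)
        (show V →ₗ[k] A.Even from α.codRestrict (Subalgebra.toSubmodule A.evenSubalgebra) hα))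

theorem symmetricLift_ι (α : V →ₗ[k] A) (hα : ∀ v, α v ∈ A.grading 0) (v : V) :
    symmetricLift α hα (SymmetricAlgebra.ι k V v) = α v :=
  congrArg Subtype.val (SymmetricAlgebra.lift_ι_apply (A := A.Even) _ v)

theorem symmetricLift_mem (α : V →ₗ[k] A) (hα : ∀ v, α v ∈ A.grading 0)
    (s : SymmetricAlgebra k V) : symmetricLift α hα s ∈ A.grading 0 :=
  Subtype.prop (p := (· ∈ A.evenSubalgebra)) _

variable (k V W) in
/-- The generators of `Sym(V) ⊗ Λ(W)` of even parity. -/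
def symEven : V →ₗ[k] symSuper k V W :=
  (TensorProduct.mk k (SymmetricAlgebra k V) (ExteriorAlgebra k W)).flip 1 ∘ₗ SymmetricAlgebra.ι k V

variable (k V W) in
/-- The generators of `Sym(V) ⊗ Λ(W)` of odd parity. -/
def symOdd : W →ₗ[k] symSuper k V W :=
  TensorProduct.mk k (SymmetricAlgebra k V) (ExteriorAlgebra k W) 1 ∘ₗ ExteriorAlgebra.ι k

theorem symEven_mem (v : V) : symEven k V W v ∈ (symSuper k V W).grading 0 :=
  ⟨SymmetricAlgebra.ι k V v ⊗ₜ ⟨1, SetLike.GradedOne.one_mem⟩, rfl⟩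

theorem symOdd_mem (w : W) : symOdd k V W w ∈ (symSuper k V W).grading 1 :=
  ⟨1 ⊗ₜ ⟨ExteriorAlgebra.ι k w, CliffordAlgebra.ι_mem_evenOdd_one _ w⟩, rfl⟩

theorem symSuper_hom_ext {f g : symSuper k V W ⟶ A}
    (h0 : ∀ v, f (symEven k V W v) = g (symEven k V W v))
    (h1 : ∀ w, f (symOdd k V W w) = g (symOdd k V W w)) : f = g := by
  let f' : SymmetricAlgebra k V ⊗[k] ExteriorAlgebra k W →ₐ[k] A := f.toAlgHom
  let g' : SymmetricAlgebra k V ⊗[k] ExteriorAlgebra k W →ₐ[k] A := g.toAlgHom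
  have e0 : f'.comp (Algebra.TensorProduct.includeLeft : SymmetricAlgebra k V →ₐ[k] _) =
      g'.comp Algebra.TensorProduct.includeLeft := by
    refine AlgHom.ext fun s => ?_
    induction s using SymmetricAlgebra.induction with
    | algebraMap r => rw [AlgHom.commutes, AlgHom.commutes]
    | ι v => exact h0 v
    | mul a b ha hb => rw [map_mul, map_mul, ha, hb]
    | add a b ha hb => rw [map_add, map_add, ha, hb]
  have e1 : f'.comp (Algebra.TensorProduct.includeRight : ExteriorAlgebra k W →ₐ[k] _) =
      g'.comp Algebra.TensorProduct.includeRight := ExteriorAlgebra.hom_ext (LinearMap.ext h1)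
  have h : f' = g' := Algebra.TensorProduct.ext e0 e1
  exact SAlg.hom_ext fun z => DFunLike.congr_fun h z

variable [NeZero (2 : k)]

/-- The algebra homomorphism `Λ(W) ⟶ A` defined by a linear map from `W` to the odd part. -/
def exteriorLift (β : W →ₗ[k] A) (hβ : ∀ w, β w ∈ A.grading 1) : ExteriorAlgebra k W →ₐ[k] A :=
  -- The relation of the exterior algebra holds in `A` since odd elements square to zero, `2` being
  -- invertible.
  ExteriorAlgebra.lift k ⟨β, fun w => SAlg.odd_sq (hβ w)⟩

theorem exteriorLift_ι (β : W →ₗ[k] A) (hβ : ∀ w, β w ∈ A.grading 1) (w : W) :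
    exteriorLift β hβ (ExteriorAlgebra.ι k w) = β w :=
  ExteriorAlgebra.lift_ι_apply k β _ w

/-- Both parts of the exterior algebra are generated from scalars or single vectors by multiplying
with two vectors at a time, and two odd factors do not change the parity in `A`. -/
theorem exteriorLift_mem (β : W →ₗ[k] A) (hβ : ∀ w, β w ∈ A.grading 1) (i : ZMod 2)
    {e : ExteriorAlgebra k W} (he : e ∈ extGrading k W i) : exteriorLift β hβ e ∈ A.grading i := by
  have hmul : ∀ (m₁ m₂ : W) {y : A}, y ∈ A.grading i → β m₁ * β m₂ * y ∈ A.grading i := by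
    intro m₁ m₂ y hy
    have h := SetLike.mul_mem_graded (SetLike.mul_mem_graded (hβ m₁) (hβ m₂)) hy
    have e : (1 : ZMod 2) + 1 + i = i := by
      rw [CharTwo.add_self_eq_zero, zero_add]
    rwa [e] at h
  rcases zmod_two i with rfl | rfl
  · induction e, he using CliffordAlgebra.even_induction with
    | algebraMap r =>
      exact (AlgHom.commutes (exteriorLift β hβ) r).symm ▸ A.evenSubalgebra.algebraMap_mem r
    | add x y hx hy ihx ihy => rw [map_add]; exact add_mem ihx ihy
    | ι_mul_ι_mul m₁ m₂ x hx ih =>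
      have h := hmul m₁ m₂ ih
      rw [← exteriorLift_ι β hβ m₁, ← exteriorLift_ι β hβ m₂, ← map_mul, ← map_mul] at h
      exact h
  · induction e, he using CliffordAlgebra.odd_induction with
    | ι v => exact (exteriorLift_ι β hβ v).symm ▸ hβ v
    | add x y hx hy ihx ihy => rw [map_add]; exact add_mem ihx ihy
    | ι_mul_ι_mul m₁ m₂ x hx ih =>
      have h := hmul m₁ m₂ ih
      rw [← exteriorLift_ι β hβ m₁, ← exteriorLift_ι β hβ m₂, ← map_mul, ← map_mul] at h
      exact h

variable (α : V →ₗ[k] A) (hα : ∀ v, α v ∈ A.grading 0) (β : W →ₗ[k] A)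
    (hβ : ∀ w, β w ∈ A.grading 1)

/-- The algebra homomorphism `Sym(V) ⊗ Λ(W) ⟶ A` defined by linear maps from `V` to the even part
and from `W` to the odd part. -/
def symSuperLiftHom : SymmetricAlgebra k V ⊗[k] ExteriorAlgebra k W →ₐ[k] A :=
  Algebra.TensorProduct.lift (symmetricLift α hα) (exteriorLift β hβ)
    -- The two lifts have commuting images because that of `Sym(V)` is even, hence central.
    fun s e => (SAlg.even_comm (symmetricLift_mem α hα s) (exteriorLift β hβ e) :)

theorem symSuperLiftHom_tmul (s : SymmetricAlgebra k V) (e : ExteriorAlgebra k W) :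
    symSuperLiftHom α hα β hβ (s ⊗ₜ e) = symmetricLift α hα s * exteriorLift β hβ e :=
  Algebra.TensorProduct.lift_tmul (symmetricLift α hα) (exteriorLift β hβ)
    (fun s e => SAlg.even_comm (symmetricLift_mem α hα s) (exteriorLift β hβ e)) s e

/-- The morphism `Sym(V) ⊗ Λ(W) ⟶ A` of superalgebras defined by linear maps from `V` to the even
part and from `W` to the odd part. -/
def symSuperLift : symSuper k V W ⟶ A where
  __ := symSuperLiftHom α hα β hβ
  map_mem' i z hz := by
    obtain ⟨y, rfl⟩ := hz
    change symSuperLiftHom α hα β hβ _ ∈ _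
    induction y with
    | zero => rw [map_zero, map_zero]; exact zero_mem _
    | add x y hx hy => rw [map_add, map_add]; exact add_mem hx hy
    | tmul s e =>
      rw [LinearMap.lTensor_tmul, symSuperLiftHom_tmul]
      have h := SetLike.mul_mem_graded (symmetricLift_mem α hα s) (exteriorLift_mem β hβ i e.2)
      rwa [zero_add] at h

theorem symSuperLift_symEven (v : V) : symSuperLift α hα β hβ (symEven k V W v) = α v := by
  refine (symSuperLiftHom_tmul α hα β hβ _ _).trans ?_
  rw [map_one, mul_one, symmetricLift_ι]

theorem symSuperLift_symOdd (w : W) : symSuperLift α hα β hβ (symOdd k V W w) = β w := by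
  refine (symSuperLiftHom_tmul α hα β hβ _ _).trans ?_
  rw [map_one, one_mul, exteriorLift_ι]

end SymLift

/-! ### Morphisms out of `Sym(T^*)` and linear maps on the cotangent space -/

namespace Superscheme

variable {k : Type u} [Field k] [NeZero (2 : k)] {X : Superscheme k} {x : X} (hx : X.IsRational x)

/-- The linear functions on the even part of the tangent superspace as elements of `Sym(T^*)`. -/
def symCotangentEven : Module.Dual k (tangentGrading hx 0) →ₗ[k] symCotangent hx :=
  symEven k (Module.Dual k (tangentGrading hx 0)) (Module.Dual k (tangentGrading hx 1))

/-- The linear functions on the odd part of the tangent superspace as elements of `Sym(T^*)`. -/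
def symCotangentOdd : Module.Dual k (tangentGrading hx 1) →ₗ[k] symCotangent hx :=
  symOdd k (Module.Dual k (tangentGrading hx 0)) (Module.Dual k (tangentGrading hx 1))

/-- The linear function on the tangent superspace defined by an element of the cotangent space, as
an element of the symmetric superalgebra. -/
def cotangentCoord : X.Cotangent x →ₗ[k] symCotangent hx :=
  symCotangentEven hx ∘ₗ LinearMap.lcomp k k (tangentGrading hx 0).subtype ∘ₗ pairing hx +
    symCotangentOdd hx ∘ₗ LinearMap.lcomp k k (tangentGrading hx 1).subtype ∘ₗ pairing hx

/-- An even covector pairs to zero with odd tangent vectors, so only the symmetric summand survives.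
-/
theorem cotangentCoord_even (w : X.cotangentGrading x 0) :
    cotangentCoord hx w.1 = symCotangentEven hx (cotangentToDual hx 0 w) := by
  have h : pairing hx w.1 ∘ₗ (tangentGrading hx 1).subtype = 0 :=
    LinearMap.ext fun D => pairing_eq_zero hx zero_ne_one w.2 D.2
  refine Eq.trans (congrArg (symCotangentEven hx (cotangentToDual hx 0 w) + ·)
    ((congrArg (symCotangentOdd hx) h).trans (map_zero _))) (add_zero _)

theorem cotangentCoord_odd (w : X.cotangentGrading x 1) :
    cotangentCoord hx w.1 = symCotangentOdd hx (cotangentToDual hx 1 w) := by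
  have h : pairing hx w.1 ∘ₗ (tangentGrading hx 0).subtype = 0 :=
    LinearMap.ext fun D => pairing_eq_zero hx one_ne_zero w.2 D.2
  refine Eq.trans (congrArg (· + symCotangentOdd hx (cotangentToDual hx 1 w))
    ((congrArg (symCotangentEven hx) h).trans (map_zero _))) (zero_add _)

theorem cotangentCoord_mem :
    cotangentCoord hx ∈ X.cotangentHom x (symCotangent hx) := by
  intro i w hw
  rcases zmod_two i with rfl | rfl
  · exact cotangentCoord_even hx ⟨w, hw⟩ ▸ symEven_mem _
  · exact cotangentCoord_odd hx ⟨w, hw⟩ ▸ symOdd_mem _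

/-- The linear map `m/m² ⟶ A` defined by a morphism `Sym(T^*) ⟶ A`. -/
def homOfSym {A : SAlg k} (h : symCotangent hx ⟶ A) : X.cotangentHom x A :=
  ⟨h.toAlgHom.toLinearMap ∘ₗ cotangentCoord hx,
    fun i w hw => SAlg.map_mem h (cotangentCoord_mem hx i w hw)⟩

theorem homOfSym_mk {A : SAlg k} (h : symCotangent hx ⟶ A) (f : X.maxIdeal x) :
    (homOfSym hx h).1 (X.cotangentMk x f) = h (coord hx f.1) := rfl

/-- Since `(m/m²)_i ≅ (T_i)^*`, the elements `cotangentCoord hx w` include all generators of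
`Sym(T^*)`, which gives injectivity. Conversely, the two parts of `d`, transported to `(T_0)^*` and
`(T_1)^*`, are even and odd linear maps to which the universal property applies. -/
theorem homOfSym_bijective [Module.Finite k (X.Cotangent x)] (A : SAlg k) :
    Function.Bijective (homOfSym hx (A := A)) := by
  constructor
  · intro g h e
    have key : ∀ w, g (cotangentCoord hx w) = h (cotangentCoord hx w) := fun w =>
      LinearMap.congr_fun (congrArg Subtype.val e) w
    refine symSuper_hom_ext (fun v => ?_) fun v => ?_
    · obtain ⟨w, rfl⟩ := (cotangentToDual_bijective hx 0).2 v
      have := key w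
      rwa [cotangentCoord_even] at this
    · obtain ⟨w, rfl⟩ := (cotangentToDual_bijective hx 1).2 v
      have := key w
      rwa [cotangentCoord_odd] at this
  · intro d
    let e := fun i => LinearEquiv.ofBijective _ (cotangentToDual_bijective hx i)
    let δ := fun i => (d.1 ∘ₗ (X.cotangentGrading x i).subtype) ∘ₗ (e i).symm.toLinearMap
    have hδ : ∀ i l, δ i l ∈ A.grading i := fun i l => d.2 i _ ((e i).symm l).2
    have hδ' : ∀ i w, δ i (cotangentToDual hx i w) = d.1 w := fun i w =>
      congrArg (fun v : X.cotangentGrading x i => d.1 v) ((e i).symm_apply_apply w)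
    let h : symCotangent hx ⟶ A := symSuperLift (δ 0) (hδ 0) (δ 1) (hδ 1)
    refine ⟨h, Subtype.ext (LinearMap.ext fun w => ?_)⟩
    obtain ⟨w0, hw0, w1, hw1, rfl⟩ := ((isInternal_iff _).1
      (cotangentGrading_isInternal (X := X) (x := x))).1 w
    rw [map_add, map_add]
    refine congrArg₂ (· + ·) ?_ ?_
    · exact (congrArg h (cotangentCoord_even hx ⟨w0, hw0⟩)).trans
        ((symSuperLift_symEven _ _ _ _ _).trans (hδ' 0 _))
    · exact (congrArg h (cotangentCoord_odd hx ⟨w1, hw1⟩)).trans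
        ((symSuperLift_symOdd _ _ _ _ _).trans (hδ' 1 _))

/-- The bijection `Hom(m/m², A) ≅ Hom(Sym(T^*), A)`. -/
def symEquiv [Module.Finite k (X.Cotangent x)] (A : SAlg k) :
    X.cotangentHom x A ≃ (symCotangent hx ⟶ A) :=
  (Equiv.ofBijective _ (homOfSym_bijective hx A)).symm

theorem symEquiv_coord [Module.Finite k (X.Cotangent x)] {A : SAlg k} (d : X.cotangentHom x A)
    (f : X.maxIdeal x) : symEquiv hx A d (coord hx f.1) = d.1 (X.cotangentMk x f) := by
  rw [← homOfSym_mk]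
  exact congrArg (fun d : X.cotangentHom x A => d.1 (X.cotangentMk x f))
    ((Equiv.ofBijective _ (homOfSym_bijective hx A)).apply_symm_apply d)

theorem symEquiv_eq [Module.Finite k (X.Cotangent x)] {A : SAlg k} (d : X.cotangentHom x A)
    (h : symCotangent hx ⟶ A) (e : ∀ f : X.maxIdeal x, h (coord hx f.1) = d.1 (X.cotangentMk x f)) :
    symEquiv hx A d = h := by
  refine (Equiv.symm_apply_eq _).2 (Subtype.ext (LinearMap.ext fun w => ?_))
  obtain ⟨f, rfl⟩ := cotangentMk_surjective w
  exact (e f).symm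

end Superscheme

/-! ### Dual numbers in one and two parameters -/

namespace SAlg
variable {k : Type u} [Field k] {A B : SAlg k}

/-- The coefficient `a` of `a + ε b`. -/
def dualFst (z : A.dual) : A := TrivSqZeroExt.fst (R := A) (M := A) z

/-- The coefficient `b` of `a + ε b`. -/
def dualSnd (z : A.dual) : A := TrivSqZeroExt.snd (R := A) (M := A) z

theorem dual_ext {z w : A.dual} (h : dualFst z = dualFst w) (h' : dualSnd z = dualSnd w) : z = w :=
  TrivSqZeroExt.ext h h'

theorem dualSnd_mul (z w : A.dual) :
    dualSnd (z * w) = dualFst z * dualSnd w + dualSnd z * dualFst w := rfl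

/-- The inclusion `A ⟶ A(ε)`. -/
def dualIncl (A : SAlg k) : A ⟶ A.dual where
  toFun a := dualMk a 0
  map_one' := rfl
  map_mul' a b := dual_ext rfl (by
    change (0 : A) = a * 0 + 0 * b
    rw [mul_zero, zero_mul, add_zero])
  map_zero' := rfl
  map_add' a b := dual_ext rfl (add_zero (0 : A)).symm
  commutes' _ := rfl
  map_mem' _ _ h := ⟨h, zero_mem _⟩

/-- The morphism `A(ε)(ε') ⟶ A(ε)` with `ε, ε' ↦ ε`. -/
def dualDiag (A : SAlg k) : A.dual.dual ⟶ A.dual where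
  -- The coefficient of `ε ε'` is dropped, as `ε ε'` goes to `ε² = 0`.
  toFun z := dualMk (dualFst (dualFst z)) (dualSnd (dualFst z) + dualFst (dualSnd z))
  map_one' := dual_ext rfl (add_zero (0 : A))
  map_mul' z w := dual_ext rfl (by
    change (dualFst (dualFst z) * dualSnd (dualFst w) + dualSnd (dualFst z) * dualFst (dualFst w)) +
      (dualFst (dualFst z) * dualFst (dualSnd w) + dualFst (dualSnd z) * dualFst (dualFst w)) =
      dualFst (dualFst z) * (dualSnd (dualFst w) + dualFst (dualSnd w)) +
        (dualSnd (dualFst z) + dualFst (dualSnd z)) * dualFst (dualFst w)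
    rw [mul_add, add_mul, add_add_add_comm])
  map_zero' := dual_ext rfl (add_zero (0 : A))
  map_add' z w := dual_ext rfl (add_add_add_comm _ _ _ _)
  commutes' _ := dual_ext rfl (add_zero (0 : A))
  map_mem' _ _ h := ⟨h.1.1, add_mem h.1.2 h.2.1⟩

theorem dualMk_zero_sq (a : A) : dualMk 0 a * dualMk 0 a = 0 :=
  dual_ext (zero_mul (0 : A)) (by
    change (0 : A) * a + a * 0 = 0
    rw [mul_zero, zero_mul, add_zero])

theorem dualIncl_comp_dualProj (A : SAlg k) : dualIncl A ≫ dualProj A = 𝟙 A := rfl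

/-- In `A(ε)(ε')`, `dualIncl A.dual` keeps `a + ε b` and `dualMap (dualIncl A)` turns it into `a +
ε' b`; `dualProj A.dual` sets `ε' = 0` and `dualMap (dualProj A)` sets `ε = 0`. This and the
following identities evaluate the two inclusions under these projections and under `ε' = ε`; they
carry the proof of `lieToHom_mul`. -/
theorem dualIncl_comp_dualMap_dualProj (A : SAlg k) :
    dualIncl A.dual ≫ dualMap (dualProj A) = dualProj A ≫ dualIncl A := rfl

theorem dualMap_dualIncl_comp_dualProj (A : SAlg k) :
    dualMap (dualIncl A) ≫ dualProj A.dual = dualProj A ≫ dualIncl A := rfl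

theorem dualMap_dualIncl_comp_dualMap_dualProj (A : SAlg k) :
    dualMap (dualIncl A) ≫ dualMap (dualProj A) = 𝟙 A.dual := rfl

theorem dualIncl_comp_dualDiag (A : SAlg k) : dualIncl A.dual ≫ dualDiag A = 𝟙 A.dual :=
  hom_ext fun z => dual_ext rfl (add_zero (dualSnd z))

theorem dualMap_dualIncl_comp_dualDiag (A : SAlg k) :
    dualMap (dualIncl A) ≫ dualDiag A = 𝟙 A.dual :=
  hom_ext fun z => dual_ext rfl (zero_add (dualSnd z))

/-- Every point of `Spec A(ε)` lies on the closed subspace `Spec A`. -/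
theorem specBase_dualProj_surjective (A : SAlg k) :
    Function.Surjective (specBase (dualProj A)) := by
  intro p
  refine ⟨specBase (dualIncl A) p, PrimeSpectrum.ext (Ideal.ext fun t => ?_)⟩
  -- `t'` is `t` with its `ε`-term removed. The difference has square zero and so lies in every
  -- prime ideal; hence `𝔭` is determined by its contraction to `A`.
  let t' : A.dual.Even := evenMap (dualIncl A) (evenMap (dualProj A) t)
  have hsq : (t - t') * (t - t') = 0 := Subtype.ext (dual_ext
    (by
      change (dualFst t.1 - dualFst t.1) * (dualFst t.1 - dualFst t.1) = 0
      rw [sub_self, mul_zero])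
    (by
      change (dualFst t.1 - dualFst t.1) * (dualSnd t.1 - 0) +
        (dualSnd t.1 - 0) * (dualFst t.1 - dualFst t.1) = 0
      rw [sub_self, mul_zero, zero_mul, add_zero]))
  have hmem : t - t' ∈ PrimeSpectrum.asIdeal p :=
    or_self_iff.1 (p.2.mem_or_mem (hsq ▸ p.asIdeal.zero_mem))
  change t' ∈ PrimeSpectrum.asIdeal p ↔ t ∈ PrimeSpectrum.asIdeal p
  rw [← sub_add_cancel t t']
  exact (Ideal.add_mem_iff_right _ hmem).symm.trans (by rw [sub_add_cancel])

theorem eq_basePoint (p : (base k).Spec) : p = basePoint k := by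
  have key : ∀ (q : (base k).Spec) (t : (base k).Even), t ∈ PrimeSpectrum.asIdeal q ↔ t = 0 := by
    refine fun q t => ⟨fun ht => ?_, fun h => h ▸ Ideal.zero_mem _⟩
    by_contra h0
    let c : k := t.1
    have hc : c ≠ 0 := fun h => h0 (Subtype.ext h)
    let b : k := c⁻¹
    let s : (base k).Even := ⟨b, base_mem_zero (k := k) b⟩
    have hst : s * t = 1 := Subtype.ext (show b * c = 1 from inv_mul_cancel₀ hc)
    exact q.2.ne_top ((Ideal.eq_top_iff_one _).2 (hst ▸ Ideal.mul_mem_left _ s ht))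
  exact PrimeSpectrum.ext (Ideal.ext fun t => (key p t).trans (key _ t).symm)

end SAlg

namespace Superscheme
variable {k : Type u} [Field k] {X : Superscheme k} {x : X} (hx : X.IsRational x) {A : SAlg k}

/-! ### Homomorphisms to dual numbers -/

section DerivOf
variable (ψ : X.localRing x ⟶ A.dual)
  (hψ : ∀ f, SAlg.dualFst (ψ f) = algebraMap k A (valueAt hx f))

/-- The coefficient of `ε` of a homomorphism to dual numbers, as a linear map. -/
def sndHom : X.localRing x →ₗ[k] A where
  toFun f := SAlg.dualSnd (ψ f)
  map_add' f g := congrArg SAlg.dualSnd (SAlg.hom_add ψ f g)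
  map_smul' c f := congrArg SAlg.dualSnd (SAlg.hom_smul ψ c f)

include hψ in
-- `ψ` takes `m` into `ε A`, and products of elements of `ε A` vanish.
theorem sndHom_sq {f : X.localRing x} (hf : f ∈ X.maxIdeal x * X.maxIdeal x) :
    sndHom ψ f = 0 := by
  induction hf using Submodule.mul_induction_on' with
  | mem_mul_mem f hf g hg =>
    refine (congrArg SAlg.dualSnd (SAlg.hom_mul ψ f g)).trans ?_
    rw [SAlg.dualSnd_mul, hψ, hψ, (valueAt_eq_zero_iff hx).2 hf, (valueAt_eq_zero_iff hx).2 hg,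
      map_zero, zero_mul, mul_zero, add_zero]
  | add f hf g hg ihf ihg => rw [map_add, ihf, ihg, add_zero]

/-- The linear map `d : m/m² ⟶ A` with `ψ(f) = f(x) + ε d(df)`. -/
def derivOf : X.cotangentHom x A :=
  ⟨Submodule.liftQ _ (sndHom ψ ∘ₗ (X.maxIdeal x).subtype) fun _ hf => sndHom_sq hx ψ hψ hf, by
    rintro i _ ⟨f, hf, rfl⟩
    exact (SAlg.map_mem ψ hf).2⟩

theorem derivOf_mk (f : X.maxIdeal x) :
    (derivOf hx ψ hψ).1 (X.cotangentMk x f) = SAlg.dualSnd (ψ f.1) := rfl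

theorem eq_dualMk_derivOf (f : X.localRing x) :
    ψ f = SAlg.dualMk (algebraMap k A (valueAt hx f))
      ((derivOf hx ψ hψ).1 (differential hx f)) := by
  refine SAlg.dual_ext (hψ f) ?_
  refine Eq.trans ?_ (derivOf_mk hx ψ hψ ⟨_, sub_valueAt_mem hx f⟩).symm
  change sndHom ψ f = sndHom ψ (f - algebraMap k _ (valueAt hx f))
  rw [map_sub]
  have : sndHom ψ (algebraMap k _ (valueAt hx f)) = 0 :=
    congrArg SAlg.dualSnd (SAlg.hom_algebraMap ψ (valueAt hx f))
  rw [this, sub_zero]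

end DerivOf

variable [NeZero (2 : k)]

/-- The homomorphism `f ↦ f(x) + ε d(df)`. -/
def dualHomOf (d : X.cotangentHom x A) : X.localRing x ⟶ A.dual where
  toFun f := SAlg.dualMk (algebraMap k A (valueAt hx f)) (d.1 (differential hx f))
  map_one' := SAlg.dual_ext ((congrArg (algebraMap k A) (valueAt_one hx)).trans (map_one _)) (by
    have h := differential_algebraMap hx 1
    rw [map_one] at h
    exact (congrArg d.1 h).trans (map_zero _))
  map_mul' f g := SAlg.dual_ext
    ((congrArg (algebraMap k A) (valueAt_mul hx f g)).trans (map_mul _ _ _)) (by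
      refine (congrArg d.1 (differential_mul hx f g)).trans ?_
      rw [map_add, map_smul, map_smul, Algebra.smul_def, Algebra.smul_def,
        Algebra.commutes (valueAt hx g)]
      rfl)
  map_zero' := SAlg.dual_ext
    ((congrArg (algebraMap k A) (map_zero (valueHom hx))).trans (map_zero _))
    ((congrArg d.1 (map_zero (differentialₗ hx))).trans (map_zero _))
  map_add' f g := SAlg.dual_ext
    ((congrArg (algebraMap k A) (valueAt_add hx f g)).trans (map_add _ _ _))
    ((congrArg d.1 (differential_add hx f g)).trans (map_add _ _ _))
  commutes' c := SAlg.dual_ext (congrArg (algebraMap k A) (valueAt_algebraMap hx c))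
    ((congrArg d.1 (differential_algebraMap hx c)).trans (map_zero _))
  map_mem' i f hf := by
    refine ⟨?_, d.2 i _ (differential_mem hx hf)⟩
    change algebraMap k A (valueAt hx f) ∈ A.grading i
    rcases zmod_two i with rfl | rfl
    · exact A.evenSubalgebra.algebraMap_mem _
    · rw [valueAt_odd hx hf, map_zero]
      exact zero_mem _

theorem dualHomOf_apply (d : X.cotangentHom x A) (f : X.localRing x) :
    dualHomOf hx d f = SAlg.dualMk (algebraMap k A (valueAt hx f)) (d.1 (differential hx f)) := rfl

/-- A nonunit has value zero and goes to a multiple of `ε`. This is the condition under which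
`ofStalkHom` yields a morphism. -/
theorem dualHomOf_isNilpotent (d : X.cotangentHom x A) (f : X.localRing x) (hf : ¬ IsUnit f) :
    IsNilpotent (dualHomOf hx d f) := by
  refine ⟨2, ?_⟩
  rw [dualHomOf_apply, (valueAt_eq_zero_iff hx).2 hf, map_zero, pow_two, SAlg.dualMk_zero_sq]

end Superscheme

namespace AlgebraicSupergroup

variable {k : Type u} [Field k] [NeZero (2 : k)] (G : AlgebraicSupergroup k) {A B : SAlg k}

theorem map_id (g : G.Points A) : G.map (𝟙 A) g = g :=
  (congrArg (· ≫ (g : A.Spec ⟶ G.toSuperRingedSpace)) (SAlg.specMap_id A)).trans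
    (Category.id_comp _)

/-! ### Points supported at the identity -/

/-- The point `g` has the image `1_G`. -/
def IsAtIdentity (g : G.Points A) : Prop :=
  ∀ p : A.Spec, (SuperRingedSpace.Hom.hom g).base p = G.identity

variable {G}

/-- The homomorphism `𝒪_{G,1} ⟶ A` defined by a point with image `1_G`. -/
def IsAtIdentity.hom {g : G.Points A} (h : G.IsAtIdentity g) : G.localRing G.identity ⟶ A :=
  SuperRingedSpace.stalkHom (Y := G.toSuperRingedSpace) g h

theorem IsAtIdentity.map {g : G.Points A} (h : G.IsAtIdentity g) (φ : A ⟶ B) :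
    G.IsAtIdentity (G.map φ g) := fun p => h (SAlg.specBase φ p)

theorem IsAtIdentity.map_hom {g : G.Points A} (h : G.IsAtIdentity g) (φ : A ⟶ B) :
    (h.map φ).hom = h.hom ≫ φ :=
  SuperRingedSpace.stalkHom_specMap φ _ h (h.map φ)

theorem IsAtIdentity.hom_of_map {g : G.Points A} {g' : G.Points B} (h : G.IsAtIdentity g)
    (h' : G.IsAtIdentity g') {φ : A ⟶ B} (e : G.map φ g = g') : h'.hom = h.hom ≫ φ := by
  subst e
  exact h.map_hom φ

theorem IsAtIdentity.ext {g g' : G.Points A} (h : G.IsAtIdentity g) (h' : G.IsAtIdentity g')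
    (e : h.hom = h'.hom) : g = g' :=
  SuperRingedSpace.hom_ext_of_stalkHom (Y := G.toSuperRingedSpace) h h' e

/-- `Spec A ⟶ Spec A(ε)` is surjective on points, so the image of `g` is visible after setting `ε =
0`. -/
theorem isAtIdentity_of_map_dualProj {g : G.Points A.dual}
    (h : G.IsAtIdentity (G.map A.dualProj g)) : G.IsAtIdentity g := by
  intro p
  obtain ⟨q, rfl⟩ := SAlg.specBase_dualProj_surjective A p
  exact h q

theorem isAtIdentity_unit : G.IsAtIdentity (1 : G.Points (SAlg.base k)) := fun p =>
  congrArg G.unit.hom.base (SAlg.eq_basePoint p)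

theorem map_fromBase_unit : G.map A.fromBase (1 : G.Points (SAlg.base k)) = 1 := map_one _

/-- The unit of `G(A)` is the pullback of `e` along `Spec A ⟶ Spec k`, and `Spec k` has a single
point. -/
theorem isAtIdentity_one : G.IsAtIdentity (1 : G.Points A) := by
  rw [← map_fromBase_unit]
  exact isAtIdentity_unit.map _

/-- A homomorphism `ψ` to `k` kills `f - ψ(f)`, which is therefore not a unit; this characterizes
`ψ(f)` as the value of `f`. -/
theorem isAtIdentity_unit_hom_apply (f : G.localRing G.identity) :
    isAtIdentity_unit.hom f = valueAt G.identity_isRational f := by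
  let ψ : G.localRing G.identity ⟶ SAlg.base k := isAtIdentity_unit.hom
  let c : k := ψ f
  refine (valueAt_eq (c := c) G.identity_isRational fun hu => ?_).symm
  have h0 : ψ (f - algebraMap k _ c) = 0 := by
    rw [SAlg.hom_sub, SAlg.hom_algebraMap]
    exact sub_self (show k from c)
  obtain ⟨v, hv⟩ := hu.exists_right_inv
  have h1 : ψ 1 = 0 := by rw [← hv, SAlg.hom_mul, h0, zero_mul]
  rw [SAlg.hom_one] at h1
  exact one_ne_zero (α := k) h1

theorem isAtIdentity_one_hom_apply (f : G.localRing G.identity) :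
    (isAtIdentity_one (A := A)).hom f = algebraMap k A (valueAt G.identity_isRational f) := by
  rw [isAtIdentity_unit.hom_of_map isAtIdentity_one map_fromBase_unit]
  exact congrArg (algebraMap k A) (isAtIdentity_unit_hom_apply f)

/-! ### The Lie algebra -/

theorem isAtIdentity_lie (z : G.Lie A) : G.IsAtIdentity z.1 := by
  refine isAtIdentity_of_map_dualProj ?_
  rw [show G.map A.dualProj z.1 = 1 from z.2]
  exact isAtIdentity_one

/-- Setting `ε = 0` turns `z` into the unit of `G(A)`, whose homomorphism is evaluation at `1_G`. -/
theorem dualFst_lie_hom (z : G.Lie A) (f : G.localRing G.identity) :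
    SAlg.dualFst ((isAtIdentity_lie z).hom f) =
      algebraMap k A (valueAt G.identity_isRational f) := by
  rw [← isAtIdentity_one_hom_apply, (isAtIdentity_lie z).hom_of_map isAtIdentity_one
    (show G.map A.dualProj z.1 = 1 from z.2)]
  rfl

/-- The linear map `m/m² ⟶ A` defined by an element of `Lie(G)(A)`. -/
def lieToHom (z : G.Lie A) : G.cotangentHom G.identity A :=
  derivOf G.identity_isRational (isAtIdentity_lie z).hom (dualFst_lie_hom z)

theorem lie_hom_apply (z : G.Lie A) (f : G.localRing G.identity) :
    (isAtIdentity_lie z).hom f = SAlg.dualMk (algebraMap k A (valueAt G.identity_isRational f))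
      ((lieToHom z).1 (differential G.identity_isRational f)) :=
  eq_dualMk_derivOf _ _ _ f

theorem lieToHom_mk (z : G.Lie A) (f : G.maxIdeal G.identity) :
    (lieToHom z).1 (G.cotangentMk G.identity f) = SAlg.dualSnd ((isAtIdentity_lie z).hom f.1) := rfl

/-- The `A(ε)`-point defined by a linear map `m/m² ⟶ A`. -/
def pointOfHom (d : G.cotangentHom G.identity A) : G.Points A.dual :=
  SuperRingedSpace.ofStalkHom (Y := G.toSuperRingedSpace) (dualHomOf G.identity_isRational d)
    (dualHomOf_isNilpotent G.identity_isRational d)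

theorem isAtIdentity_pointOfHom (d : G.cotangentHom G.identity A) :
    G.IsAtIdentity (pointOfHom d) := fun _ => rfl

theorem pointOfHom_hom (d : G.cotangentHom G.identity A) :
    (isAtIdentity_pointOfHom d).hom = dualHomOf G.identity_isRational d :=
  SuperRingedSpace.stalkHom_ofStalkHom (Y := G.toSuperRingedSpace) _ _

theorem pointOfHom_mem (d : G.cotangentHom G.identity A) : pointOfHom d ∈ G.Lie A := by
  refine ((isAtIdentity_pointOfHom d).map A.dualProj).ext isAtIdentity_one
    (SAlg.hom_ext fun f => ?_)
  rw [(isAtIdentity_pointOfHom d).map_hom, pointOfHom_hom, isAtIdentity_one_hom_apply]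
  rfl

theorem lieToHom_pointOfHom (d : G.cotangentHom G.identity A) :
    lieToHom ⟨pointOfHom d, pointOfHom_mem d⟩ = d := by
  refine Subtype.ext (LinearMap.ext fun w => ?_)
  obtain ⟨f, rfl⟩ := cotangentMk_surjective w
  refine (lieToHom_mk _ f).trans ?_
  refine (congrArg (fun ψ : G.localRing G.identity ⟶ A.dual => SAlg.dualSnd (ψ f.1))
    (pointOfHom_hom d)).trans ?_
  exact congrArg d.1 (differential_of_mem G.identity_isRational f.2)

theorem lieToHom_bijective : Function.Bijective (lieToHom (G := G) (A := A)) := by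
  refine ⟨fun z w h => Subtype.ext ((isAtIdentity_lie z).ext (isAtIdentity_lie w)
    (SAlg.hom_ext fun f => ?_)), fun d => ⟨_, lieToHom_pointOfHom d⟩⟩
  rw [lie_hom_apply, lie_hom_apply, h]

/-- Let `u` be the product in `G(A(ε)(ε'))` of `z`, with parameter `ε`, and `w`, with parameter
`ε'`. Since `z` and `w` become `1` when their parameters vanish, `u` specializes to `z` at `ε' = 0`,
to `w` at `ε = 0`, and to `z * w` at `ε' = ε`. Only functoriality of the group law is used, with no
comultiplication. -/
theorem lieToHom_mul (z w : G.Lie A) : lieToHom (z * w) = lieToHom z + lieToHom w := by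
  let u : G.Points A.dual.dual := G.map (SAlg.dualIncl A.dual) z.1 *
    G.map (SAlg.dualMap (SAlg.dualIncl A)) w.1
  have hz : G.map A.dualProj z.1 = 1 := z.2
  have hw : G.map A.dualProj w.1 = 1 := w.2
  have h1 : G.map A.dual.dualProj u = z.1 := by
    rw [_root_.map_mul, ← map_comp, ← map_comp, SAlg.dualIncl_comp_dualProj, map_id,
      SAlg.dualMap_dualIncl_comp_dualProj, map_comp, hw, map_one, mul_one]
  have h2 : G.map (SAlg.dualMap A.dualProj) u = w.1 := by
    rw [_root_.map_mul, ← map_comp, ← map_comp, SAlg.dualMap_dualIncl_comp_dualMap_dualProj, map_id,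
      SAlg.dualIncl_comp_dualMap_dualProj, map_comp, hz, map_one, one_mul]
  have h3 : G.map (SAlg.dualDiag A) u = (z * w).1 := by
    rw [_root_.map_mul, ← map_comp, ← map_comp, SAlg.dualIncl_comp_dualDiag,
      SAlg.dualMap_dualIncl_comp_dualDiag, map_id, map_id]
    rfl
  have hu : G.IsAtIdentity u := isAtIdentity_of_map_dualProj (by
    rw [h1]
    exact isAtIdentity_lie z)
  refine Subtype.ext (LinearMap.ext fun v => ?_)
  obtain ⟨f, rfl⟩ := cotangentMk_surjective v
  have e1 : (isAtIdentity_lie z).hom = hu.hom ≫ A.dual.dualProj := hu.hom_of_map _ h1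
  have e2 : (isAtIdentity_lie w).hom = hu.hom ≫ SAlg.dualMap A.dualProj := hu.hom_of_map _ h2
  have e3 : (isAtIdentity_lie (z * w)).hom = hu.hom ≫ SAlg.dualDiag A := hu.hom_of_map _ h3
  -- All three homomorphisms are specializations of that of `u`. Both sides are the coefficient of
  -- `ε` plus the coefficient of `ε'` in the image of `f` under it.
  change (lieToHom (z * w)).1 _ = (lieToHom z).1 _ + (lieToHom w).1 _
  rw [lieToHom_mk, lieToHom_mk, lieToHom_mk, e1, e2, e3]
  rfl

variable (G A) in
/-- The isomorphism `Lie(G)(A) ≅ Hom(m/m², A)`. -/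
def lieEquiv : G.Lie A ≃* Multiplicative (G.cotangentHom G.identity A) where
  __ := (Equiv.ofBijective _ lieToHom_bijective).trans Multiplicative.ofAdd
  map_mul' z w := congrArg Multiplicative.ofAdd (lieToHom_mul z w)

theorem pullback_lie (z : G.Lie A) (U : Opens G.toSuperscheme) (hU : G.identity ∈ U)
    (s : G.presheaf.obj (op U)) :
    G.pullback z.1 U s = A.dual.toSection _ (SAlg.dualMk
      (algebraMap k A (valueAt G.identity_isRational (germ G.presheaf G.identity U hU s)))
      ((lieToHom z).1 (differential G.identity_isRational
        (germ G.presheaf G.identity U hU s)))) := by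
  refine (SuperRingedSpace.stalkHom_germ (Y := G.toSuperRingedSpace) _ (isAtIdentity_lie z) U hU
    s).trans ?_
  exact congrArg (A.dual.toSection _) (lie_hom_apply z _)

theorem lieToHom_lieMap (φ : A ⟶ B) (z : G.Lie A) (w : G.Cotangent G.identity) :
    (lieToHom (G.lieMap φ z)).1 w = φ ((lieToHom z).1 w) := by
  obtain ⟨f, rfl⟩ := cotangentMk_surjective w
  rw [lieToHom_mk, lieToHom_mk,
    (isAtIdentity_lie z).hom_of_map (isAtIdentity_lie (G.lieMap φ z)) (φ := SAlg.dualMap φ) rfl]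
  rfl

end AlgebraicSupergroup

end Super

end

theorem mainTheorem6 {k : Type u} [Field k] [NeZero (2 : k)] (G : AlgebraicSupergroup k) :
    ∃ (Φ : ∀ A : SAlg k, G.Lie A ≃* Multiplicative (G.cotangentHom G.identity A))
      (Θ : ∀ A : SAlg k, tangentTensor G.identity_isRational A ≃ₗ[k]
        G.cotangentHom G.identity A)
      (Ξ : ∀ A : SAlg k, G.Lie A ≃ (symCotangent G.identity_isRational ⟶ A)),
      -- `Φ` identifies `z` with the linear map `d` such that `z^*(s) = s(1_G) + ε d(ds)`
      (∀ (A : SAlg k) (z : G.Lie A) (U : Opens G.toSuperscheme) (hU : G.identity ∈ U)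
        (s : G.presheaf.obj (op U)),
        G.pullback z.1 U s = A.dual.toSection _ (SAlg.dualMk
          (algebraMap k A (valueAt G.identity_isRational (germ G.presheaf G.identity U hU s)))
          ((Φ A z).toAdd.1
            (differential G.identity_isRational (germ G.presheaf G.identity U hU s))))) ∧
      (∀ (A B : SAlg k) (φ : A ⟶ B) (z : G.Lie A) (w : G.Cotangent G.identity),
        (Φ B (G.lieMap φ z)).toAdd.1 w = φ ((Φ A z).toAdd.1 w)) ∧
      -- `Θ` takes `a ⊗ D` to the map with `[f] ↦ D(f) a`
      (∀ (A : SAlg k) (t : tangentTensor G.identity_isRational A)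
        (f : G.maxIdeal G.identity),
        (Θ A t).1 (G.cotangentMk G.identity f) =
          tensorEval G.identity_isRational A f.1 t.1) ∧
      (∀ (A B : SAlg k) (φ : A ⟶ B)
        (t : tangentTensor G.identity_isRational A)
        (t' : tangentTensor G.identity_isRational B),
        t'.1 = tensorMap G.identity_isRational φ t.1 →
          ∀ w : G.Cotangent G.identity, (Θ B t').1 w = φ ((Θ A t).1 w)) ∧
      -- `Ξ` identifies `Lie(G)` with the functor represented by the tangent superspace
      (∀ (A : SAlg k) (z : G.Lie A) (f : G.maxIdeal G.identity),
        Ξ A z (coord G.identity_isRational f.1) =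
          (Φ A z).toAdd.1 (G.cotangentMk G.identity f)) ∧
      (∀ (A B : SAlg k) (φ : A ⟶ B) (z : G.Lie A), Ξ B (G.lieMap φ z) = Ξ A z ≫ φ) := by
  -- Algebraicity enters here only. The finite dimension serves `Θ` and `Ξ`; the isomorphism `Φ`
  -- does not depend on it.
  have hfin : Module.Finite k (G.Cotangent G.identity) :=
    IsAlgebraic.finite_cotangent G.isAlgebraic G.identity_isRational
  refine ⟨AlgebraicSupergroup.lieEquiv G, tangentTensorEquiv G.identity_isRational,
    fun A => (Equiv.ofBijective _ (AlgebraicSupergroup.lieToHom_bijective (G := G) (A := A))).trans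
      (symEquiv G.identity_isRational A),
    fun A z U hU s => AlgebraicSupergroup.pullback_lie z U hU s,
    fun A B φ z w => AlgebraicSupergroup.lieToHom_lieMap φ z w,
    fun A t f => tangentTensorEquiv_mk _ A t f,
    fun A B φ t t' h w => tangentTensorEquiv_naturality _ φ t t' h w,
    fun A z f => symEquiv_coord _ (AlgebraicSupergroup.lieToHom z) f, fun A B φ z => ?_⟩
  -- A morphism out of `Sym(T^*)` is determined by its values on the linear functions `coord`, so
  -- naturality of `Ξ` reduces to that of `Φ`.
  refine symEquiv_eq _ (AlgebraicSupergroup.lieToHom (G.lieMap φ z)) _ fun f => ?_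
  rw [AlgebraicSupergroup.lieToHom_lieMap]
  exact congrArg φ (symEquiv_coord _ (AlgebraicSupergroup.lieToHom z) f)
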